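/- Let $-\infty<a<b<\infty$, let $\mathcal M^n$ be a smooth $n$-dimensional manifold (without boundary), and let $g(t)$, $t\in[a,b]$, be a smooth one-parameter family of complete Riemannian metrics on $\mathcal M^n$ with $\frac{\partial}{\partial t}g=2h$. Below, $\nabla$, $|\cdot|$, $\Delta=\operatorname{tr}_g\nabla\nabla$, $\operatorname{tr}_g h$ and the volume measure $d\mu$ at time $t$ are the spatial ones of $g(t)$. Let $\Psi:\mathcal M^n\times[a,b)\to(0,\infty)$, put $\psi=\log\Psi$, and for $r>0$ let $E_r=\{(x,t)\in\mathcal M^n\times[a,b):\Psi(x,t)>r^{-n}\}$. Suppose: 1. $\Psi$ is locally Lipschitz on $\mathcal M^n\times[a,s]$ for every $s\in(a,b)$. 2. There is a compact set $\Omega\subseteq\mathcal M^n$ such that $\Psi$ is bounded outside $\Omega\times[a,b)$. 3. $\bar r>0$ is such that $$\lim_{s\nearrow b}\int_{E_{\bar r}\cap(\mathcal M^n\times\{s\})}|\psi|\,d\mu=0\quad\text{and}\quad \int_{E_{\bar r}}|\nabla\psi|^2\,d\mu\,dt<\infty ,$$ and, in case $\bar r>1$, also such that the $g(s)$-volume of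 $E_{\bar r}\cap(\mathcal M^n\times\{s\})$ tends to $0$ as $s\nearrow b$. 4. $\Psi\le\bar r^{-n}$ outside some compact subset of $\mathcal M^n\times(a,b]$ (given 1 and 2 and $n\ge1$, this holds as soon as $\bar r$ is small enough). Let $\varphi$ be a smooth function on $\mathcal M^n\times(a,b]$. Then, for $r\in(0,\bar r]$, the integral $$P_{\varphi,\Psi}(r)=\int_{E_r}\bigl[|\nabla\psi|^2-(\psi+n\log r)\operatorname{tr}_g h\bigr]\varphi\,d\mu\,dt$$ converges absolutely. Let $0<r_0<r_1\le\bar r$. (i) If $\Psi$ is smooth, then on $\mathcal M^n\times(a,b)$ $$\frac{(\frac{\partial}{\partial t}+\Delta+\operatorname{tr}_g h)\Psi}{\Psi}=\frac{\partial\psi}{\partial t}+\Delta\psi+|\nabla\psi|^2+\operatorname{tr}_g h ,$$ and if this function belongs to $L^1(E_{\bar r})$ (with respect to $d\mu\,dt$), then $$\frac{P_{\varphi,\Psi}(r_1)}{r_1^n}-\frac{P_{\varphi,\Psi}(r_0)}{r_0^n}=\int_{r_0}^{r_1}\frac{n}{r^{n+1}}\int_{E_r}\Bigl[-\Bigl(\frac{\partial\psi}{\partial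 t}+\Delta\psi+|\nabla\psi|^2+\operatorname{tr}_g h\Bigr)\varphi-(\psi+n\log r)\Bigl(\frac{\partial\varphi}{\partial t}-\Delta\varphi\Bigr)\Bigr]d\mu\,dt\,dr .$$ (ii) If, instead of being smooth, $\Psi$ is only locally Lipschitz as in 1, if $(\frac{\partial}{\partial t}+\Delta+\operatorname{tr}_g h)\Psi\ge0$ on $\mathcal M^n\times(a,b)$ in the sense of distributions, that is, $\int_{\mathcal M^n\times(a,b)}\Psi\,(\Delta\eta-\frac{\partial\eta}{\partial t})\,d\mu\,dt\ge0$ for every nonnegative smooth $\eta$ with compact support in $\mathcal M^n\times(a,b)$, and if $\varphi\ge0$, then $$\frac{P_{\varphi,\Psi}(r_1)}{r_1^n}-\frac{P_{\varphi,\Psi}(r_0)}{r_0^n}\le-\int_{r_0}^{r_1}\frac{n}{r^{n+1}}\int_{E_r}(\psi+n\log r)\Bigl(\frac{\partial\varphi}{\partial t}-\Delta\varphi\Bigr)\,d\mu\,dt\,dr .$$ In (i) and (ii) all integrals on the right-hand sides converge absolutely. -/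

import Mathlib

open Set Filter Topology MeasureTheory Manifold Bundle
open scoped ContDiff ENNReal NNReal

noncomputable section

namespace HeatBall

/-- The model space `ℝⁿ` of an `n`-dimensional manifold. -/
abbrev Model (n : ℕ) : Type := EuclideanSpace ℝ (Fin n)

/-- The `i`-th standard basis vector of `ℝⁿ`. -/
abbrev stdVec {n : ℕ} (i : Fin n) : Model n := EuclideanSpace.single i (1 : ℝ)

/-- `∂f/∂t` at `p = (x, t)`. -/
def timeDeriv {M : Type*} (f : M × ℝ → ℝ) (p : M × ℝ) : ℝ :=
  deriv (fun s => f (p.1, s)) p.2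

section

variable {n : ℕ} {M : Type*} [TopologicalSpace M] [ChartedSpace (Model n) M]

variable (n M) in
/-- Smooth Riemannian metrics on an `n`-dimensional smooth manifold `M` without boundary. -/
abbrev SmoothMetric [IsManifold 𝓘(ℝ, Model n) ∞ M] : Type _ :=
  ContMDiffRiemannianMetric 𝓘(ℝ, Model n) ∞ (Model n)
    (fun x : M => TangentSpace 𝓘(ℝ, Model n) x)

variable (n M) in
/-- Fields of bilinear forms on the tangent spaces of `M`. -/
abbrev BilinField : Type _ :=
  (x : M) → TangentSpace 𝓘(ℝ, Model n) x →L[ℝ] TangentSpace 𝓘(ℝ, Model n) x →L[ℝ] ℝ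

/-! ### Calculus in charts

For `c : M`, the chart centred at `c` is `extChartAt 𝓘(ℝ, Model n) c`. -/

/-- The components `β (∂ᵢ, ∂ⱼ)` of a bilinear form field `β` in the chart centred at `c`, at the
point with coordinates `y`; here `∂ᵢ` is the image of the `i`-th standard basis vector under the
differential of the inverse chart. -/
def components (β : BilinField n M) (c : M) (y : Model n) : Matrix (Fin n) (Fin n) ℝ :=
  Matrix.of fun i j =>
    β ((extChartAt 𝓘(ℝ, Model n) c).symm y)
      (mfderiv 𝓘(ℝ, Model n) 𝓘(ℝ, Model n) (extChartAt 𝓘(ℝ, Model n) c).symm y (stdVec i))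
      (mfderiv 𝓘(ℝ, Model n) 𝓘(ℝ, Model n) (extChartAt 𝓘(ℝ, Model n) c).symm y (stdVec j))

/-- The expression of `f : M → ℝ` in the chart centred at `c`. -/
def inChart (f : M → ℝ) (c : M) (y : Model n) : ℝ :=
  f ((extChartAt 𝓘(ℝ, Model n) c).symm y)

/-- The `i`-th partial derivative of a function on `ℝⁿ`. -/
def partialDeriv (i : Fin n) (F : Model n → ℝ) (y : Model n) : ℝ :=
  fderiv ℝ F y (stdVec i)

variable [IsManifold 𝓘(ℝ, Model n) ∞ M]

/-- The matrix `(g_{ij})` of the metric in the chart centred at `c`. -/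
def gram (g : SmoothMetric n M) (c : M) (y : Model n) : Matrix (Fin n) (Fin n) ℝ :=
  components g.inner c y

/-- The volume density `√det (g_{ij})` in the chart centred at `c`. -/
def volDensity (g : SmoothMetric n M) (c : M) (y : Model n) : ℝ :=
  Real.sqrt (gram g c y).det

/-- `|∇f|²` at `x`, that is `g^{ij} ∂ᵢf ∂ⱼf`, computed in the chart centred at `x`. -/
def gradNormSq (g : SmoothMetric n M) (f : M → ℝ) (x : M) : ℝ :=
  let y := extChartAt 𝓘(ℝ, Model n) x x
  ∑ i, ∑ j, (gram g x y)⁻¹ i j * partialDeriv i (inChart f x) y * partialDeriv j (inChart f x) y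

/-- The Laplace-Beltrami operator
`Δf = (det g)^{-1/2} ∂ᵢ ((det g)^{1/2} g^{ij} ∂ⱼf)` at `x`, computed in the chart centred at `x`. -/
def laplacian (g : SmoothMetric n M) (f : M → ℝ) (x : M) : ℝ :=
  let y := extChartAt 𝓘(ℝ, Model n) x x
  (volDensity g x y)⁻¹ *
    ∑ i, partialDeriv i
      (fun z => volDensity g x z * ∑ j, (gram g x z)⁻¹ i j * partialDeriv j (inChart f x) z) y

/-- The trace `tr_g β = g^{ij} β_{ij}` at `x`, computed in the chart centred at `x`. -/
def metricTrace (g : SmoothMetric n M) (β : BilinField n M) (x : M) : ℝ :=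
  let y := extChartAt 𝓘(ℝ, Model n) x x
  ∑ i, ∑ j, (gram g x y)⁻¹ i j * components β x y i j

/-! ### Completeness, volume -/

/-- The Riemannian metric `g` is complete: every Cauchy sequence for the Riemannian distance of `g`
(the infimum of the `g`-lengths of `C¹` paths) converges. -/
def IsCompleteMetric (g : SmoothMetric n M) : Prop :=
  letI : RiemannianBundle (fun x : M => TangentSpace 𝓘(ℝ, Model n) x) := ⟨g.toRiemannianMetric⟩
  ∀ u : ℕ → M,
    (∀ ε : ℝ≥0∞, 0 < ε → ∃ N : ℕ, ∀ k ≥ N, ∀ l ≥ N,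
      riemannianEDist 𝓘(ℝ, Model n) (u k) (u l) < ε) →
    ∃ x : M, Tendsto u atTop (𝓝 x)

/-- The Riemannian volume measure `dμ` of `g`. The measure `√det (g_{ij}) dy` on the domain of a
chart does not depend on the chart, and `dμ` is the least measure on `M` that dominates
it on each chart domain; so `dμ = √det (g_{ij}) dy` on each chart domain. -/
def volumeMeasure [MeasurableSpace M] (g : SmoothMetric n M) : Measure M :=
  ⨆ c : M,
    (((volume : Measure (Model n)).restrict (extChartAt 𝓘(ℝ, Model n) c).target).withDensity
      (fun y => ENNReal.ofReal (volDensity g c y))).map (extChartAt 𝓘(ℝ, Model n) c).symm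

/-- The space-time measure `dμ dt` on `M × (a, b)`, with `dμ` the volume measure of `g t`
at time `t`: the measure on `M × ℝ` which is `√det (g_{ij}(y, t)) dy dt`
on (chart domain) `× (a, b)`, and which is zero outside `M × (a, b)`. -/
def spacetimeMeasure [MeasurableSpace M] (g : ℝ → SmoothMetric n M) (a b : ℝ) : Measure (M × ℝ) :=
  ⨆ c : M,
    (((volume : Measure (Model n × ℝ)).restrict
        ((extChartAt 𝓘(ℝ, Model n) c).target ×ˢ Ioo a b)).withDensity
      (fun q => ENNReal.ofReal (volDensity (g q.2) c q.1))).map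
        (fun q => ((extChartAt 𝓘(ℝ, Model n) c).symm q.1, q.2))

/-! ### Evolving metrics -/

/-- `g` is a smooth family of metrics on `M` for `t ∈ [a, b]`: jointly smooth on `M × [a, b]`. -/
def IsSmoothFamily (g : ℝ → SmoothMetric n M) (a b : ℝ) : Prop :=
  ContMDiffOn (𝓘(ℝ, Model n).prod 𝓘(ℝ, ℝ))
    (𝓘(ℝ, Model n).prod 𝓘(ℝ, Model n →L[ℝ] Model n →L[ℝ] ℝ)) ∞
    (fun p : M × ℝ =>
      (TotalSpace.mk' (Model n →L[ℝ] Model n →L[ℝ] ℝ) p.1 ((g p.2).inner p.1) :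
        TotalSpace (Model n →L[ℝ] Model n →L[ℝ] ℝ) (fun x : M =>
          TangentSpace 𝓘(ℝ, Model n) x →L[ℝ] TangentSpace 𝓘(ℝ, Model n) x →L[ℝ] ℝ)))
    (univ ×ˢ Icc a b)

/-- `∂g/∂t = 2h` for `t ∈ [a, b]` (one-sided at the end points). -/
def EvolvesBy (g : ℝ → SmoothMetric n M) (h : ℝ → BilinField n M) (a b : ℝ) : Prop :=
  ∀ t ∈ Icc a b, ∀ x : M, ∀ v w : TangentSpace 𝓘(ℝ, Model n) x,
    HasDerivWithinAt (fun s => (g s).inner x v w) (2 * h t x v w) (Icc a b) t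

/-- The Laplacian at `p = (x, t)` of the time slice at time `t`, with respect to `g t`. -/
def spaceLaplacian (g : ℝ → SmoothMetric n M) (f : M × ℝ → ℝ) (p : M × ℝ) : ℝ :=
  laplacian (g p.2) (fun x => f (x, p.2)) p.1

/-- The spatial `|∇f|²` at `p = (x, t)`, with respect to `g t`. -/
def spaceGradNormSq (g : ℝ → SmoothMetric n M) (f : M × ℝ → ℝ) (p : M × ℝ) : ℝ :=
  gradNormSq (g p.2) (fun x => f (x, p.2)) p.1

/-- `tr_g h` at `p = (x, t)`. -/
def trH (g : ℝ → SmoothMetric n M) (h : ℝ → BilinField n M) (p : M × ℝ) : ℝ :=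
  metricTrace (g p.2) (h p.2) p.1

/-! ### The data of the theorem

In the following `Ψ : M × ℝ → ℝ` stands for a positive function on `M × [a, b)`, and `φ` for
a function on `M × (a, b]`; values at other times are irrelevant. -/

/-- `f` is locally Lipschitz on `M × S`: each point of `M × S` has, in the coordinates given by a
chart of `M`, a neighbourhood in `M × S` where `f` is Lipschitz. -/
def IsLocallyLipschitz (n : ℕ) {M : Type*} [TopologicalSpace M] [ChartedSpace (Model n) M]
    (f : M × ℝ → ℝ) (S : Set ℝ) : Prop :=
  ∀ x : M, ∀ t ∈ S, ∃ C : ℝ≥0,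
    ∃ U ∈ 𝓝[univ ×ˢ S] ((extChartAt 𝓘(ℝ, Model n) x x, t) : Model n × ℝ),
      LipschitzOnWith C
        (fun q : Model n × ℝ => f ((extChartAt 𝓘(ℝ, Model n) x).symm q.1, q.2)) U

/-- The distributional inequality `(∂/∂t + Δ + tr_g h) Ψ ≥ 0` on `M × (a, b)`. Since
`∂(dμ)/∂t = (tr_g h) dμ`, the operator `∂/∂t + Δ + tr_g h` is, with respect to `dμ dt`, the formal
adjoint of `-∂/∂t + Δ`, which acts here on the nonnegative test functions. -/
def IsDistribSubsolution [MeasurableSpace M] (g : ℝ → SmoothMetric n M) (a b : ℝ)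
    (Ψ : M × ℝ → ℝ) : Prop :=
  ∀ η : M × ℝ → ℝ,
    ContMDiff (𝓘(ℝ, Model n).prod 𝓘(ℝ, ℝ)) 𝓘(ℝ, ℝ) ∞ η →
    HasCompactSupport η → tsupport η ⊆ univ ×ˢ Ioo a b → (∀ p, 0 ≤ η p) →
    0 ≤ ∫ p, Ψ p * (spaceLaplacian g η p - timeDeriv η p) ∂(spacetimeMeasure g a b)

/-- `ψ = log Ψ`. -/
def logFun {M : Type*} (Ψ : M × ℝ → ℝ) (p : M × ℝ) : ℝ := Real.log (Ψ p)

/-- The heatball `E_r = {(x, t) ∈ M × [a, b) : Ψ (x, t) > r⁻ⁿ}`. -/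
def heatball {M : Type*} (n : ℕ) (a b : ℝ) (Ψ : M × ℝ → ℝ) (r : ℝ) : Set (M × ℝ) :=
  {p | p.2 ∈ Ico a b ∧ (r ^ n)⁻¹ < Ψ p}

/-- The time slice `{x : (x, s) ∈ E}` of a set `E` in space-time. -/
def timeSlice {M : Type*} (E : Set (M × ℝ)) (s : ℝ) : Set M := {x | (x, s) ∈ E}

/-- First assumption: `Ψ` is locally Lipschitz on `M × [a, s]` for any `s ∈ (a, b)`. -/
def AssumptionLipschitz (n : ℕ) {M : Type*} [TopologicalSpace M] [ChartedSpace (Model n) M]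
    (a b : ℝ) (Ψ : M × ℝ → ℝ) : Prop :=
  ∀ s ∈ Ioo a b, IsLocallyLipschitz n Ψ (Icc a s)

/-- Second assumption: `Ψ` is bounded outside `Ω × [a, b)` for some compact `Ω ⊆ M`. -/
def AssumptionBounded {M : Type*} [TopologicalSpace M] (a b : ℝ) (Ψ : M × ℝ → ℝ) : Prop :=
  ∃ Ω : Set M, IsCompact Ω ∧ ∃ C : ℝ, ∀ x ∉ Ω, ∀ t ∈ Ico a b, |Ψ (x, t)| ≤ C

/-- Third assumption, for the radius `rbar`: `∫_{E_rbar ∩ (M × {s})} |ψ| dμ → 0` as `s ↗ b`, and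
`∫_{E_rbar} |∇ψ|² dμ dt < ∞`. For a radius `rbar > 1` the volume of `E_rbar ∩ (M × {s})` is also
required to tend to zero. -/
def AssumptionRadius [MeasurableSpace M] (g : ℝ → SmoothMetric n M) (a b : ℝ) (Ψ : M × ℝ → ℝ)
    (rbar : ℝ) : Prop :=
  Tendsto
    (fun s => ∫⁻ x in timeSlice (heatball n a b Ψ rbar) s, ENNReal.ofReal |logFun Ψ (x, s)|
      ∂(volumeMeasure (g s)))
    (𝓝[<] b) (𝓝 0) ∧
  ∫⁻ p in heatball n a b Ψ rbar, ENNReal.ofReal (spaceGradNormSq g (logFun Ψ) p)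
    ∂(spacetimeMeasure g a b) < ⊤ ∧
  (1 < rbar →
    Tendsto (fun s => volumeMeasure (g s) (timeSlice (heatball n a b Ψ rbar) s))
      (𝓝[<] b) (𝓝 0))

/-- `Ψ ≤ rbar⁻ⁿ` outside some compact subset of `M × (a, b]`. -/
def IsSmallOutsideCompact {M : Type*} [TopologicalSpace M] (n : ℕ) (a b : ℝ) (Ψ : M × ℝ → ℝ)
    (rbar : ℝ) : Prop :=
  ∃ K : Set (M × ℝ), IsCompact K ∧ K ⊆ univ ×ˢ Ioc a b ∧
    ∀ x : M, ∀ t ∈ Ico a b, (x, t) ∉ K → Ψ (x, t) ≤ (rbar ^ n)⁻¹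

/-- `(∂Ψ/∂t + ΔΨ + (tr_g h) Ψ) / Ψ`. -/
def conjHeatQuotient (g : ℝ → SmoothMetric n M) (h : ℝ → BilinField n M) (Ψ : M × ℝ → ℝ)
    (p : M × ℝ) : ℝ :=
  (timeDeriv Ψ p + spaceLaplacian g Ψ p + trH g h p * Ψ p) / Ψ p

/-- `∂ψ/∂t + Δψ + |∇ψ|² + tr_g h`, with `ψ = log Ψ`. -/
def logConjHeat (g : ℝ → SmoothMetric n M) (h : ℝ → BilinField n M) (Ψ : M × ℝ → ℝ)
    (p : M × ℝ) : ℝ :=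
  timeDeriv (logFun Ψ) p + spaceLaplacian g (logFun Ψ) p + spaceGradNormSq g (logFun Ψ) p
    + trH g h p

/-- `∂φ/∂t - Δφ`. -/
def heatOp (g : ℝ → SmoothMetric n M) (φ : M × ℝ → ℝ) (p : M × ℝ) : ℝ :=
  timeDeriv φ p - spaceLaplacian g φ p

/-- The integrand `[|∇ψ|² - (ψ + n log r) tr_g h] φ` of `P_{φ,Ψ}(r)`. -/
def integrandP (g : ℝ → SmoothMetric n M) (h : ℝ → BilinField n M) (φ Ψ : M × ℝ → ℝ) (r : ℝ)
    (p : M × ℝ) : ℝ :=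
  (spaceGradNormSq g (logFun Ψ) p - (logFun Ψ p + n * Real.log r) * trH g h p) * φ p

/-- `P_{φ,Ψ}(r) = ∫_{E_r} [|∇ψ|² - (ψ + n log r) tr_g h] φ dμ dt`. -/
def functionalP [MeasurableSpace M] (g : ℝ → SmoothMetric n M) (h : ℝ → BilinField n M) (a b : ℝ)
    (φ Ψ : M × ℝ → ℝ) (r : ℝ) : ℝ :=
  ∫ p in heatball n a b Ψ r, integrandP g h φ Ψ r p ∂(spacetimeMeasure g a b)

end

end HeatBall

end

open HeatBall

/-!
# The local monotonicity formula for the heatball functional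

Put `Rᵢ = rᵢ^{-n}`, so `R₁ ≤ R₀`, and integrate over the radius first. A point with `Ψ = y`
belongs to `E_r` exactly when `y > r^{-n}`, so it contributes the weights

* `A(y) = ∫_{r₀}^{r₁} n r^{-n-1} 1_{y > r^{-n}} dr = min R₀ y - min R₁ y` (`levelA`),
* `B(y) = ∫_{r₀}^{r₁} n r^{-n-1} (log y + n log r)₊ dr` (`levelB`),

and Fubini's theorem (`integral_radial_swap`, `integral_radius`) turns the iterated integrals on
the right-hand sides into integrals over `E_{rbar}` alone. On the left-hand side,
`P(r₀) / r₀ⁿ - P(r₁) / r₁ⁿ` is the integral of `J φ`, where `J` is the function (`gapFun`)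

  `J = (R₀ 1_{Ψ > R₀} - R₁ 1_{Ψ > R₁}) |∇ψ|² + (A(Ψ) - B(Ψ)) tr_g h`.

The formula is therefore equivalent to

  `∫ J φ = ∫ A(Ψ) ((∂/∂t + Δ + tr_g h) Ψ / Ψ) φ + ∫ B(Ψ) (∂φ/∂t - Δφ)`,

and the inequality says that `∫ J φ - ∫ B(Ψ) (∂φ/∂t - Δφ) ≥ 0`.

For `φ` with compact support in a chart this follows by testing the weak form of
`(∂/∂t + Δ + tr_g h) Ψ` with the Lipschitz function `A(Ψ) φ / Ψ` (`HeatCoeff.integral_gap`).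
Since `B` is a primitive of `A` as a function of `log y`, integration by parts of `B(Ψ)` against
`∂φ/∂t - Δφ` produces the terms with `∇φ` and `∂ψ/∂t`; the corners of `A` do no harm because a
Lipschitz function has vanishing gradient almost everywhere on each of its level sets. For smooth
`Ψ` the weak form is the classical one. If `Ψ` is only a distributional subsolution, mollification
of the test function shows that the weak form is nonnegative (`HeatCoeff.integral_weak_nonneg`).
This local computation uses only that the volume density `v` satisfies `∂v/∂t = (tr_g h) v`, which
is Jacobi's formula for the determinant (`hasDerivAt_volDensity`).

To work on the manifold, the differential operators and measures, which are defined by particular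
charts, have to be compared in different charts; for the Laplacian this is done through its weak
formulation (`lap_transition`). A partition of unity then gives the identity for all test
functions with compact support in `M × (a, b)` (`integral_gapFun`). Finally `φ` is cut off near
the final time. The error is the integral of `B(Ψ) φ` against the time derivative of the cut-off,
and it tends to zero since `B(Ψ)` is bounded by a multiple of `|ψ|` (plus a constant if
`rbar > 1`), whose slice integrals tend to zero (`tendsto_integral_levelB_deriv`,
`integral_gapFun_superlevel`).
-/

noncomputable section

set_option linter.unusedSectionVars false

namespace HeatBall

/-! ### Lipschitz functions on a finite-dimensional space -/

section Lipschitz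

variable {E : Type*} [NormedAddCommGroup E] [NormedSpace ℝ E] [FiniteDimensional ℝ E]
  [MeasurableSpace E] [BorelSpace E] {μ : Measure E} [μ.IsAddHaarMeasure]

theorem integral_mul_fderiv_eq_neg {F w : E → ℝ} {C : ℝ≥0} (hF : LipschitzWith C F)
    (hw : ContDiff ℝ 1 w) (hwc : HasCompactSupport w) (e : E) :
    ∫ q, F q * fderiv ℝ w q e ∂μ = -∫ q, fderiv ℝ F q e * w q ∂μ := by
  obtain ⟨D, hD⟩ := hw.lipschitzWith_of_hasCompactSupport hwc one_ne_zero
  have h := hF.integral_lineDeriv_mul_eq (μ := μ) hD hwc e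
  have h1 : ∫ q, fderiv ℝ F q e * w q ∂μ = ∫ q, lineDeriv ℝ F q e * w q ∂μ := by
    apply integral_congr_ae
    filter_upwards [hF.ae_differentiableAt (μ := μ)] with q hq
    rw [hq.lineDeriv_eq_fderiv]
  rw [h1, h, ← integral_neg]
  apply integral_congr_ae
  filter_upwards with q
  rw [(hw.differentiable one_ne_zero q).lineDeriv_eq_fderiv]
  simp [mul_comm]

/-- A Lipschitz function has zero derivative at almost every point of a level set: where `|u - R|`
is differentiable it has a minimum on the level set, so its derivative vanishes there. -/
theorem ae_fderiv_eq_zero_of_level {u : E → ℝ} {C : ℝ≥0} (hu : LipschitzWith C u) (R : ℝ) :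
    ∀ᵐ q ∂μ, u q = R → fderiv ℝ u q = 0 := by
  have h1 : LipschitzWith C (fun q => |u q - R|) := by
    have := (lipschitzWith_one_norm (E := ℝ)).comp (hu.sub (LipschitzWith.const R))
    simpa [Function.comp_def] using this
  filter_upwards [h1.ae_differentiableAt (μ := μ)] with q hq hR
  have h0 : fderiv ℝ (fun q => |u q - R|) q = 0 := by
    apply IsLocalMin.fderiv_eq_zero
    filter_upwards with x
    simp [hR]
  have h2 := hq.hasFDerivAt
  rw [h0] at h2
  apply HasFDerivAt.fderiv
  rw [hasFDerivAt_iff_isLittleO] at h2 ⊢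
  refine Asymptotics.IsBigO.trans_isLittleO (Asymptotics.IsBigO.of_bound 1 ?_) h2
  filter_upwards with x
  simp [hR]

/-- At a point of the level set the derivative of `min R u` exists because that of `u` vanishes. -/
theorem hasFDerivAt_min_const {u : E → ℝ} {q : E} {u' : E →L[ℝ] ℝ} (hu : HasFDerivAt u u' q)
    {R : ℝ} (hR : u q = R → u' = 0) :
    HasFDerivAt (fun x => min R (u x)) ((if R < u q then (0 : ℝ) else 1) • u') q := by
  rcases lt_trichotomy (u q) R with h | h | h
  · rw [if_neg h.not_gt, one_smul]
    refine hu.congr_of_eventuallyEq ?_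
    filter_upwards [hu.continuousAt.eventually_lt continuousAt_const h] with x hx
    exact min_eq_right hx.le
  · rw [hR h, smul_zero]
    rw [hR h] at hu
    rw [hasFDerivAt_iff_isLittleO] at hu ⊢
    refine Asymptotics.IsBigO.trans_isLittleO (Asymptotics.IsBigO.of_bound 1 ?_) hu
    filter_upwards with x
    simp only [h, min_self, zero_apply, sub_zero, one_mul]
    rw [Real.norm_eq_abs, Real.norm_eq_abs]
    rcases le_total R (u x) with h2 | h2
    · simp [min_eq_left h2]
    · simp [min_eq_right h2]
  · rw [if_pos h, zero_smul]
    refine (hasFDerivAt_const R q).congr_of_eventuallyEq ?_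
    filter_upwards [continuousAt_const.eventually_lt hu.continuousAt h] with x hx
    exact min_eq_left hx.le

/-- Near a compact subset of an open set, a positive locally Lipschitz function agrees with
a globally Lipschitz one with positive bounds. -/
theorem exists_lipschitzWith_eqOn {D K : Set E} (hD : IsOpen D) (hK : IsCompact K) (hKD : K ⊆ D)
    {u : E → ℝ} (hu : ∀ x ∈ D, ∃ C : ℝ≥0, ∃ U ∈ 𝓝 x, LipschitzOnWith C u U)
    (hpos : ∀ x ∈ D, 0 < u x) :
    ∃ (w : E → ℝ) (C : ℝ≥0) (m : ℝ) (B : ℝ), LipschitzWith C w ∧ 0 < m ∧ (∀ x, m ≤ w x) ∧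
      (∀ x, w x ≤ B) ∧ ∃ D', IsOpen D' ∧ K ⊆ D' ∧ D' ⊆ D ∧ EqOn u w D' := by
  obtain ⟨K2, hK2, h1, h2⟩ := exists_compact_between hK hD hKD
  rcases K2.eq_empty_or_nonempty with he | hne
  · refine ⟨fun _ => 1, 0, 1, 1, LipschitzWith.const 1, one_pos, fun _ => le_rfl, fun _ => le_rfl,
      ∅, isOpen_empty, ?_, empty_subset _, by simp⟩
    rw [he] at h1
    simpa using h1
  have hll : LocallyLipschitzOn K2 u := by
    intro x hx
    obtain ⟨C, U, hU, hC⟩ := hu x (h2 hx)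
    exact ⟨C, U, mem_nhdsWithin_of_mem_nhds hU, hC⟩
  obtain ⟨C, hC⟩ := hll.exists_lipschitzOnWith_of_compact hK2
  obtain ⟨w, hw, hwe⟩ := hC.extend_real
  obtain ⟨x0, hx0, hmin⟩ := hK2.exists_isMinOn hne hC.continuousOn
  obtain ⟨x1, hx1, hmax⟩ := hK2.exists_isMaxOn hne hC.continuousOn
  refine ⟨fun x => max (u x0) (min (u x1) (w x)), C, u x0, max (u x0) (u x1), ?_,
    hpos _ (h2 hx0), fun x => le_max_left _ _, fun x => max_le_max le_rfl (min_le_left _ _),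
    interior K2, isOpen_interior, h1, interior_subset.trans h2, ?_⟩
  · exact (hw.const_min _).const_max _
  · intro x hx
    have hx' := interior_subset hx
    have e1 := hmin hx'
    have e2 := hmax hx'
    simp only [mem_ofPred_eq] at e1 e2
    simp only
    rw [← hwe hx', min_eq_right e2, max_eq_right e1]

end Lipschitz

/-! ### Mollification of a Lipschitz function -/

section Mollify

variable {E : Type*} [NormedAddCommGroup E] [NormedSpace ℝ E] [FiniteDimensional ℝ E]
  [MeasurableSpace E] [BorelSpace E] (μ : Measure E) [μ.IsAddHaarMeasure]

/-- The mollification of `ζ` by the normalised bump function `ρ`. -/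
def mollify (ρ : ContDiffBump (0 : E)) (ζ : E → ℝ) : E → ℝ :=
  convolution (ρ.normed μ) ζ (ContinuousLinearMap.lsmul ℝ ℝ) μ

variable {μ}

theorem mollify_apply (ρ : ContDiffBump (0 : E)) (ζ : E → ℝ) (x : E) :
    mollify μ ρ ζ x = ∫ t, ρ.normed μ t * ζ (x - t) ∂μ := by
  simp [mollify, convolution_def]

theorem contDiff_mollify (ρ : ContDiffBump (0 : E)) {ζ : E → ℝ} (hζ : Continuous ζ) :
    ContDiff ℝ ∞ (mollify μ ρ ζ) :=
  HasCompactSupport.contDiff_convolution_left _ ρ.hasCompactSupport_normed ρ.contDiff_normed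
    hζ.locallyIntegrable

theorem mollify_nonneg (ρ : ContDiffBump (0 : E)) {ζ : E → ℝ} (hζ : ∀ x, 0 ≤ ζ x) (x : E) :
    0 ≤ mollify μ ρ ζ x := by
  rw [mollify_apply]
  exact integral_nonneg fun t => mul_nonneg (ρ.nonneg_normed t) (hζ _)

theorem abs_mollify_le (ρ : ContDiffBump (0 : E)) {ζ : E → ℝ} {Z : ℝ} (hζ : ∀ x, |ζ x| ≤ Z)
    (x : E) : |mollify μ ρ ζ x| ≤ Z := by
  rw [mollify_apply]
  calc |∫ t, ρ.normed μ t * ζ (x - t) ∂μ| ≤ ∫ t, ρ.normed μ t * Z ∂μ := by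
        rw [← Real.norm_eq_abs]
        apply norm_integral_le_of_norm_le (ρ.integrable_normed.mul_const Z)
        filter_upwards with t
        rw [norm_mul, Real.norm_of_nonneg (ρ.nonneg_normed t)]
        exact mul_le_mul_of_nonneg_left (hζ _) (ρ.nonneg_normed t)
    _ = Z := by rw [integral_mul_const, ρ.integral_normed, one_mul]

theorem support_mollify_subset (ρ : ContDiffBump (0 : E)) {ζ : E → ℝ} {δ : ℝ} (hδ : ρ.rOut ≤ δ) :
    Function.support (mollify μ ρ ζ) ⊆ Metric.cthickening δ (tsupport ζ) := by
  intro x hx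
  rw [Function.mem_support, mollify_apply] at hx
  by_contra hcon
  apply hx
  rw [integral_eq_zero_of_ae]
  filter_upwards with t
  by_cases ht : t ∈ Metric.ball (0 : E) ρ.rOut
  · have : ζ (x - t) = 0 := by
      by_contra h0
      apply hcon
      apply Metric.mem_cthickening_of_dist_le x (x - t) δ _ (subset_tsupport _ h0)
      rw [dist_eq_norm]
      simp only [Metric.mem_ball, dist_zero_right] at ht
      simpa using ht.le.trans hδ
    simp [this]
  · have : ρ.normed μ t = 0 := by
      rw [← Function.notMem_support, ρ.support_normed_eq]
      exact ht
    simp [this]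

/-- Mollification commutes with differentiation; the difference quotients of a Lipschitz function
are bounded, so the integral can be differentiated. -/
theorem fderiv_mollify (ρ : ContDiffBump (0 : E)) {ζ : E → ℝ} {C : ℝ≥0} (hζ : LipschitzWith C ζ)
    (e x : E) :
    fderiv ℝ (mollify μ ρ ζ) x e = mollify μ ρ (fun y => fderiv ℝ ζ y e) x := by
  have hd : DifferentiableAt ℝ (mollify μ ρ ζ) x :=
    (contDiff_mollify ρ hζ.continuous).differentiable (by simp) x
  have hline : HasDerivAt (fun s : ℝ => mollify μ ρ ζ (x + s • e))
      (fderiv ℝ (mollify μ ρ ζ) x e) 0 := by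
    have h1 : HasDerivAt (fun s : ℝ => x + s • e) e 0 := by
      simpa using ((hasDerivAt_id (0 : ℝ)).smul_const e).const_add x
    have h2 : HasFDerivAt (mollify μ ρ ζ) (fderiv ℝ (mollify μ ρ ζ) x) (x + (0 : ℝ) • e) := by
      simpa using hd.hasFDerivAt
    exact h2.comp_hasDerivAt (0 : ℝ) h1
  have hcont : ∀ s : ℝ, Continuous fun t => ρ.normed μ t * ζ (x + s • e - t) := fun s =>
    ρ.continuous_normed.mul (hζ.continuous.comp (by fun_prop))
  have hint := hasDerivAt_integral_of_dominated_loc_of_lip (μ := μ) (𝕜 := ℝ)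
    (F := fun s t => ρ.normed μ t * ζ (x + s • e - t)) (x₀ := 0) (s := univ)
    (F' := fun t => ρ.normed μ t * fderiv ℝ ζ (x - t) e)
    (bound := fun t => ρ.normed μ t * (C * ‖e‖)) univ_mem
    (Eventually.of_forall fun s => (hcont s).aestronglyMeasurable)
    ((hcont 0).integrable_of_hasCompactSupport (ρ.hasCompactSupport_normed.mul_right))
    (by
      apply Measurable.aestronglyMeasurable
      exact ρ.continuous_normed.measurable.mul
        ((measurable_fderiv_apply_const ℝ ζ e).comp (measurable_const.sub measurable_id)))
    (by
      filter_upwards with t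
      apply LipschitzWith.lipschitzOnWith
      apply LipschitzWith.of_dist_le_mul
      intro s s'
      have h1 := hζ.dist_le_mul (x + s • e - t) (x + s' • e - t)
      have h2 : dist (x + s • e - t) (x + s' • e - t) = dist s s' * ‖e‖ := by
        rw [dist_eq_norm, Real.dist_eq, ← Real.norm_eq_abs, ← norm_smul]
        congr 1
        rw [sub_smul]; abel
      rw [h2] at h1
      have h3 : 0 ≤ ρ.normed μ t * (C * ‖e‖) :=
        mul_nonneg (ρ.nonneg_normed t) (by positivity)
      rw [Real.coe_nnabs, abs_of_nonneg h3, Real.dist_eq, ← mul_sub, abs_mul,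
        abs_of_nonneg (ρ.nonneg_normed t), ← Real.dist_eq, mul_assoc]
      apply mul_le_mul_of_nonneg_left _ (ρ.nonneg_normed t)
      linarith)
    (ρ.integrable_normed.mul_const _)
    (by
      have h1 : ∀ᵐ t ∂μ, DifferentiableAt ℝ ζ (x - t) :=
        (quasiMeasurePreserving_sub_left μ x).ae hζ.ae_differentiableAt
      filter_upwards [h1] with t ht
      apply HasDerivAt.const_mul
      have h1 : HasDerivAt (fun s : ℝ => x + s • e - t) e 0 := by
        simpa using (((hasDerivAt_id (0 : ℝ)).smul_const e).const_add x).sub_const t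
      have h2 : HasFDerivAt ζ (fderiv ℝ ζ (x - t)) (x + (0 : ℝ) • e - t) := by
        simpa using ht.hasFDerivAt
      exact h2.comp_hasDerivAt (0 : ℝ) h1)
  have h3 := hint.2
  simp only [← mollify_apply] at h3
  exact hline.unique h3

theorem abs_fderiv_mollify_le (ρ : ContDiffBump (0 : E)) {ζ : E → ℝ} {C : ℝ≥0}
    (hζ : LipschitzWith C ζ) (e x : E) : |fderiv ℝ (mollify μ ρ ζ) x e| ≤ C * ‖e‖ := by
  rw [fderiv_mollify ρ hζ]
  apply abs_mollify_le
  intro y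
  rw [← Real.norm_eq_abs]
  exact (ContinuousLinearMap.le_opNorm _ _).trans
    (mul_le_mul_of_nonneg_right (norm_fderiv_le_of_lipschitz ℝ hζ) (norm_nonneg e))

theorem locallyIntegrable_fderiv_apply {ζ : E → ℝ} {C : ℝ≥0} (hζ : LipschitzWith C ζ) (e : E) :
    LocallyIntegrable (fun x => fderiv ℝ ζ x e) μ := by
  apply (MeasureTheory.locallyIntegrable_const (C * ‖e‖ : ℝ)).mono
    (measurable_fderiv_apply_const ℝ ζ e).aestronglyMeasurable
  filter_upwards with y
  rw [Real.norm_of_nonneg (by positivity : (0:ℝ) ≤ C * ‖e‖)]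
  exact (ContinuousLinearMap.le_opNorm _ _).trans
    (mul_le_mul_of_nonneg_right (norm_fderiv_le_of_lipschitz ℝ hζ) (norm_nonneg e))

/-- Nonnegative Lipschitz functions with compact support are limits of smooth ones, with bounded
a.e. convergence of the functions and of all their directional derivatives. -/
theorem exists_smooth_approx {ζ : E → ℝ} {C : ℝ≥0} (hζ : LipschitzWith C ζ)
    (hζc : HasCompactSupport ζ) (hζ0 : ∀ x, 0 ≤ ζ x) {D : Set E} (hD : IsOpen D)
    (hζD : tsupport ζ ⊆ D) :
    ∃ (K : Set E) (η : ℕ → E → ℝ) (Z : ℝ), IsCompact K ∧ K ⊆ D ∧ tsupport ζ ⊆ K ∧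
      (∀ k, ContDiff ℝ ∞ (η k)) ∧ (∀ k, tsupport (η k) ⊆ K) ∧ (∀ k x, 0 ≤ η k x) ∧
      (∀ k x, |η k x| ≤ Z) ∧ (∀ k x e, |fderiv ℝ (η k) x e| ≤ C * ‖e‖) ∧
      (∀ x, Tendsto (fun k => η k x) atTop (𝓝 (ζ x))) ∧
      ∀ e, ∀ᵐ x ∂μ, Tendsto (fun k => fderiv ℝ (η k) x e) atTop (𝓝 (fderiv ℝ ζ x e)) := by
  obtain ⟨δ, hδ, hδD⟩ := hζc.isCompact.exists_cthickening_subset_open hD hζD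
  have hr : ∀ k : ℕ, 0 < δ / (2 * (k + 1)) := fun k => by positivity
  -- the ratio of the two radii stays bounded, as Lebesgue differentiation requires
  let ρ : ℕ → ContDiffBump (0 : E) := fun k =>
    ⟨δ / (2 * (k + 1)), 2 * (δ / (2 * (k + 1))), hr k, by linarith [hr k]⟩
  have hle : ∀ k, (ρ k).rOut ≤ δ := fun k => by
    change 2 * (δ / (2 * ((k : ℝ) + 1))) ≤ δ
    have : (2 : ℝ) * (δ / (2 * ((k : ℝ) + 1))) = δ / (k + 1) := by field_simp
    rw [this]
    apply div_le_self hδ.le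
    have : (0 : ℝ) ≤ k := by positivity
    linarith
  have hlim : Tendsto (fun k => (ρ k).rOut) atTop (𝓝 0) := by
    have h1 : Tendsto (fun k : ℕ => δ * (1 / ((k : ℝ) + 1))) atTop (𝓝 (δ * 0)) :=
      tendsto_one_div_add_atTop_nhds_zero_nat.const_mul δ
    rw [mul_zero] at h1
    refine h1.congr fun k => ?_
    change δ * (1 / ((k : ℝ) + 1)) = 2 * (δ / (2 * ((k : ℝ) + 1)))
    field_simp
  obtain ⟨Z, hZ⟩ := hζ.continuous.bounded_above_of_compact_support hζc
  refine ⟨Metric.cthickening δ (tsupport ζ), fun k => mollify μ (ρ k) ζ, Z,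
    hζc.isCompact.cthickening, hδD, Metric.self_subset_cthickening _,
    fun k => contDiff_mollify _ hζ.continuous, fun k => ?_, fun k => mollify_nonneg _ hζ0,
    fun k => abs_mollify_le _ hZ, fun k x e => abs_fderiv_mollify_le _ hζ e x, fun x => ?_,
    fun e => ?_⟩
  · exact closure_minimal (support_mollify_subset _ (hle k)) Metric.isClosed_cthickening
  · exact ContDiffBump.convolution_tendsto_right_of_continuous hlim hζ.continuous x
  · have h := ContDiffBump.ae_convolution_tendsto_right_of_locallyIntegrable (μ := μ) (φ := ρ)
      (l := atTop) (K := 2) hlim (Eventually.of_forall fun k => le_rfl)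
      (locallyIntegrable_fderiv_apply (μ := μ) hζ e)
    filter_upwards [h] with x hx
    simp only [fderiv_mollify _ hζ]
    exact hx

end Mollify

/-! ### Essentially bounded functions -/

section EssBdd

variable {X : Type*} [MeasurableSpace X] {μ : Measure X}

/-- `F` is measurable and bounded, up to null sets. -/
def EssBdd (μ : Measure X) (F : X → ℝ) : Prop :=
  AEStronglyMeasurable F μ ∧ ∃ C, ∀ᵐ x ∂μ, |F x| ≤ C

theorem EssBdd.mul {F H : X → ℝ} (hF : EssBdd μ F) (hH : EssBdd μ H) :
    EssBdd μ (fun x => F x * H x) := by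
  obtain ⟨mF, C, hC⟩ := hF
  obtain ⟨mH, D, hD⟩ := hH
  refine ⟨mF.mul mH, C * D, ?_⟩
  filter_upwards [hC, hD] with x h1 h2
  rw [abs_mul]
  exact mul_le_mul h1 h2 (abs_nonneg _) ((abs_nonneg _).trans h1)

theorem EssBdd.add {F H : X → ℝ} (hF : EssBdd μ F) (hH : EssBdd μ H) :
    EssBdd μ (fun x => F x + H x) := by
  obtain ⟨mF, C, hC⟩ := hF
  obtain ⟨mH, D, hD⟩ := hH
  refine ⟨mF.add mH, C + D, ?_⟩
  filter_upwards [hC, hD] with x h1 h2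
  exact (abs_add_le _ _).trans (add_le_add h1 h2)

theorem EssBdd.neg {F : X → ℝ} (hF : EssBdd μ F) : EssBdd μ (fun x => -F x) := by
  obtain ⟨mF, C, hC⟩ := hF
  refine ⟨mF.neg, C, ?_⟩
  filter_upwards [hC] with x h1
  rwa [abs_neg]

theorem EssBdd.sub {F H : X → ℝ} (hF : EssBdd μ F) (hH : EssBdd μ H) :
    EssBdd μ (fun x => F x - H x) := by
  simpa only [sub_eq_add_neg] using hF.add hH.neg

theorem EssBdd.const (c : ℝ) : EssBdd μ (fun _ => c) :=
  ⟨aestronglyMeasurable_const, |c|, Eventually.of_forall fun _ => le_rfl⟩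

theorem EssBdd.sum {ι : Type*} (s : Finset ι) {F : ι → X → ℝ} (hF : ∀ i ∈ s, EssBdd μ (F i)) :
    EssBdd μ (fun x => ∑ i ∈ s, F i x) := by
  classical
  induction s using Finset.induction_on with
  | empty => simpa using EssBdd.const (μ := μ) 0
  | insert a s ha ih =>
    simp only [Finset.sum_insert ha]
    exact (hF a (by simp)).add (ih fun i hi => hF i (by simp [hi]))

theorem EssBdd.integrable [IsFiniteMeasure μ] {F : X → ℝ} (hF : EssBdd μ F) : Integrable F μ := by
  obtain ⟨mF, C, hC⟩ := hF
  exact Integrable.of_bound mF C hC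

variable [TopologicalSpace X] [BorelSpace X] [IsFiniteMeasureOnCompacts μ]

theorem EssBdd.of_continuousOn {K : Set X} (hK : IsCompact K) (hKm : MeasurableSet K) {F : X → ℝ}
    (hF : ContinuousOn F K) : EssBdd (μ.restrict K) F := by
  refine ⟨hF.aestronglyMeasurable hKm, ?_⟩
  obtain ⟨C, hC⟩ := hK.exists_bound_of_continuousOn hF
  exact ⟨C, (ae_restrict_iff' hKm).2 (Eventually.of_forall hC)⟩

theorem EssBdd.integrable_of_zero {K : Set X} (hK : IsCompact K) {F : X → ℝ}
    (hF : EssBdd (μ.restrict K) F) (h0 : ∀ q ∉ K, F q = 0) : Integrable F μ := by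
  have : IsFiniteMeasure (μ.restrict K) := ⟨by simpa using hK.measure_lt_top⟩
  rw [← integrableOn_iff_integrable_of_support_subset (s := K)]
  · exact hF.integrable
  · intro q hq
    by_contra h
    exact hq (h0 q h)

end EssBdd

/-! ### The two level functions -/

/-- `A(y) = min R₀ y - min R₁ y`, which is `∫_{r₀}^{r₁} n r^{-n-1} 1_{y > r^{-n}} dr` for
`Rᵢ = rᵢ^{-n}`. -/
def levelA (R₁ R₀ y : ℝ) : ℝ := min R₀ y - min R₁ y

/-- `B(y) = ∫_{r₀}^{r₁} n r^{-n-1} (log y + n log r)₊ dr` for `Rᵢ = rᵢ^{-n}`, in closed form; as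
a function of `log y` it is a primitive of `A(y)`. -/
def levelB (R₁ R₀ y : ℝ) : ℝ :=
  levelA R₁ R₀ y - R₁ * max 0 (Real.log y - Real.log R₁) + R₀ * max 0 (Real.log y - Real.log R₀)

theorem hasDerivAt_min_add_log {R y : ℝ} (hR : 0 < R) (hy : 0 < y) :
    HasDerivAt (fun y => min R y + R * max 0 (Real.log y - Real.log R)) (min R y / y) y := by
  have hlog : HasDerivAt (fun y => R + R * (Real.log y - Real.log R)) (R / y) y := by
    have := (((Real.hasDerivAt_log hy.ne').sub_const (Real.log R)).const_mul R).const_add R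
    simpa [div_eq_mul_inv] using this
  have e1 : ∀ x, 0 < x → x ≤ R → min R x + R * max 0 (Real.log x - Real.log R) = x := by
    intro x hx hxR
    rw [min_eq_right hxR, max_eq_left (sub_nonpos.2 (Real.log_le_log hx hxR))]; simp
  have e2 : ∀ x, R ≤ x → min R x + R * max 0 (Real.log x - Real.log R)
      = R + R * (Real.log x - Real.log R) := by
    intro x hxR
    rw [min_eq_left hxR, max_eq_right (sub_nonneg.2 (Real.log_le_log hR hxR))]
  rcases lt_trichotomy y R with h | h | h
  · rw [min_eq_right h.le, div_self hy.ne']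
    refine (hasDerivAt_id y).congr_of_eventuallyEq ?_
    filter_upwards [Ioo_mem_nhds hy h] with x hx
    exact e1 x hx.1 hx.2.le
  · rw [h, min_self, div_self hR.ne']
    rw [h, div_self hR.ne'] at hlog
    have hl : HasDerivWithinAt (fun y => min R y + R * max 0 (Real.log y - Real.log R)) 1
        (Iic R) R := by
      refine (hasDerivAt_id R).hasDerivWithinAt.congr_of_eventuallyEq ?_ (e1 R hR le_rfl)
      filter_upwards [self_mem_nhdsWithin, mem_nhdsWithin_of_mem_nhds (Ioi_mem_nhds hR)] with x a b
      exact e1 x b a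
    have hr : HasDerivWithinAt (fun y => min R y + R * max 0 (Real.log y - Real.log R)) 1
        (Ici R) R := by
      refine hlog.hasDerivWithinAt.congr (fun x hx => e2 x hx) (e2 R le_rfl)
    have := hl.union hr
    rwa [Iic_union_Ici, hasDerivWithinAt_univ] at this
  · rw [min_eq_left h.le]
    refine hlog.congr_of_eventuallyEq ?_
    filter_upwards [Ioi_mem_nhds h] with x hx
    exact e2 x hx.le

theorem hasDerivAt_levelB {R₁ R₀ y : ℝ} (h1 : 0 < R₁) (h0 : 0 < R₀) (hy : 0 < y) :
    HasDerivAt (levelB R₁ R₀) (levelA R₁ R₀ y / y) y := by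
  have := (hasDerivAt_min_add_log h0 hy).sub (hasDerivAt_min_add_log h1 hy)
  rw [levelA, sub_div]
  refine this.congr_of_eventuallyEq (Eventually.of_forall fun x => ?_)
  simp only [levelB, levelA, Pi.sub_apply]
  ring

theorem levelA_nonneg {R₁ R₀ : ℝ} (h : R₁ ≤ R₀) (y : ℝ) : 0 ≤ levelA R₁ R₀ y :=
  sub_nonneg.2 (min_le_min_right y h)

theorem abs_levelA_le {R₁ R₀ : ℝ} (h : R₁ ≤ R₀) (y : ℝ) : |levelA R₁ R₀ y| ≤ R₀ - R₁ := by
  rw [abs_of_nonneg (levelA_nonneg h _), levelA]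
  rcases le_total R₁ y with h1 | h1
  · rw [min_eq_left h1]
    exact sub_le_sub_right (min_le_left _ _) _
  · rw [min_eq_right h1, min_eq_right (h1.trans h), sub_self]
    exact sub_nonneg.2 h

theorem levelA_le {R₁ R₀ : ℝ} (h1 : 0 < R₁) {y : ℝ} (hy : 0 < y) : levelA R₁ R₀ y ≤ y := by
  have h2 : 0 ≤ min R₁ y := le_min h1.le hy.le
  have := min_le_right R₀ y
  unfold levelA; linarith

theorem levelA_eq_zero {R₁ R₀ y : ℝ} (h : R₁ ≤ R₀) (hy : y ≤ R₁) : levelA R₁ R₀ y = 0 := by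
  rw [levelA, min_eq_right hy, min_eq_right (hy.trans h), sub_self]

theorem levelB_eq_zero {R₁ R₀ y : ℝ} (h : R₁ ≤ R₀) (h0 : 0 < y) (hy : y ≤ R₁) :
    levelB R₁ R₀ y = 0 := by
  rw [levelB, levelA_eq_zero h hy, max_eq_left, max_eq_left]
  · simp
  · exact sub_nonpos.2 (Real.log_le_log h0 (hy.trans h))
  · exact sub_nonpos.2 (Real.log_le_log h0 hy)

theorem lipschitzOnWith_levelB {R₁ R₀ : ℝ} (h : R₁ ≤ R₀) (h1 : 0 < R₁) :
    LipschitzOnWith 1 (levelB R₁ R₀) (Ioi 0) := by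
  apply (convex_Ioi (0 : ℝ)).lipschitzOnWith_of_nnnorm_hasDerivWithin_le (𝕜 := ℝ)
    (f' := fun y => levelA R₁ R₀ y / y)
  · intro y hy
    exact (hasDerivAt_levelB h1 (h1.trans_le h) hy).hasDerivWithinAt
  · intro y hy
    rw [← NNReal.coe_le_coe, coe_nnnorm, Real.norm_eq_abs,
      abs_of_nonneg (div_nonneg (levelA_nonneg h y) (le_of_lt hy)), NNReal.coe_one]
    exact (div_le_one hy).2 (levelA_le h1 hy)

/-! ### Weak forms of the adjoint heat operator in coordinates -/

section Cutoff

variable {E : Type*} [NormedAddCommGroup E] [NormedSpace ℝ E]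

theorem contDiff_of_contDiffOn_of_zero {N : ℕ∞ω} {w : E → ℝ} {D S : Set E} (hD : IsOpen D)
    (hw : ContDiffOn ℝ N w D) (hS : IsClosed S) (hSD : S ⊆ D) (h0 : ∀ q ∉ S, w q = 0) :
    ContDiff ℝ N w := by
  rw [contDiff_iff_contDiffAt]
  intro q
  by_cases hq : q ∈ S
  · exact hw.contDiffAt (hD.mem_nhds (hSD hq))
  · refine (contDiffAt_const (c := (0 : ℝ))).congr_of_eventuallyEq ?_
    filter_upwards [hS.isOpen_compl.mem_nhds hq] with x hx
    exact h0 x hx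

theorem exists_cutoff [FiniteDimensional ℝ E] {D K : Set E} (hD : IsOpen D) (hK : IsCompact K)
    (hKD : K ⊆ D) :
    ∃ θ : E → ℝ, ContDiff ℝ ∞ θ ∧ HasCompactSupport θ ∧ tsupport θ ⊆ D ∧
      (∀ᶠ x in 𝓝ˢ K, θ x = 1) ∧ ∀ x, θ x ∈ Icc (0 : ℝ) 1 := by
  obtain ⟨K2, hK2, h1, h2⟩ := exists_compact_between hK hD hKD
  obtain ⟨f, hf1, hf0, hf⟩ := exists_contMDiffMap_one_nhds_of_subset_interior 𝓘(ℝ, E)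
    (n := (⊤ : ℕ∞))
    hK.isClosed h1
  have hs : tsupport f ⊆ K2 := by
    apply closure_minimal _ hK2.isClosed
    intro x hx
    by_contra h
    exact hx (hf0 x h)
  exact ⟨f, f.contMDiff.contDiff, HasCompactSupport.of_support_subset_isCompact hK2
    ((subset_tsupport _).trans hs), hs.trans h2, hf1, hf⟩

theorem _root_.LipschitzWith.mul_of_bounded {F H : E → ℝ} {C D : ℝ≥0} (hF : LipschitzWith C F)
    (hH : LipschitzWith D H) {BF BH : ℝ≥0} (bF : ∀ x, |F x| ≤ BF) (bH : ∀ x, |H x| ≤ BH) :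
    LipschitzWith (BF * D + BH * C) (fun x => F x * H x) := by
  apply LipschitzWith.of_dist_le_mul
  intro x y
  have e1 := hF.dist_le_mul x y
  have e2 := hH.dist_le_mul x y
  rw [Real.dist_eq] at e1 e2 ⊢
  calc |F x * H x - F y * H y| = |F x * (H x - H y) + H y * (F x - F y)| := by ring_nf
    _ ≤ |F x| * |H x - H y| + |H y| * |F x - F y| := by
        rw [← abs_mul, ← abs_mul]; exact abs_add_le _ _
    _ ≤ BF * (D * dist x y) + BH * (C * dist x y) := by
        gcongr
        · exact bF x
        · exact bH y
    _ = _ := by push_cast; ring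

end Cutoff

/-- Coefficients of a heat equation in coordinates: on the open set `D` of space-time `E`, with
spatial coordinate directions `e i` and time direction `τ`, a volume density `v`, the inverse
metric `G` and the function `k = tr_g h`, so that `∂v/∂τ = k v`. -/
structure HeatCoeff (ι E : Type*) [NormedAddCommGroup E] [NormedSpace ℝ E] where
  D : Set E
  isOpen : IsOpen D
  e : ι → E
  τ : E
  v : E → ℝ
  k : E → ℝ
  G : ι → ι → E → ℝ
  v_smooth : ContDiffOn ℝ ∞ v D
  v_pos : ∀ q ∈ D, 0 < v q
  G_smooth : ∀ i j, ContDiffOn ℝ ∞ (G i j) D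
  G_symm : ∀ i j, ∀ q ∈ D, G i j q = G j i q
  k_cont : ContinuousOn k D
  deriv_v : ∀ q ∈ D, fderiv ℝ v q τ = k q * v q

namespace HeatCoeff

variable {ι E : Type*} [Fintype ι] [NormedAddCommGroup E] [NormedSpace ℝ E]

/-- The restriction of the coefficients to a smaller open set. -/
def restrict (c : HeatCoeff ι E) (D' : Set E) (h : IsOpen D') (hs : D' ⊆ c.D) : HeatCoeff ι E where
  __ := c
  D := D'
  isOpen := h
  v_smooth := c.v_smooth.mono hs
  v_pos q hq := c.v_pos q (hs hq)
  G_smooth i j := (c.G_smooth i j).mono hs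
  G_symm i j q hq := c.G_symm i j q (hs hq)
  k_cont := c.k_cont.mono hs
  deriv_v q hq := c.deriv_v q (hs hq)

variable (c : HeatCoeff ι E)

/-- The pairing `G^{ij} αᵢ βⱼ` of the spatial parts of two covectors. -/
def pair (q : E) (α β : E →L[ℝ] ℝ) : ℝ := ∑ i, ∑ j, c.G i j q * α (c.e i) * β (c.e j)

/-- The components `v G^{ij} ∂ⱼf` of the gradient density. -/
def flux (f : E → ℝ) (i : ι) (z : E) : ℝ := c.v z * ∑ j, c.G i j z * fderiv ℝ f z (c.e j)

/-- The Laplacian `v⁻¹ ∂ᵢ(v G^{ij} ∂ⱼf)`. -/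
def lap (f : E → ℝ) (q : E) : ℝ := (c.v q)⁻¹ * ∑ i, fderiv ℝ (c.flux f i) q (c.e i)

/-- The density of the weak form `∫ (∂u/∂τ ζ - ⟨∇u, ∇ζ⟩ + k u ζ) v` of the operator
`∂/∂τ + Δ + k`. -/
def weak (u ζ : E → ℝ) (q : E) : ℝ :=
  (fderiv ℝ u q c.τ * ζ q - c.pair q (fderiv ℝ u q) (fderiv ℝ ζ q) + c.k q * u q * ζ q) * c.v q

theorem pair_add_right (q : E) (α β γ : E →L[ℝ] ℝ) :
    c.pair q α (β + γ) = c.pair q α β + c.pair q α γ := by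
  simp only [pair, add_apply, mul_add, Finset.sum_add_distrib]

theorem pair_smul_right (q : E) (a : ℝ) (α β : E →L[ℝ] ℝ) :
    c.pair q α (a • β) = a * c.pair q α β := by
  simp only [pair, smul_apply, smul_eq_mul, Finset.mul_sum]
  refine Finset.sum_congr rfl fun i _ => Finset.sum_congr rfl fun j _ => by ring

theorem pair_comm {q : E} (hq : q ∈ c.D) (α β : E →L[ℝ] ℝ) : c.pair q α β = c.pair q β α := by
  rw [pair, Finset.sum_comm]
  refine Finset.sum_congr rfl fun i _ => Finset.sum_congr rfl fun j _ => ?_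
  rw [c.G_symm j i q hq]; ring

theorem pair_eq_flux (q : E) (α : E →L[ℝ] ℝ) (f : E → ℝ) :
    c.v q * c.pair q α (fderiv ℝ f q) = ∑ i, α (c.e i) * c.flux f i q := by
  simp only [pair, flux, Finset.mul_sum]
  refine Finset.sum_congr rfl fun i _ => Finset.sum_congr rfl fun j _ => by ring

theorem flux_smooth {f : E → ℝ} (hf : ContDiffOn ℝ ∞ f c.D) (i : ι) :
    ContDiffOn ℝ ∞ (c.flux f i) c.D := by
  refine c.v_smooth.mul (ContDiffOn.sum fun j _ => (c.G_smooth i j).mul ?_)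
  exact (hf.fderiv_of_isOpen c.isOpen (by simp)).clm_apply contDiffOn_const

theorem flux_congr {f f' : E → ℝ} {q : E} (h : f =ᶠ[𝓝 q] f') (i : ι) :
    c.flux f i =ᶠ[𝓝 q] c.flux f' i := by
  filter_upwards [h.eventuallyEq_nhds] with x hx
  simp only [flux, hx.fderiv_eq]

theorem lap_congr {f f' : E → ℝ} {q : E} (h : f =ᶠ[𝓝 q] f') : c.lap f q = c.lap f' q := by
  simp only [lap]
  congr 1
  exact Finset.sum_congr rfl fun i _ => by rw [(c.flux_congr h i).fderiv_eq]

theorem flux_eq_zero {f : E → ℝ} {q : E} (hq : q ∉ tsupport f) (i : ι) : c.flux f i q = 0 := by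
  have h : f =ᶠ[𝓝 q] fun _ => 0 := notMem_tsupport_iff_eventuallyEq.1 hq
  have := (c.flux_congr h i).eq_of_nhds
  rw [this]
  simp [flux]

theorem lap_eq_zero {f : E → ℝ} {q : E} (hq : q ∉ tsupport f) : c.lap f q = 0 := by
  have h : f =ᶠ[𝓝 q] fun _ => 0 := notMem_tsupport_iff_eventuallyEq.1 hq
  rw [c.lap_congr h]
  simp only [lap]
  have : ∀ i, c.flux (fun _ => 0) i = fun _ => 0 := fun i => by
    funext z; simp [flux]
  simp [this]

theorem fderiv_eq_zero_of_notMem {f : E → ℝ} {q : E} (hq : q ∉ tsupport f) :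
    fderiv ℝ f q = 0 := by
  have h : f =ᶠ[𝓝 q] fun _ => 0 := notMem_tsupport_iff_eventuallyEq.1 hq
  rw [h.fderiv_eq]; simp

theorem weak_eq_zero {u ζ : E → ℝ} {q : E} (hq : q ∉ tsupport ζ) : c.weak u ζ q = 0 := by
  simp [weak, pair, fderiv_eq_zero_of_notMem hq, image_eq_zero_of_notMem_tsupport hq]

theorem continuousOn_lap {f : E → ℝ} (hf : ContDiffOn ℝ ∞ f c.D) : ContinuousOn (c.lap f) c.D := by
  refine (c.v_smooth.continuousOn.inv₀ fun q hq => (c.v_pos q hq).ne').mul ?_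
  refine continuousOn_finsetSum _ fun i _ => ?_
  exact ((c.flux_smooth hf i).continuousOn_fderiv_of_isOpen c.isOpen (by simp)).clm_apply
    continuousOn_const

variable [FiniteDimensional ℝ E] [MeasurableSpace E] [BorelSpace E] {μ : Measure E}
  [μ.IsAddHaarMeasure]

omit c in
theorem essBdd_fderiv {u : E → ℝ} {C : ℝ≥0} (hu : LipschitzWith C u) (e : E) (K : Set E) :
    EssBdd (μ.restrict K) (fun q => fderiv ℝ u q e) := by
  refine ⟨(measurable_fderiv_apply_const ℝ u e).aestronglyMeasurable, C * ‖e‖,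
    Eventually.of_forall fun q => ?_⟩
  rw [← Real.norm_eq_abs]
  exact (ContinuousLinearMap.le_opNorm _ _).trans
    (mul_le_mul_of_nonneg_right (norm_fderiv_le_of_lipschitz ℝ hu) (norm_nonneg e))

section

variable {K : Set E} (hK : IsCompact K) (hKD : K ⊆ c.D)
include hK hKD

theorem essBdd_of_contOn {F : E → ℝ} (hF : ContinuousOn F c.D) : EssBdd (μ.restrict K) F :=
  EssBdd.of_continuousOn hK hK.measurableSet (hF.mono hKD)

theorem essBdd_pair {u w : E → ℝ} {C C' : ℝ≥0} (hu : LipschitzWith C u) (hw : LipschitzWith C' w) :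
    EssBdd (μ.restrict K) (fun q => c.pair q (fderiv ℝ u q) (fderiv ℝ w q)) :=
  EssBdd.sum _ fun i _ => EssBdd.sum _ fun j _ =>
    ((c.essBdd_of_contOn hK hKD (c.G_smooth i j).continuousOn).mul
      (essBdd_fderiv hu _ K)).mul (essBdd_fderiv hw _ K)

theorem essBdd_weak {u ζ : E → ℝ} {C C' : ℝ≥0} (hu : LipschitzWith C u) (hζ : LipschitzWith C' ζ) :
    EssBdd (μ.restrict K) (c.weak u ζ) := by
  have bu := EssBdd.of_continuousOn (μ := μ) hK hK.measurableSet hu.continuous.continuousOn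
  have bζ := EssBdd.of_continuousOn (μ := μ) hK hK.measurableSet hζ.continuous.continuousOn
  exact ((((essBdd_fderiv hu c.τ K).mul bζ).sub (c.essBdd_pair hK hKD hu hζ)).add
    (((c.essBdd_of_contOn hK hKD c.k_cont).mul bu).mul bζ)).mul
    (c.essBdd_of_contOn hK hKD c.v_smooth.continuousOn)

end

/-- Integration by parts in space: `∫ F Δf v = -∫ ⟨∇F, ∇f⟩ v`. -/
theorem integral_mul_lap {F f : E → ℝ} {C : ℝ≥0} (hF : LipschitzWith C F)
    (hf : ContDiff ℝ ∞ f) (hfc : HasCompactSupport f) (hfD : tsupport f ⊆ c.D) :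
    ∫ q, F q * c.lap f q * c.v q ∂μ = -∫ q, c.v q * c.pair q (fderiv ℝ F q) (fderiv ℝ f q) ∂μ := by
  -- the flux vanishes off `tsupport f`, so it is smooth on the whole space
  have hw : ∀ i, ContDiff ℝ ∞ (c.flux f i) := fun i =>
    contDiff_of_contDiffOn_of_zero c.isOpen (c.flux_smooth hf.contDiffOn i)
      (isClosed_tsupport f) hfD fun q hq => c.flux_eq_zero hq i
  have hwc : ∀ i, HasCompactSupport (c.flux f i) := fun i =>
    HasCompactSupport.intro hfc fun q hq => c.flux_eq_zero hq i
  have e1 : ∀ q, F q * c.lap f q * c.v q = ∑ i, F q * fderiv ℝ (c.flux f i) q (c.e i) := by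
    intro q
    by_cases hq : q ∈ tsupport f
    · have := (c.v_pos q (hfD hq)).ne'
      rw [← Finset.mul_sum, lap]
      field_simp
    · rw [c.lap_eq_zero hq]
      have : ∀ i, fderiv ℝ (c.flux f i) q = 0 := fun i => by
        apply fderiv_eq_zero_of_notMem
        intro h
        refine hq (closure_minimal ?_ (isClosed_tsupport f) h)
        intro x hx
        by_contra hx'
        exact hx (c.flux_eq_zero hx' i)
      simp [this]
  have bc : ∀ {F : E → ℝ}, Continuous F → EssBdd (μ.restrict (tsupport f)) F := fun h =>
    EssBdd.of_continuousOn hfc.isCompact hfc.isCompact.measurableSet h.continuousOn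
  simp only [e1, c.pair_eq_flux]
  rw [integral_finsetSum, integral_finsetSum, ← Finset.sum_neg_distrib]
  · exact Finset.sum_congr rfl fun i _ => integral_mul_fderiv_eq_neg hF
      ((hw i).of_le (by simp)) (hwc i) _
  · intro i _
    exact EssBdd.integrable_of_zero hfc.isCompact
      ((essBdd_fderiv hF (c.e i) _).mul (bc (hw i).continuous))
      fun q hq => by rw [c.flux_eq_zero hq i, mul_zero]
  · intro i _
    have hcd : Continuous fun q => fderiv ℝ (c.flux f i) q (c.e i) :=
      ((hw i).continuous_fderiv (by simp)).clm_apply continuous_const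
    refine (hF.continuous.mul hcd).integrable_of_hasCompactSupport ?_
    exact ((hwc i).fderiv_apply (𝕜 := ℝ) (c.e i)).mul_left

/-- Integration by parts in space, with the compact support on the Lipschitz factor. -/
theorem integral_mul_lap' {F f : E → ℝ} {C : ℝ≥0} (hF : LipschitzWith C F)
    (hFc : HasCompactSupport F) (hFD : tsupport F ⊆ c.D) (hf : ContDiffOn ℝ ∞ f c.D) :
    ∫ q, F q * c.lap f q * c.v q ∂μ = -∫ q, c.v q * c.pair q (fderiv ℝ F q) (fderiv ℝ f q) ∂μ := by
  obtain ⟨θ, hθ, hθc, hθD, hθ1, -⟩ := exists_cutoff c.isOpen hFc.isCompact hFD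
  have hs : tsupport (fun q => θ q * f q) ⊆ tsupport θ :=
    closure_mono fun q hq => by
      simp only [Function.mem_support] at hq ⊢
      exact left_ne_zero_of_mul hq
  have hsm : ContDiff ℝ ∞ (fun q => θ q * f q) :=
    contDiff_of_contDiffOn_of_zero c.isOpen (hθ.contDiffOn.mul hf) (isClosed_tsupport θ) hθD
      fun q hq => by rw [image_eq_zero_of_notMem_tsupport hq, zero_mul]
  have heq : ∀ q ∈ tsupport F, (fun q => θ q * f q) =ᶠ[𝓝 q] f := by
    intro q hq
    filter_upwards [(eventually_nhdsSet_iff_forall.1 hθ1) q hq] with x hx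
    rw [hx, one_mul]
  have h := c.integral_mul_lap (μ := μ) hF hsm (HasCompactSupport.of_support_subset_isCompact hθc
    ((subset_tsupport _).trans hs)) (hs.trans hθD)
  convert h using 2
  · funext q
    by_cases hq : q ∈ tsupport F
    · rw [c.lap_congr (heq q hq)]
    · simp [image_eq_zero_of_notMem_tsupport hq]
  · congr 1
    funext q
    by_cases hq : q ∈ tsupport F
    · rw [(heq q hq).fderiv_eq]
    · simp [pair, fderiv_eq_zero_of_notMem hq]

/-- Integration by parts in time; the volume density contributes the term with `k`. -/
theorem integral_mul_fderiv_time {F f : E → ℝ} {C : ℝ≥0} (hF : LipschitzWith C F)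
    (hf : ContDiff ℝ ∞ f) (hfc : HasCompactSupport f) (hfD : tsupport f ⊆ c.D) :
    ∫ q, F q * fderiv ℝ f q c.τ * c.v q ∂μ
      = -∫ q, (fderiv ℝ F q c.τ + F q * c.k q) * f q * c.v q ∂μ := by
  have hsm : ContDiff ℝ ∞ (fun q => f q * c.v q) :=
    contDiff_of_contDiffOn_of_zero c.isOpen (hf.contDiffOn.mul c.v_smooth) (isClosed_tsupport f)
      hfD fun q hq => by rw [image_eq_zero_of_notMem_tsupport hq, zero_mul]
  have hsc : HasCompactSupport (fun q => f q * c.v q) := hfc.mul_right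
  have h := integral_mul_fderiv_eq_neg (μ := μ) hF (hsm.of_le (by simp)) hsc c.τ
  have bc : ∀ {F : E → ℝ}, ContinuousOn F c.D → EssBdd (μ.restrict (tsupport f)) F := fun h =>
    c.essBdd_of_contOn hfc.isCompact hfD h
  have bF := bc hF.continuous.continuousOn
  have bf := bc hf.continuous.continuousOn
  have bv := bc c.v_smooth.continuousOn
  have bk := bc c.k_cont
  have hf' : Continuous fun q => fderiv ℝ f q c.τ :=
    (hf.continuous_fderiv (by simp)).clm_apply continuous_const
  have e1 : ∀ q, F q * fderiv ℝ (fun q => f q * c.v q) q c.τ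
      = F q * fderiv ℝ f q c.τ * c.v q + F q * c.k q * f q * c.v q := by
    intro q
    by_cases hq : q ∈ tsupport f
    · have hd : DifferentiableAt ℝ c.v q :=
        (c.v_smooth.contDiffAt (c.isOpen.mem_nhds (hfD hq))).differentiableAt (by simp)
      rw [fderiv_fun_mul (hf.differentiable (by simp) q) hd]
      simp only [add_apply, smul_apply, smul_eq_mul, c.deriv_v q (hfD hq)]
      ring
    · have h1 : q ∉ tsupport (fun q => f q * c.v q) := fun h' =>
        hq (closure_mono (fun x hx => left_ne_zero_of_mul hx) h')
      simp [fderiv_eq_zero_of_notMem h1, fderiv_eq_zero_of_notMem hq,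
        image_eq_zero_of_notMem_tsupport hq]
  simp only [e1] at h
  rw [integral_add] at h
  · have h2 : ∫ q, (fderiv ℝ F q c.τ + F q * c.k q) * f q * c.v q ∂μ
        = ∫ q, fderiv ℝ F q c.τ * (f q * c.v q) ∂μ + ∫ q, F q * c.k q * f q * c.v q ∂μ := by
      rw [← integral_add]
      · congr 1; funext q; ring
      · exact EssBdd.integrable_of_zero hfc.isCompact ((essBdd_fderiv hF c.τ _).mul (bf.mul bv))
          fun q hq => by simp [image_eq_zero_of_notMem_tsupport hq]
      · exact EssBdd.integrable_of_zero hfc.isCompact (((bF.mul bk).mul bf).mul bv)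
          fun q hq => by simp [image_eq_zero_of_notMem_tsupport hq]
    rw [h2]; linarith
  · exact EssBdd.integrable_of_zero hfc.isCompact ((bF.mul (bc hf'.continuousOn)).mul bv)
      fun q hq => by simp [fderiv_eq_zero_of_notMem hq]
  · exact EssBdd.integrable_of_zero hfc.isCompact (((bF.mul bk).mul bf).mul bv)
      fun q hq => by simp [image_eq_zero_of_notMem_tsupport hq]

/-- For smooth `u` the weak form is the integral of `(∂u/∂τ + Δu + k u) ζ`. -/
theorem integral_weak_of_smooth {u ζ : E → ℝ} {C C' : ℝ≥0} (hu : LipschitzWith C u)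
    (hus : ContDiffOn ℝ ∞ u c.D) (hζ : LipschitzWith C' ζ) (hζc : HasCompactSupport ζ)
    (hζD : tsupport ζ ⊆ c.D) :
    ∫ q, c.weak u ζ q ∂μ
      = ∫ q, (fderiv ℝ u q c.τ + c.lap u q + c.k q * u q) * ζ q * c.v q ∂μ := by
  have h := c.integral_mul_lap' (μ := μ) hζ hζc hζD hus
  have bc : ∀ {F : E → ℝ}, ContinuousOn F c.D → EssBdd (μ.restrict (tsupport ζ)) F := fun h =>
    c.essBdd_of_contOn hζc.isCompact hζD h
  have bu := bc hu.continuous.continuousOn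
  have bζ := bc hζ.continuous.continuousOn
  have bv := bc c.v_smooth.continuousOn
  have bk := bc c.k_cont
  have e1 : ∀ q, c.weak u ζ q = (fderiv ℝ u q c.τ + c.k q * u q) * ζ q * c.v q
      + -(c.v q * c.pair q (fderiv ℝ ζ q) (fderiv ℝ u q)) := by
    intro q
    by_cases hq : q ∈ tsupport ζ
    · rw [c.pair_comm (hζD hq), weak]; ring
    · simp [c.weak_eq_zero hq, pair, image_eq_zero_of_notMem_tsupport hq,
        fderiv_eq_zero_of_notMem hq]
  have e2 : ∀ q, (fderiv ℝ u q c.τ + c.lap u q + c.k q * u q) * ζ q * c.v q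
      = (fderiv ℝ u q c.τ + c.k q * u q) * ζ q * c.v q + ζ q * c.lap u q * c.v q := by
    intro q; ring
  have i1 : Integrable (fun q => (fderiv ℝ u q c.τ + c.k q * u q) * ζ q * c.v q) μ :=
    EssBdd.integrable_of_zero hζc.isCompact
      ((((essBdd_fderiv hu c.τ _).add (bk.mul bu)).mul bζ).mul bv)
      fun q hq => by simp [image_eq_zero_of_notMem_tsupport hq]
  simp only [e1, e2]
  rw [integral_add i1, integral_add i1, h, integral_neg]
  · exact EssBdd.integrable_of_zero hζc.isCompact ((bζ.mul (bc (c.continuousOn_lap hus))).mul bv)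
      fun q hq => by simp [image_eq_zero_of_notMem_tsupport hq]
  · refine EssBdd.integrable_of_zero hζc.isCompact
      (bv.mul (c.essBdd_pair hζc.isCompact hζD hζ hu)).neg
      fun q hq => by simp [pair, fderiv_eq_zero_of_notMem hq]

/-- For smooth test functions, the weak form is the distributional one. -/
theorem integral_weak_of_test {u η : E → ℝ} {C : ℝ≥0} (hu : LipschitzWith C u)
    (hη : ContDiff ℝ ∞ η) (hηc : HasCompactSupport η) (hηD : tsupport η ⊆ c.D) :
    ∫ q, c.weak u η q ∂μ = ∫ q, u q * (c.lap η q - fderiv ℝ η q c.τ) * c.v q ∂μ := by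
  have h1 := c.integral_mul_lap (μ := μ) hu hη hηc hηD
  have h2 := c.integral_mul_fderiv_time (μ := μ) hu hη hηc hηD
  obtain ⟨Cη, hCη⟩ := (hη.of_le (by simp)).lipschitzWith_of_hasCompactSupport hηc one_ne_zero
  have bc : ∀ {F : E → ℝ}, ContinuousOn F c.D → EssBdd (μ.restrict (tsupport η)) F := fun h =>
    c.essBdd_of_contOn hηc.isCompact hηD h
  have bu := bc hu.continuous.continuousOn
  have bη := bc hη.continuous.continuousOn
  have bv := bc c.v_smooth.continuousOn
  have bk := bc c.k_cont
  have hη' : Continuous fun q => fderiv ℝ η q c.τ :=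
    (hη.continuous_fderiv (by simp)).clm_apply continuous_const
  have i1 : Integrable (fun q => (fderiv ℝ u q c.τ + u q * c.k q) * η q * c.v q) μ :=
    EssBdd.integrable_of_zero hηc.isCompact
      ((((essBdd_fderiv hu c.τ _).add (bu.mul bk)).mul bη).mul bv)
      fun q hq => by simp [image_eq_zero_of_notMem_tsupport hq]
  have i2 : Integrable (fun q => c.v q * c.pair q (fderiv ℝ u q) (fderiv ℝ η q)) μ :=
    EssBdd.integrable_of_zero hηc.isCompact
      (bv.mul (c.essBdd_pair hηc.isCompact hηD hu hCη))
      fun q hq => by simp [pair, fderiv_eq_zero_of_notMem hq]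
  have e1 : ∀ q, c.weak u η q = (fderiv ℝ u q c.τ + u q * c.k q) * η q * c.v q
      - c.v q * c.pair q (fderiv ℝ u q) (fderiv ℝ η q) := by
    intro q; rw [weak]; ring
  have e2 : ∀ q, u q * (c.lap η q - fderiv ℝ η q c.τ) * c.v q
      = u q * c.lap η q * c.v q - u q * fderiv ℝ η q c.τ * c.v q := by
    intro q; ring
  simp only [e1, e2]
  rw [integral_sub i1 i2, integral_sub, h1, h2]
  · ring
  · exact EssBdd.integrable_of_zero hηc.isCompact
      ((bu.mul (bc (c.continuousOn_lap hη.contDiffOn))).mul bv)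
      fun q hq => by simp [c.lap_eq_zero hq]
  · exact EssBdd.integrable_of_zero hηc.isCompact ((bu.mul (bc hη'.continuousOn)).mul bv)
      fun q hq => by simp [fderiv_eq_zero_of_notMem hq]

/-- A distributional subsolution satisfies the weak inequality for Lipschitz test functions. -/
theorem integral_weak_nonneg {u ζ : E → ℝ} {C C' : ℝ≥0} (hu : LipschitzWith C u)
    (hζ : LipschitzWith C' ζ) (hζc : HasCompactSupport ζ) (hζD : tsupport ζ ⊆ c.D)
    (hζ0 : ∀ q, 0 ≤ ζ q)
    (hsub : ∀ η : E → ℝ, ContDiff ℝ ∞ η → HasCompactSupport η → tsupport η ⊆ c.D →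
      (∀ q, 0 ≤ η q) → 0 ≤ ∫ q, u q * (c.lap η q - fderiv ℝ η q c.τ) * c.v q ∂μ) :
    0 ≤ ∫ q, c.weak u ζ q ∂μ := by
  obtain ⟨K, η, Z, hK, hKD, hζK, hηs, hηK, hη0, hηZ, hηC, hlim, hlim'⟩ :=
    exists_smooth_approx (μ := μ) hζ hζc hζ0 c.isOpen hζD
  have hpos : ∀ k, 0 ≤ ∫ q in K, c.weak u (η k) q ∂μ := by
    intro k
    have hc : HasCompactSupport (η k) := HasCompactSupport.of_support_subset_isCompact hK
      ((subset_tsupport _).trans (hηK k))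
    rw [setIntegral_eq_integral_of_forall_compl_eq_zero fun q hq =>
      c.weak_eq_zero fun h => hq (hηK k h), c.integral_weak_of_test hu (hηs k) hc
        ((hηK k).trans hKD)]
    exact hsub _ (hηs k) hc ((hηK k).trans hKD) (hη0 k)
  rw [← setIntegral_eq_integral_of_forall_compl_eq_zero fun q hq =>
    c.weak_eq_zero fun h => hq (hζK h)]
  refine ge_of_tendsto' (x := atTop) ?_ hpos
  have : IsFiniteMeasure (μ.restrict K) := ⟨by simpa using hK.measure_lt_top⟩
  have bc : ∀ {F : E → ℝ}, ContinuousOn F c.D → EssBdd (μ.restrict K) F := fun h =>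
    c.essBdd_of_contOn hK hKD h
  have bu := bc hu.continuous.continuousOn
  have bv := bc c.v_smooth.continuousOn
  have bk := bc c.k_cont
  have i0 := (((essBdd_fderiv (μ := μ) hu c.τ K).add (bk.mul bu)).mul bv)
  have i1 : ∀ i j, EssBdd (μ.restrict K) (fun q => c.G i j q * fderiv ℝ u q (c.e i) * c.v q) :=
    fun i j => ((bc (c.G_smooth i j).continuousOn).mul (essBdd_fderiv hu _ K)).mul bv
  have hbound : Integrable (fun q => |(fderiv ℝ u q c.τ + c.k q * u q) * c.v q| * Z
      + ∑ i, ∑ j, |c.G i j q * fderiv ℝ u q (c.e i) * c.v q| * (C' * ‖c.e j‖)) (μ.restrict K) := by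
    refine (i0.integrable.abs.mul_const Z).add ?_
    exact integrable_finsetSum _ fun i _ => integrable_finsetSum _ fun j _ =>
      (i1 i j).integrable.abs.mul_const _
  -- the weak form is linear in `w` and `∇w`, with essentially bounded coefficients on `K`
  have hsplit : ∀ (w : E → ℝ) q, c.weak u w q = (fderiv ℝ u q c.τ + c.k q * u q) * c.v q * w q
      - ∑ i, ∑ j, c.G i j q * fderiv ℝ u q (c.e i) * c.v q * fderiv ℝ w q (c.e j) := by
    intro w q
    have : ∑ i, ∑ j, c.G i j q * fderiv ℝ u q (c.e i) * c.v q * fderiv ℝ w q (c.e j)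
        = c.v q * c.pair q (fderiv ℝ u q) (fderiv ℝ w q) := by
      simp only [pair, Finset.mul_sum]
      exact Finset.sum_congr rfl fun i _ => Finset.sum_congr rfl fun j _ => by ring
    rw [this, weak]; ring
  refine tendsto_integral_of_dominated_convergence _ (fun k => ?_) hbound (fun k => ?_) ?_
  · have hc : HasCompactSupport (η k) := HasCompactSupport.of_support_subset_isCompact hK
      ((subset_tsupport _).trans (hηK k))
    obtain ⟨Cη, hCη⟩ := ((hηs k).of_le (by simp)).lipschitzWith_of_hasCompactSupport hc one_ne_zero
    exact (c.essBdd_weak hK hKD hu hCη).1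
  · filter_upwards with q
    rw [hsplit, Real.norm_eq_abs]
    refine (abs_sub _ _).trans (add_le_add ?_ ?_)
    · rw [abs_mul]
      exact mul_le_mul_of_nonneg_left (hηZ k q) (abs_nonneg _)
    · refine (Finset.abs_sum_le_sum_abs _ _).trans (Finset.sum_le_sum fun i _ => ?_)
      refine (Finset.abs_sum_le_sum_abs _ _).trans (Finset.sum_le_sum fun j _ => ?_)
      rw [abs_mul]
      exact mul_le_mul_of_nonneg_left (hηC k q _) (abs_nonneg _)
  · have h2 : ∀ᵐ q ∂(μ.restrict K), ∀ j,
        Tendsto (fun k => fderiv ℝ (η k) q (c.e j)) atTop (𝓝 (fderiv ℝ ζ q (c.e j))) :=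
      ae_all_iff.2 fun j => ae_restrict_of_ae (hlim' (c.e j))
    filter_upwards [h2] with q hq
    simp only [hsplit]
    refine ((hlim q).const_mul _).sub ?_
    exact tendsto_finsetSum _ fun i _ => tendsto_finsetSum _ fun j _ => (hq j).const_mul _

end HeatCoeff

section

variable {E : Type*} [NormedAddCommGroup E] [NormedSpace ℝ E]

theorem _root_.LipschitzWith.inv_of_le {u : E → ℝ} {C : ℝ≥0} (hu : LipschitzWith C u) {m : ℝ}
    (hm : 0 < m) (hmu : ∀ q, m ≤ u q) :
    LipschitzWith (C * (Real.toNNReal (m ^ 2))⁻¹) (fun q => (u q)⁻¹) := by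
  apply LipschitzWith.of_dist_le_mul
  intro x y
  have hx := hm.trans_le (hmu x)
  have hy := hm.trans_le (hmu y)
  have h := hu.dist_le_mul x y
  rw [Real.dist_eq] at h ⊢
  have e : (u x)⁻¹ - (u y)⁻¹ = -(u x - u y) * (u x * u y)⁻¹ := by field_simp; ring
  rw [e, abs_mul, abs_neg, abs_of_pos (by positivity : 0 < (u x * u y)⁻¹)]
  push_cast
  rw [Real.coe_toNNReal _ (sq_nonneg m)]
  calc |u x - u y| * (u x * u y)⁻¹ ≤ (C * dist x y) * (m ^ 2)⁻¹ := by
        apply mul_le_mul h _ (by positivity) (by positivity)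
        apply inv_anti₀ (by positivity)
        rw [sq]
        exact mul_le_mul (hmu x) (hmu y) hm.le hx.le
    _ = _ := by ring

/-- The test function `A(u) / u · f`. -/
def testFun (R₁ R₀ : ℝ) (u f : E → ℝ) (q : E) : ℝ := levelA R₁ R₀ (u q) * (u q)⁻¹ * f q

theorem exists_lipschitzWith_testFun {R₁ R₀ : ℝ} (h : R₁ ≤ R₀) (h1 : 0 < R₁) {u f : E → ℝ}
    {C C' : ℝ≥0} {m : ℝ} (hu : LipschitzWith C u) (hm : 0 < m) (hmu : ∀ q, m ≤ u q)
    (hf : LipschitzWith C' f) {Z : ℝ} (hZ : ∀ q, |f q| ≤ Z) :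
    ∃ C'', LipschitzWith C'' (testFun R₁ R₀ u f) := by
  have hA : LipschitzWith (C + C) (fun q => levelA R₁ R₀ (u q)) :=
    (hu.const_min R₀).sub (hu.const_min R₁)
  have hpos : ∀ q, 0 < u q := fun q => hm.trans_le (hmu q)
  have bA : ∀ q, |levelA R₁ R₀ (u q)| ≤ (Real.toNNReal R₀ : ℝ) := fun q => by
    rw [abs_of_nonneg (levelA_nonneg h _), Real.coe_toNNReal _ (h1.le.trans h), levelA]
    have := le_min h1.le (hpos q).le
    have := min_le_left R₀ (u q)
    linarith
  have bi : ∀ q, |(u q)⁻¹| ≤ (Real.toNNReal m⁻¹ : ℝ) := fun q => by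
    rw [abs_of_pos (inv_pos.2 (hpos q)), Real.coe_toNNReal _ (inv_pos.2 hm).le]
    exact inv_anti₀ hm (hmu q)
  have h2 := hA.mul_of_bounded (hu.inv_of_le hm hmu) bA bi
  have hZ' : ∀ q, |f q| ≤ (Real.toNNReal Z : ℝ) := fun q => (hZ q).trans (Real.le_coe_toNNReal Z)
  refine ⟨_, h2.mul_of_bounded hf (BF := 1) (fun q => ?_) hZ'⟩
  rw [abs_of_nonneg (mul_nonneg (levelA_nonneg h _) (inv_pos.2 (hpos q)).le), ← div_eq_mul_inv,
    NNReal.coe_one]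
  exact (div_le_one (hpos q)).2 (levelA_le h1 (hpos q))

theorem tsupport_testFun (R₁ R₀ : ℝ) (u f : E → ℝ) :
    tsupport (testFun R₁ R₀ u f) ⊆ tsupport f :=
  closure_mono fun _ hq => right_ne_zero_of_mul hq

theorem testFun_nonneg {R₁ R₀ : ℝ} (h : R₁ ≤ R₀) {u f : E → ℝ} {q : E} (hu : 0 < u q)
    (hf : 0 ≤ f q) : 0 ≤ testFun R₁ R₀ u f q :=
  mul_nonneg (mul_nonneg (levelA_nonneg h _) (inv_pos.2 hu).le) hf

end

namespace HeatCoeff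

variable {ι E : Type*} [Fintype ι] [NormedAddCommGroup E] [NormedSpace ℝ E] (c : HeatCoeff ι E)

/-- The density whose integral compares the two values of the local functional: at a point where
`u = y` it is `(R₀ 1_{y > R₀} - R₁ 1_{y > R₁}) |∇ log u|² + (A(y) - B(y)) k`, times `f v`. -/
def gap (R₁ R₀ : ℝ) (u f : E → ℝ) (q : E) : ℝ :=
  (((if R₀ < u q then R₀ else 0) - (if R₁ < u q then R₁ else 0)) *
      (c.pair q (fderiv ℝ u q) (fderiv ℝ u q) / u q ^ 2)
    + (levelA R₁ R₀ (u q) - levelB R₁ R₀ (u q)) * c.k q) * f q * c.v q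

variable [FiniteDimensional ℝ E] [MeasurableSpace E] [BorelSpace E] {μ : Measure E}
  [μ.IsAddHaarMeasure]

/-- The local identity behind the monotonicity formula: the weak form tested with `A(u) f / u`,
combined with integration by parts of `B(u)` against `∂f/∂τ - Δf`. -/
theorem integral_gap {R₁ R₀ : ℝ} (h : R₁ ≤ R₀) (h1 : 0 < R₁) {u f : E → ℝ} {C : ℝ≥0} {m : ℝ}
    (hu : LipschitzWith C u) (hm : 0 < m) (hmu : ∀ q, m ≤ u q)
    (hf : ContDiff ℝ ∞ f) (hfc : HasCompactSupport f) (hfD : tsupport f ⊆ c.D) :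
    ∫ q, c.gap R₁ R₀ u f q ∂μ = ∫ q, c.weak u (testFun R₁ R₀ u f) q ∂μ
      + ∫ q, levelB R₁ R₀ (u q) * (fderiv ℝ f q c.τ - c.lap f q) * c.v q ∂μ := by
  have hpos : ∀ q, 0 < u q := fun q => hm.trans_le (hmu q)
  have h0 : 0 < R₀ := h1.trans_le h
  obtain ⟨Cf, hCf⟩ := (hf.of_le (by simp)).lipschitzWith_of_hasCompactSupport hfc one_ne_zero
  obtain ⟨Z, hZ⟩ := hf.continuous.bounded_above_of_compact_support hfc
  obtain ⟨Cζ, hζ⟩ := exists_lipschitzWith_testFun h h1 hu hm hmu hCf hZ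
  have hB : LipschitzWith (1 * C) (fun q => levelB R₁ R₀ (u q)) :=
    LipschitzOnWith.comp (lipschitzOnWith_levelB h h1) hu.lipschitzOnWith
      (fun q _ => hpos q) |> lipschitzOnWith_univ.1
  have e1 := c.integral_mul_lap (μ := μ) hB hf hfc hfD
  have e2 := c.integral_mul_fderiv_time (μ := μ) hB hf hfc hfD
  have hK := hfc.isCompact
  have bc : ∀ {F : E → ℝ}, ContinuousOn F c.D → EssBdd (μ.restrict (tsupport f)) F := fun h =>
    c.essBdd_of_contOn hK hfD h
  have bu := bc hu.continuous.continuousOn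
  have bB := bc hB.continuous.continuousOn
  have bf := bc hf.continuous.continuousOn
  have bv := bc c.v_smooth.continuousOn
  have bk := bc c.k_cont
  have hf' : Continuous fun q => fderiv ℝ f q c.τ :=
    (hf.continuous_fderiv (by simp)).clm_apply continuous_const
  have i1 : Integrable (fun q => levelB R₁ R₀ (u q) * fderiv ℝ f q c.τ * c.v q) μ :=
    EssBdd.integrable_of_zero hK ((bB.mul (bc hf'.continuousOn)).mul bv)
      fun q hq => by simp [fderiv_eq_zero_of_notMem hq]
  have i2 : Integrable (fun q => levelB R₁ R₀ (u q) * c.lap f q * c.v q) μ :=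
    EssBdd.integrable_of_zero hK ((bB.mul (bc (c.continuousOn_lap hf.contDiffOn))).mul bv)
      fun q hq => by simp [c.lap_eq_zero hq]
  have i3 : Integrable (c.weak u (testFun R₁ R₀ u f)) μ :=
    EssBdd.integrable_of_zero hK (c.essBdd_weak hK hfD hu hζ)
      fun q hq => c.weak_eq_zero fun h' => hq (tsupport_testFun _ _ _ _ h')
  have i4 : Integrable (fun q => (fderiv ℝ (fun q => levelB R₁ R₀ (u q)) q c.τ
      + levelB R₁ R₀ (u q) * c.k q) * f q * c.v q) μ :=
    EssBdd.integrable_of_zero hK ((((essBdd_fderiv hB c.τ _).add (bB.mul bk)).mul bf).mul bv)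
      fun q hq => by simp [image_eq_zero_of_notMem_tsupport hq]
  have i5 : Integrable (fun q => c.v q *
      c.pair q (fderiv ℝ (fun q => levelB R₁ R₀ (u q)) q) (fderiv ℝ f q)) μ :=
    EssBdd.integrable_of_zero hK (bv.mul (c.essBdd_pair hK hfD hB hCf))
      fun q hq => by simp [pair, fderiv_eq_zero_of_notMem hq]
  have e3 : ∫ q, levelB R₁ R₀ (u q) * (fderiv ℝ f q c.τ - c.lap f q) * c.v q ∂μ
      = ∫ q, levelB R₁ R₀ (u q) * fderiv ℝ f q c.τ * c.v q ∂μ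
        - ∫ q, levelB R₁ R₀ (u q) * c.lap f q * c.v q ∂μ := by
    rw [← integral_sub i1 i2]
    congr 1; funext q; ring
  have i6 : Integrable (fun q => c.v q *
      c.pair q (fderiv ℝ (fun q => levelB R₁ R₀ (u q)) q) (fderiv ℝ f q)
      - (fderiv ℝ (fun q => levelB R₁ R₀ (u q)) q c.τ
      + levelB R₁ R₀ (u q) * c.k q) * f q * c.v q) μ := i5.sub i4
  rw [e3, e1, e2, sub_neg_eq_add, add_comm (-_), ← sub_eq_add_neg, ← integral_sub i5 i4,
    ← integral_add i3 i6]
  apply integral_congr_ae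
  -- `∇u = 0` almost everywhere on the levels `R₀` and `R₁`, where `A` has its corners
  filter_upwards [hu.ae_differentiableAt (μ := μ), ae_fderiv_eq_zero_of_level (μ := μ) hu R₀,
    ae_fderiv_eq_zero_of_level (μ := μ) hu R₁] with q hq hq0 hq1
  by_cases hqf : q ∈ tsupport f
  swap
  · have hz : q ∉ tsupport (testFun R₁ R₀ u f) := fun h' => hqf (tsupport_testFun _ _ _ _ h')
    rw [c.weak_eq_zero hz]
    simp [gap, pair, image_eq_zero_of_notMem_tsupport hqf, fderiv_eq_zero_of_notMem hqf]
  have hqD := hfD hqf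
  have hu' := hq.hasFDerivAt
  have huq := (hpos q).ne'
  set u' := fderiv ℝ u q with hu'def
  -- derivatives at `q` of `B(u)` and of the test function
  have dB : fderiv ℝ (fun q => levelB R₁ R₀ (u q)) q = (levelA R₁ R₀ (u q) / u q) • u' :=
    ((hasDerivAt_levelB h1 h0 (hpos q)).comp_hasFDerivAt q hu').fderiv
  have dA : HasFDerivAt (fun x => levelA R₁ R₀ (u x))
      ((if R₀ < u q then (0 : ℝ) else 1) • u' - (if R₁ < u q then (0 : ℝ) else 1) • u') q :=
    (hasFDerivAt_min_const hu' hq0).sub (hasFDerivAt_min_const hu' hq1)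
  have dI : HasFDerivAt (fun x => (u x)⁻¹) (-(u q ^ 2)⁻¹ • u') q :=
    (hasDerivAt_inv huq).comp_hasFDerivAt q hu'
  have df := (hf.differentiable (by simp) q).hasFDerivAt
  have dζ : fderiv ℝ (testFun R₁ R₀ u f) q
      = ((((if R₀ < u q then (0 : ℝ) else 1) - (if R₁ < u q then (0 : ℝ) else 1)) * (u q)⁻¹
          - levelA R₁ R₀ (u q) * (u q ^ 2)⁻¹) * f q) • u'
        + (levelA R₁ R₀ (u q) * (u q)⁻¹) • fderiv ℝ f q := by
    have := ((dA.mul dI).mul df).fderiv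
    rw [show testFun R₁ R₀ u f = ((fun x => levelA R₁ R₀ (u x)) * (fun x => (u x)⁻¹)) * f from rfl,
      this]
    ext w
    simp only [add_apply, smul_apply, smul_eq_mul, sub_apply, Pi.mul_apply]
    ring
  rw [gap, weak, dζ, dB, pair_add_right, pair_smul_right, pair_smul_right,
    c.pair_comm hqD (_ • u'), pair_smul_right, c.pair_comm hqD (fderiv ℝ f q), testFun, ← hu'def]
  simp only [smul_apply, smul_eq_mul]
  -- the coefficient of `|∇u|²`, checked on each of the three ranges of `u`
  have key : ((if R₀ < u q then R₀ else 0) - (if R₁ < u q then R₁ else 0)) / u q ^ 2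
      * c.pair q u' u' = -((((if R₀ < u q then (0 : ℝ) else 1) - (if R₁ < u q then (0 : ℝ) else 1))
        * (u q)⁻¹ - levelA R₁ R₀ (u q) * (u q ^ 2)⁻¹)) * c.pair q u' u' := by
    congr 1
    by_cases c0 : R₀ < u q
    · have c1 : R₁ < u q := h.trans_lt c0
      simp only [if_pos c0, if_pos c1, levelA, min_eq_left c0.le, min_eq_left c1.le]
      field_simp
      ring
    · by_cases c1 : R₁ < u q
      · simp only [if_neg c0, if_pos c1, levelA, min_eq_right (not_lt.1 c0), min_eq_left c1.le]
        field_simp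
        ring
      · simp only [if_neg c0, if_neg c1, levelA_eq_zero h (not_lt.1 c1)]
        simp
  have key2 : ((if R₀ < u q then R₀ else 0) - (if R₁ < u q then R₁ else 0)) *
      (c.pair q u' u' / u q ^ 2) = ((if R₀ < u q then R₀ else 0) - (if R₁ < u q then R₁ else 0)) /
      u q ^ 2 * c.pair q u' u' := by ring
  rw [key2, key]
  field_simp
  ring

end HeatCoeff

/-! ### Matrices under a change of frame -/

section Matrices

variable {n : ℕ}

theorem sum_mul_mul_eq_dotProduct (A : Matrix (Fin n) (Fin n) ℝ) (a b : Fin n → ℝ) :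
    ∑ i, ∑ j, A i j * a i * b j = dotProduct a (A.mulVec b) := by
  simp only [dotProduct, Matrix.mulVec, Finset.mul_sum]
  exact Finset.sum_congr rfl fun i _ => Finset.sum_congr rfl fun j _ => by ring

theorem inv_transpose_mul_mul {J G : Matrix (Fin n) (Fin n) ℝ} :
    (J.transpose * G * J)⁻¹ = J⁻¹ * G⁻¹ * (J⁻¹).transpose := by
  rw [Matrix.mul_inv_rev, Matrix.mul_inv_rev, Matrix.transpose_nonsing_inv, Matrix.mul_assoc]

theorem inv_pairing_change_frame {J G : Matrix (Fin n) (Fin n) ℝ} (hJ : IsUnit J.det)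
    (a b : Fin n → ℝ) :
    ∑ i, ∑ j, (J.transpose * G * J)⁻¹ i j * (J.transpose.mulVec a) i * (J.transpose.mulVec b) j
      = ∑ i, ∑ j, G⁻¹ i j * a i * b j := by
  rw [sum_mul_mul_eq_dotProduct, sum_mul_mul_eq_dotProduct, inv_transpose_mul_mul,
    Matrix.mulVec_mulVec, Matrix.mul_assoc, ← Matrix.transpose_mul, Matrix.mul_nonsing_inv J hJ,
    Matrix.transpose_one, Matrix.mul_one, Matrix.mulVec_transpose, ← Matrix.dotProduct_mulVec,
    Matrix.mulVec_mulVec, ← Matrix.mul_assoc, Matrix.mul_nonsing_inv J hJ, Matrix.one_mul]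

theorem inv_trace_change_frame {J G B : Matrix (Fin n) (Fin n) ℝ} (hJ : IsUnit J.det) :
    ∑ i, ∑ j, (J.transpose * G * J)⁻¹ i j * (J.transpose * B * J) i j
      = ∑ i, ∑ j, G⁻¹ i j * B i j := by
  have key : ∀ A B : Matrix (Fin n) (Fin n) ℝ,
      ∑ i, ∑ j, A i j * B i j = (A * B.transpose).trace := by
    intro A B
    simp [Matrix.trace, Matrix.mul_apply]
  have e1 : (J⁻¹).transpose * J.transpose = 1 := by
    rw [← Matrix.transpose_mul, Matrix.mul_nonsing_inv J hJ, Matrix.transpose_one]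
  rw [key, key, inv_transpose_mul_mul, Matrix.transpose_mul, Matrix.transpose_mul,
    Matrix.transpose_transpose]
  calc (J⁻¹ * G⁻¹ * J⁻¹.transpose * (J.transpose * (B.transpose * J))).trace
      = (J⁻¹ * (G⁻¹ * (J⁻¹.transpose * J.transpose) * B.transpose * J)).trace := by
        simp only [Matrix.mul_assoc]
    _ = ((G⁻¹ * B.transpose) * (J * J⁻¹)).trace := by
        rw [e1, Matrix.mul_one, Matrix.trace_mul_comm, Matrix.mul_assoc]
    _ = _ := by rw [Matrix.mul_nonsing_inv J hJ, Matrix.mul_one]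

/-- The matrix of a linear endomorphism of `ℝⁿ` in the standard basis. -/
def stdMatrix (L : Model n →L[ℝ] Model n) : Matrix (Fin n) (Fin n) ℝ :=
  Matrix.of fun k i => L (stdVec i) k

theorem eq_sum_stdVec (w : Model n) : w = ∑ k, w k • stdVec k := by
  ext j
  simp [Pi.single_apply]

theorem det_stdMatrix (L : Model n →L[ℝ] Model n) : (stdMatrix L).det = L.det := by
  have : stdMatrix L = LinearMap.toMatrix (EuclideanSpace.basisFun (Fin n) ℝ).toBasis
      (EuclideanSpace.basisFun (Fin n) ℝ).toBasis (L : Model n →ₗ[ℝ] Model n) := by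
    ext k i
    simp [stdMatrix, LinearMap.toMatrix_apply]
  rw [this, LinearMap.det_toMatrix]

theorem stdMatrix_mul (L L' : Model n →L[ℝ] Model n) :
    stdMatrix (L.comp L') = stdMatrix L * stdMatrix L' := by
  ext k i
  simp only [stdMatrix, Matrix.of_apply, Matrix.mul_apply, ContinuousLinearMap.comp_apply]
  conv_lhs => rw [eq_sum_stdVec (L' (stdVec i))]
  simp [map_sum, mul_comm]

end Matrices

/-! ### Changes of charts -/

section Charts

variable {n : ℕ} {M : Type*} [TopologicalSpace M] [ChartedSpace (Model n) M]

/-- The domain of the chart centred at `c`, as an open set of `ℝⁿ`. -/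
abbrev chartTarget (n : ℕ) {M : Type*} [TopologicalSpace M] [ChartedSpace (Model n) M] (c : M) :
    Set (Model n) := (extChartAt 𝓘(ℝ, Model n) c).target

/-- The domain of the chart centred at `c`, as an open set of `M`. -/
abbrev chartSource (n : ℕ) {M : Type*} [TopologicalSpace M] [ChartedSpace (Model n) M] (c : M) :
    Set M := (extChartAt 𝓘(ℝ, Model n) c).source

/-- The chart centred at `c`. -/
abbrev coord (n : ℕ) {M : Type*} [TopologicalSpace M] [ChartedSpace (Model n) M] (c : M) :
    M → Model n := extChartAt 𝓘(ℝ, Model n) c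

/-- The inverse of the chart centred at `c`. -/
abbrev param (n : ℕ) {M : Type*} [TopologicalSpace M] [ChartedSpace (Model n) M] (c : M) :
    Model n → M := (extChartAt 𝓘(ℝ, Model n) c).symm

theorem isOpen_chartTarget (c : M) : IsOpen (chartTarget n c) :=
  isOpen_extChartAt_target c

theorem isOpen_chartSource (c : M) : IsOpen (chartSource n c) := isOpen_extChartAt_source c

theorem param_mem {c : M} {y : Model n} (hy : y ∈ chartTarget n c) :
    param n c y ∈ chartSource n c :=
  (extChartAt 𝓘(ℝ, Model n) c).map_target hy

theorem coord_mem {c x : M} (hx : x ∈ chartSource n c) : coord n c x ∈ chartTarget n c :=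
  (extChartAt 𝓘(ℝ, Model n) c).map_source hx

theorem coord_param {c : M} {y : Model n} (hy : y ∈ chartTarget n c) :
    coord n c (param n c y) = y := (extChartAt 𝓘(ℝ, Model n) c).right_inv hy

theorem param_coord {c x : M} (hx : x ∈ chartSource n c) : param n c (coord n c x) = x :=
  (extChartAt 𝓘(ℝ, Model n) c).left_inv hx

theorem continuousOn_param (c : M) : ContinuousOn (param n c) (chartTarget n c) :=
  continuousOn_extChartAt_symm c

theorem continuousOn_coord (c : M) : ContinuousOn (coord n c) (chartSource n c) :=
  continuousOn_extChartAt c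

/-- The change of coordinates from the chart at `c'` to the chart at `c`. -/
def transition (n : ℕ) {M : Type*} [TopologicalSpace M] [ChartedSpace (Model n) M] (c' c : M) :
    Model n → Model n := coord n c ∘ param n c'

/-- The part of the chart domain at `c'` that corresponds to the overlap with the chart at `c`. -/
def overlap (n : ℕ) {M : Type*} [TopologicalSpace M] [ChartedSpace (Model n) M] (c' c : M) :
    Set (Model n) := chartTarget n c' ∩ param n c' ⁻¹' chartSource n c

theorem isOpen_overlap (c' c : M) : IsOpen (overlap n c' c) :=
  (continuousOn_param c').isOpen_inter_preimage (isOpen_chartTarget c') (isOpen_chartSource c)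

theorem param_transition {c' c : M} {y : Model n} (hy : y ∈ overlap n c' c) :
    param n c (transition n c' c y) = param n c' y := param_coord hy.2

theorem transition_mem {c' c : M} {y : Model n} (hy : y ∈ overlap n c' c) :
    transition n c' c y ∈ overlap n c c' := by
  refine ⟨coord_mem hy.2, ?_⟩
  rw [mem_preimage, param_transition hy]
  exact param_mem hy.1

theorem transition_transition {c' c : M} {y : Model n} (hy : y ∈ overlap n c' c) :
    transition n c c' (transition n c' c y) = y := by
  rw [transition, Function.comp_apply, param_transition hy]
  exact coord_param hy.1

theorem image_transition (c' c : M) : transition n c' c '' overlap n c' c = overlap n c c' := by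
  apply Subset.antisymm
  · rintro _ ⟨y, hy, rfl⟩
    exact transition_mem hy
  · intro y hy
    exact ⟨_, transition_mem hy, transition_transition hy⟩

theorem injOn_transition (c' c : M) : InjOn (transition n c' c) (overlap n c' c) := by
  intro y hy z hz h
  rw [← transition_transition hy, h, transition_transition hz]

variable [IsManifold 𝓘(ℝ, Model n) ∞ M]

theorem contMDiffOn_param (c : M) :
    ContMDiffOn 𝓘(ℝ, Model n) 𝓘(ℝ, Model n) ∞ (param n c) (chartTarget n c) :=
  contMDiffOn_extChartAt_symm c

theorem contMDiffOn_coord (c : M) :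
    ContMDiffOn 𝓘(ℝ, Model n) 𝓘(ℝ, Model n) ∞ (coord n c) (chartSource n c) := by
  rw [chartSource, extChartAt_source]
  exact contMDiffOn_extChartAt

theorem contDiffOn_transition (c' c : M) :
    ContDiffOn ℝ ∞ (transition n c' c) (overlap n c' c) := by
  rw [← contMDiffOn_iff_contDiffOn]
  exact (contMDiffOn_coord c).comp ((contMDiffOn_param c').mono inter_subset_left)
    fun y hy => hy.2

theorem differentiableAt_transition {c' c : M} {y : Model n} (hy : y ∈ overlap n c' c) :
    DifferentiableAt ℝ (transition n c' c) y :=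
  ((contDiffOn_transition c' c).contDiffAt ((isOpen_overlap c' c).mem_nhds hy)).differentiableAt
    (by simp)

/-- The derivative of the change of coordinates. -/
def jac (n : ℕ) {M : Type*} [TopologicalSpace M] [ChartedSpace (Model n) M] (c' c : M)
    (y : Model n) : Model n →L[ℝ] Model n := fderiv ℝ (transition n c' c) y

theorem jac_comp_jac {c' c : M} {y : Model n} (hy : y ∈ overlap n c' c) :
    (jac n c c' (transition n c' c y)).comp (jac n c' c y) = ContinuousLinearMap.id ℝ _ := by
  have h1 := ((differentiableAt_transition (transition_mem hy)).hasFDerivAt.comp y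
    (differentiableAt_transition hy).hasFDerivAt)
  refine h1.unique ((hasFDerivAt_id y).congr_of_eventuallyEq ?_)
  filter_upwards [(isOpen_overlap c' c).mem_nhds hy] with z hz
  exact transition_transition hz

theorem isUnit_det_jac {c' c : M} {y : Model n} (hy : y ∈ overlap n c' c) :
    IsUnit (stdMatrix (jac n c' c y)).det := by
  have h := congrArg (fun L => (stdMatrix L).det) (jac_comp_jac hy)
  simp only [stdMatrix_mul, Matrix.det_mul] at h
  rw [det_stdMatrix (ContinuousLinearMap.id ℝ _)] at h
  have : (ContinuousLinearMap.id ℝ (Model n)).det = 1 := by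
    simp [ContinuousLinearMap.det]
  rw [this] at h
  exact IsUnit.of_mul_eq_one_right _ h

/-- The coordinate frame at the point with coordinates `y`: the differential of the inverse chart,
read in the model space. -/
def frame (c : M) (y : Model n) : Model n →L[ℝ] Model n :=
  mfderiv 𝓘(ℝ, Model n) 𝓘(ℝ, Model n) (param n c) y

/-- A field of bilinear forms, evaluated on vectors read in the model space. -/
def evalForm (β : BilinField n M) (x : M) (v w : Model n) : ℝ := β x v w

theorem components_eq (β : BilinField n M) (c : M) (y : Model n) (i j : Fin n) :
    components β c y i j
      = evalForm β (param n c y) (frame c y (stdVec i)) (frame c y (stdVec j)) := rfl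

theorem evalForm_sum (β : BilinField n M) (x : M) (L : Model n →L[ℝ] Model n) (v w : Model n) :
    evalForm β x (L v) (L w)
      = ∑ k, ∑ l, v k * w l * evalForm β x (L (stdVec k)) (L (stdVec l)) := by
  have hv : L v = ∑ k, v k • L (stdVec k) := by
    conv_lhs => rw [eq_sum_stdVec v]
    simp [map_sum]
  have hw : L w = ∑ k, w k • L (stdVec k) := by
    conv_lhs => rw [eq_sum_stdVec w]
    simp [map_sum]
  let B : Model n →L[ℝ] Model n →L[ℝ] ℝ := β x
  change B (L v) (L w) = ∑ k, ∑ l, v k * w l * B (L (stdVec k)) (L (stdVec l))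
  rw [hv, hw]
  simp only [map_sum, map_smul, sum_apply, smul_apply, smul_eq_mul, Finset.mul_sum]
  rw [Finset.sum_comm]
  exact Finset.sum_congr rfl fun i _ => Finset.sum_congr rfl fun j _ => by ring

theorem mdifferentiableAt_param {c : M} {y : Model n} (hy : y ∈ chartTarget n c) :
    MDifferentiableAt 𝓘(ℝ, Model n) 𝓘(ℝ, Model n) (param n c) y :=
  ((contMDiffOn_param c).contMDiffAt ((isOpen_chartTarget c).mem_nhds hy)).mdifferentiableAt
    (by simp)

theorem frame_transition {c' c : M} {y : Model n} (hy : y ∈ overlap n c' c) :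
    frame c' y = (frame c (transition n c' c y)).comp (jac n c' c y) := by
  have h1 : HasMFDerivAt 𝓘(ℝ, Model n) 𝓘(ℝ, Model n) (transition n c' c) y (jac n c' c y) :=
    (differentiableAt_transition hy).hasFDerivAt.hasMFDerivAt
  have h2 := (mdifferentiableAt_param (transition_mem hy).1).hasMFDerivAt
  have h3 := h2.comp y h1
  have h4 : param n c' =ᶠ[𝓝 y] param n c ∘ transition n c' c := by
    filter_upwards [(isOpen_overlap c' c).mem_nhds hy] with z hz
    exact (param_transition hz).symm
  exact (h3.congr_of_eventuallyEq h4).mfderiv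

theorem frame_injective {c : M} {y : Model n} (hy : y ∈ chartTarget n c) :
    Function.Injective (frame c y) := by
  have h1 := (mdifferentiableAt_param hy).hasMFDerivAt
  have h2 : MDifferentiableAt 𝓘(ℝ, Model n) 𝓘(ℝ, Model n) (coord n c) (param n c y) :=
    ((contMDiffOn_coord c).contMDiffAt ((isOpen_chartSource c).mem_nhds
      (param_mem hy))).mdifferentiableAt (by simp)
  have h3 := h2.hasMFDerivAt.comp y h1
  have h4 : (id : Model n → Model n) =ᶠ[𝓝 y] coord n c ∘ param n c := by
    filter_upwards [(isOpen_chartTarget c).mem_nhds hy] with z hz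
    exact (coord_param hz).symm
  have h5 := (h3.congr_of_eventuallyEq h4).mfderiv
  rw [mfderiv_id] at h5
  intro v w hvw
  have hv := DFunLike.congr_fun h5 v
  have hw := DFunLike.congr_fun h5 w
  have e1 : v = mfderiv 𝓘(ℝ, Model n) 𝓘(ℝ, Model n) (coord n c) (param n c y) (frame c y v) := hv
  have e2 : w = mfderiv 𝓘(ℝ, Model n) 𝓘(ℝ, Model n) (coord n c) (param n c y) (frame c y w) := hw
  rw [e1, e2, hvw]

theorem components_transition (β : BilinField n M) {c' c : M} {y : Model n}
    (hy : y ∈ overlap n c' c) :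
    components β c' y = (stdMatrix (jac n c' c y)).transpose *
      components β c (transition n c' c y) * stdMatrix (jac n c' c y) := by
  ext i j
  rw [components_eq, frame_transition hy, ← param_transition hy]
  simp only [ContinuousLinearMap.comp_apply]
  rw [evalForm_sum]
  simp only [Matrix.mul_apply, Matrix.transpose_apply, stdMatrix, Matrix.of_apply, components_eq,
    Finset.sum_mul]
  rw [Finset.sum_comm]
  exact Finset.sum_congr rfl fun i _ => Finset.sum_congr rfl fun j _ => by ring

theorem partialDeriv_transition {f : M → ℝ} {c' c : M} {y : Model n} (hy : y ∈ overlap n c' c)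
    (hf : DifferentiableAt ℝ (inChart f c) (transition n c' c y)) :
    (fun i => partialDeriv i (inChart f c') y) = (stdMatrix (jac n c' c y)).transpose.mulVec
      (fun k => partialDeriv k (inChart f c) (transition n c' c y)) := by
  have h4 : inChart f c' =ᶠ[𝓝 y] inChart f c ∘ transition n c' c := by
    filter_upwards [(isOpen_overlap c' c).mem_nhds hy] with z hz
    exact congrArg f (param_transition hz).symm
  have h5 := (hf.hasFDerivAt.comp y (differentiableAt_transition hy).hasFDerivAt)
  funext i
  simp only [partialDeriv, h4.fderiv_eq, h5.fderiv, ContinuousLinearMap.comp_apply]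
  have : fderiv ℝ (transition n c' c) y (stdVec i)
      = ∑ k, stdMatrix (jac n c' c y) k i • stdVec k := eq_sum_stdVec _
  rw [this, map_sum]
  simp [Matrix.mulVec, dotProduct]

end Charts

/-! ### The coordinate expressions of the metrics -/

section MatrixCalculus

variable {n : ℕ}

theorem contDiffOn_det {E : Type*} [NormedAddCommGroup E] [NormedSpace ℝ E] {N : ℕ∞ω}
    {A : E → Matrix (Fin n) (Fin n) ℝ} {S : Set E}
    (hA : ∀ i j, ContDiffOn ℝ N (fun q => A q i j) S) :
    ContDiffOn ℝ N (fun q => (A q).det) S := by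
  simp only [Matrix.det_apply']
  exact ContDiffOn.sum fun σ _ => contDiffOn_const.mul (contDiffOn_prod fun i _ => hA _ _)

theorem contDiffOn_inv_apply {E : Type*} [NormedAddCommGroup E] [NormedSpace ℝ E] {N : ℕ∞ω}
    {A : E → Matrix (Fin n) (Fin n) ℝ} {S : Set E} (hA : ∀ i j, ContDiffOn ℝ N (fun q => A q i j) S)
    (hdet : ∀ q ∈ S, (A q).det ≠ 0) (i j : Fin n) :
    ContDiffOn ℝ N (fun q => (A q)⁻¹ i j) S := by
  have e : ∀ q, (A q)⁻¹ i j = (A q).det⁻¹ * ((A q).updateRow j (Pi.single i 1)).det := by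
    intro q
    rw [Matrix.inv_def, Matrix.smul_apply, Matrix.adjugate_apply, Ring.inverse_eq_inv', smul_eq_mul]
  simp only [e]
  refine ((contDiffOn_det hA).inv hdet).mul (contDiffOn_det fun k l => ?_)
  by_cases hk : k = j
  · subst hk
    simp only [Matrix.updateRow_self]
    exact contDiffOn_const
  · simp only [Matrix.updateRow_ne hk]
    exact hA k l

/-- Jacobi's formula. -/
theorem hasDerivAt_det {A : ℝ → Matrix (Fin n) (Fin n) ℝ} {A' : Matrix (Fin n) (Fin n) ℝ} {t : ℝ}
    (hA : ∀ i j, HasDerivAt (fun s => A s i j) (A' i j) t) :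
    HasDerivAt (fun s => (A s).det) (∑ i, ∑ j, (A t).adjugate i j * A' j i) t := by
  have h1 : HasDerivAt (fun s => (A s).det)
      (∑ σ : Equiv.Perm (Fin n), (((Equiv.Perm.sign σ : ℤ) : ℝ)) *
        ∑ i, (∏ j ∈ Finset.univ.erase i, A t (σ j) j) * A' (σ i) i) t := by
    simp only [Matrix.det_apply']
    refine HasDerivAt.fun_sum fun σ _ => HasDerivAt.const_mul _ ?_
    simpa only [smul_eq_mul] using HasDerivAt.fun_finsetProd (u := Finset.univ)
      (f := fun i s => A s (σ i) i) fun i _ => hA (σ i) i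
  convert h1 using 1
  have h2 : ∀ i, ∑ j, (A t).adjugate i j * A' j i = ((A t).updateCol i (fun j => A' j i)).det := by
    intro i
    rw [← Matrix.cramer_apply, Matrix.cramer_eq_adjugate_mulVec]
    rfl
  simp only [h2, Matrix.det_apply', Finset.mul_sum]
  rw [Finset.sum_comm]
  refine Finset.sum_congr rfl fun σ _ => Finset.sum_congr rfl fun i _ => ?_
  congr 1
  rw [← Finset.mul_prod_erase _ _ (Finset.mem_univ i), Matrix.updateCol_self, mul_comm]
  congr 1
  exact Finset.prod_congr rfl fun j hj => Matrix.updateCol_ne (Finset.ne_of_mem_erase hj)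

end MatrixCalculus

section Gram

variable {n : ℕ} {M : Type*} [TopologicalSpace M] [ChartedSpace (Model n) M]
  [IsManifold 𝓘(ℝ, Model n) ∞ M]

theorem gram_posDef (g : SmoothMetric n M) {c : M} {y : Model n} (hy : y ∈ chartTarget n c) :
    (gram g c y).PosDef := by
  apply Matrix.PosDef.of_dotProduct_mulVec_pos
  · ext i j
    simp only [Matrix.conjTranspose_apply, star_trivial]
    exact g.symm _ _ _
  · intro x hx
    have h1 : WithLp.toLp 2 x ≠ (0 : Model n) := fun h => hx (by
      have := congrArg WithLp.ofLp h
      simpa using this)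
    have h2 : frame c y (WithLp.toLp 2 x) ≠ 0 := fun h =>
      h1 (frame_injective hy (h.trans (map_zero _).symm))
    have h3 : 0 < evalForm g.inner (param n c y) (frame c y (WithLp.toLp 2 x))
        (frame c y (WithLp.toLp 2 x)) := g.pos _ _ h2
    rw [evalForm_sum] at h3
    rw [star_trivial, ← sum_mul_mul_eq_dotProduct]
    refine h3.trans_eq (Finset.sum_congr rfl fun i _ => Finset.sum_congr rfl fun j _ => ?_)
    rw [gram, components_eq]
    ring

theorem gram_det_pos (g : SmoothMetric n M) {c : M} {y : Model n} (hy : y ∈ chartTarget n c) :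
    0 < (gram g c y).det := (gram_posDef g hy).det_pos

theorem gram_symm (g : SmoothMetric n M) (c : M) (y : Model n) :
    (gram g c y).transpose = gram g c y := by
  ext i j
  exact g.symm _ _ _

theorem gram_inv_symm (g : SmoothMetric n M) (c : M) (y : Model n) (i j : Fin n) :
    (gram g c y)⁻¹ i j = (gram g c y)⁻¹ j i := by
  conv_rhs => rw [← gram_symm g c y, ← Matrix.transpose_nonsing_inv]
  rfl

theorem volDensity_pos (g : SmoothMetric n M) {c : M} {y : Model n} (hy : y ∈ chartTarget n c) :
    0 < volDensity g c y := Real.sqrt_pos.2 (gram_det_pos g hy)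

theorem gram_transition (g : SmoothMetric n M) {c' c : M} {y : Model n} (hy : y ∈ overlap n c' c) :
    gram g c' y = (stdMatrix (jac n c' c y)).transpose *
      gram g c (transition n c' c y) * stdMatrix (jac n c' c y) :=
  components_transition _ hy

theorem volDensity_transition (g : SmoothMetric n M) {c' c : M} {y : Model n}
    (hy : y ∈ overlap n c' c) :
    volDensity g c' y = |(jac n c' c y).det| * volDensity g c (transition n c' c y) := by
  rw [volDensity, volDensity, gram_transition g hy, Matrix.det_mul, Matrix.det_mul,
    Matrix.det_transpose, det_stdMatrix, mul_right_comm, ← sq, Real.sqrt_mul (sq_nonneg _),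
    Real.sqrt_sq_eq_abs]

/-! ### Smoothness in space and time -/

/-- The coordinate vector fields are smooth sections of the tangent bundle. -/
theorem contMDiffOn_frame (c : M) (i : Fin n) :
    ContMDiffOn 𝓘(ℝ, Model n) (𝓘(ℝ, Model n).prod 𝓘(ℝ, Model n)) ∞
      (fun x : M => TotalSpace.mk' (Model n) (E := TangentSpace 𝓘(ℝ, Model n)) x
        (frame c (coord n c x) (stdVec i))) (chartSource n c) := by
  have h := (trivializationAt (Model n) (TangentSpace 𝓘(ℝ, Model n)) c).contMDiffOn_symm
    (IB := 𝓘(ℝ, Model n)) (n := ∞)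
  have h2 : ContMDiffOn 𝓘(ℝ, Model n) (𝓘(ℝ, Model n).prod 𝓘(ℝ, Model n)) ∞
      (fun x : M => (x, (stdVec i : Model n))) (chartSource n c) :=
    contMDiffOn_id.prodMk contMDiffOn_const
  have h3 : MapsTo (fun x : M => (x, (stdVec i : Model n))) (chartSource n c)
      (trivializationAt (Model n) (TangentSpace 𝓘(ℝ, Model n)) c).target := by
    intro x hx
    rw [Trivialization.mem_target]
    simpa [chartSource, extChartAt_source] using hx
  refine (h.comp h2 h3).congr fun x hx => ?_
  have hx' : x ∈ (chartAt (Model n) c).source := by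
    simpa [chartSource, extChartAt_source] using hx
  have hb : x ∈ (trivializationAt (Model n) (TangentSpace 𝓘(ℝ, Model n)) c).baseSet := by
    simpa using hx'
  rw [Function.comp_apply, ← Trivialization.mk_symm _ hb]
  have e1 := TangentBundle.symmL_trivializationAt (I := 𝓘(ℝ, Model n)) hx'
  have e2 := DFunLike.congr_fun e1 (stdVec i)
  rw [Trivialization.symmL_apply] at e2
  · rw [e2]
    simp only [ModelWithCorners.range_eq_univ, mfderivWithin_univ]
    rfl
  · exact hb

theorem contDiffOn_gram {g : ℝ → SmoothMetric n M} {a b : ℝ} (hg : IsSmoothFamily g a b) (c : M)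
    (i j : Fin n) :
    ContDiffOn ℝ ∞ (fun q : Model n × ℝ => gram (g q.2) c q.1 i j)
      (chartTarget n c ×ˢ Icc a b) := by
  have hf : ∀ i, ContMDiffOn (𝓘(ℝ, Model n).prod 𝓘(ℝ, ℝ)) (𝓘(ℝ, Model n).prod 𝓘(ℝ, Model n)) ∞
      (fun p : M × ℝ => TotalSpace.mk' (Model n) (E := TangentSpace 𝓘(ℝ, Model n)) p.1
        (frame c (coord n c p.1) (stdVec i))) (chartSource n c ×ˢ Icc a b) := fun i =>
    (contMDiffOn_frame c i).comp contMDiffOn_fst fun p hp => hp.1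
  have hg' := hg.mono (prod_mono (subset_univ (chartSource n c)) (Subset.refl (Icc a b)))
  have h1 : ContMDiffOn (𝓘(ℝ, Model n).prod 𝓘(ℝ, ℝ)) (𝓘(ℝ, Model n).prod 𝓘(ℝ)) ∞
      (fun p : M × ℝ => TotalSpace.mk' ℝ (E := Bundle.Trivial M ℝ) p.1
        ((g p.2).inner p.1 (frame c (coord n c p.1) (stdVec i))
          (frame c (coord n c p.1) (stdVec j)))) (chartSource n c ×ˢ Icc a b) :=
    ContMDiffOn.clm_bundle_apply₂ (F₁ := Model n) (F₂ := Model n) hg' (hf i) (hf j)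
  have h2 : ContMDiffOn (𝓘(ℝ, Model n).prod 𝓘(ℝ, ℝ)) 𝓘(ℝ) ∞
      (fun p : M × ℝ => evalForm (g p.2).inner p.1 (frame c (coord n c p.1) (stdVec i))
          (frame c (coord n c p.1) (stdVec j))) (chartSource n c ×ˢ Icc a b) := by
    intro p hp
    have := h1 p hp
    simp only [contMDiffWithinAt_totalSpace] at this
    exact this.2
  have h3 : ContMDiffOn (𝓘(ℝ, Model n).prod 𝓘(ℝ, ℝ)) (𝓘(ℝ, Model n).prod 𝓘(ℝ, ℝ)) ∞
      (fun q : Model n × ℝ => (param n c q.1, q.2)) (chartTarget n c ×ˢ Icc a b) :=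
    ((contMDiffOn_param c).comp contMDiffOn_fst fun q hq => hq.1).prodMk contMDiffOn_snd
  have h4 := h2.comp h3 fun q hq => ⟨param_mem hq.1, hq.2⟩
  rw [← contMDiffOn_iff_contDiffOn]
  rw [modelWithCornersSelf_prod, ← chartedSpaceSelf_prod]
  refine h4.congr fun q hq => ?_
  rw [Function.comp_apply]
  simp only [coord_param hq.1]
  rfl

end Gram

/-! ### Independence of the chart -/

section Invariance

variable {n : ℕ} {M : Type*} [TopologicalSpace M] [ChartedSpace (Model n) M]
  [IsManifold 𝓘(ℝ, Model n) ∞ M]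

theorem coord_self_mem {x c : M} (hx : x ∈ chartSource n c) : coord n x x ∈ overlap n x c := by
  have h : x ∈ chartSource n x := mem_extChartAt_source x
  refine ⟨coord_mem h, ?_⟩
  rw [mem_preimage, param_coord h]
  exact hx

theorem transition_coord_self (x c : M) : transition n x c (coord n x x) = coord n c x := by
  rw [transition, Function.comp_apply, param_coord (mem_extChartAt_source x)]

theorem sum_inv_gram_transition (g : SmoothMetric n M) {f k : M → ℝ} {c' c : M} {y : Model n}
    (hy : y ∈ overlap n c' c)
    (hf : DifferentiableAt ℝ (inChart f c) (transition n c' c y))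
    (hk : DifferentiableAt ℝ (inChart k c) (transition n c' c y)) :
    ∑ i, ∑ j, (gram g c' y)⁻¹ i j * partialDeriv i (inChart f c') y
        * partialDeriv j (inChart k c') y
      = ∑ i, ∑ j, (gram g c (transition n c' c y))⁻¹ i j
        * partialDeriv i (inChart f c) (transition n c' c y)
        * partialDeriv j (inChart k c) (transition n c' c y) := by
  have e1 := partialDeriv_transition hy hf
  have e2 := partialDeriv_transition hy hk
  have h := inv_pairing_change_frame (G := gram g c (transition n c' c y)) (isUnit_det_jac hy)
    (fun k => partialDeriv k (inChart f c) (transition n c' c y))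
    (fun l => partialDeriv l (inChart k c) (transition n c' c y))
  rw [← gram_transition g hy, ← e1, ← e2] at h
  exact h

theorem gradNormSq_eq (g : SmoothMetric n M) {f : M → ℝ} {c x : M} (hx : x ∈ chartSource n c)
    (hf : DifferentiableAt ℝ (inChart f c) (coord n c x)) :
    gradNormSq g f x = ∑ i, ∑ j, (gram g c (coord n c x))⁻¹ i j
      * partialDeriv i (inChart f c) (coord n c x)
      * partialDeriv j (inChart f c) (coord n c x) := by
  have h := sum_inv_gram_transition g (f := f) (k := f) (coord_self_mem hx)
    (by rwa [transition_coord_self]) (by rwa [transition_coord_self])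
  rw [transition_coord_self] at h
  exact h

theorem metricTrace_eq (g : SmoothMetric n M) (β : BilinField n M) {c x : M}
    (hx : x ∈ chartSource n c) :
    metricTrace g β x = ∑ i, ∑ j, (gram g c (coord n c x))⁻¹ i j
      * components β c (coord n c x) i j := by
  have hy := coord_self_mem hx
  have h : metricTrace g β x = ∑ i, ∑ j, (gram g x (coord n x x))⁻¹ i j
      * components β x (coord n x x) i j := rfl
  rw [h, gram_transition g hy, components_transition β hy,
    inv_trace_change_frame (isUnit_det_jac hy), transition_coord_self]

/-- The coefficients of the Laplacian of one metric in the chart centred at `c`. -/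
def spaceCoeff (g : SmoothMetric n M)
    (hg : ∀ (c : M) (i j : Fin n), ContDiffOn ℝ ∞ (fun y => gram g c y i j) (chartTarget n c))
    (c : M) : HeatCoeff (Fin n) (Model n) where
  D := chartTarget n c
  isOpen := isOpen_chartTarget c
  e i := stdVec i
  τ := 0
  v := volDensity g c
  k _ := 0
  G i j y := (gram g c y)⁻¹ i j
  v_smooth := (contDiffOn_det (hg c)).sqrt fun _ hy => (gram_det_pos g hy).ne'
  v_pos _ hy := volDensity_pos g hy
  G_smooth i j := contDiffOn_inv_apply (hg c) (fun _ hy => (gram_det_pos g hy).ne') i j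
  G_symm i j _ _ := gram_inv_symm g c _ i j
  k_cont := continuousOn_const
  deriv_v _ _ := by simp

variable {g : SmoothMetric n M}
    (hg : ∀ (c : M) (i j : Fin n), ContDiffOn ℝ ∞ (fun y => gram g c y i j) (chartTarget n c))

theorem contDiffOn_inChart {f : M → ℝ} (hf : ContMDiff 𝓘(ℝ, Model n) 𝓘(ℝ, ℝ) ∞ f) (c : M) :
    ContDiffOn ℝ ∞ (inChart f c) (chartTarget n c) := by
  rw [← contMDiffOn_iff_contDiffOn]
  exact hf.comp_contMDiffOn (contMDiffOn_param c)

include hg in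
/-- The coordinate Laplacians of two charts agree on the overlap: tested with a function supported
there, both give `-∫ ⟨∇η, ∇f⟩ dμ`, which does not depend on the chart. -/
theorem lap_transition {f : M → ℝ} (hf : ContMDiff 𝓘(ℝ, Model n) 𝓘(ℝ, ℝ) ∞ f) (c' c : M) :
    EqOn ((spaceCoeff g hg c').lap (inChart f c'))
      (fun y => (spaceCoeff g hg c).lap (inChart f c) (transition n c' c y)) (overlap n c' c) := by
  set Φ := transition n c' c with hΦ
  set O := overlap n c' c with hO
  have hOo : IsOpen O := isOpen_overlap c' c
  have hOm : MeasurableSet O := hOo.measurableSet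
  have hfc := contDiffOn_inChart hf c
  have hfc' := contDiffOn_inChart hf c'
  have cl' := ((spaceCoeff g hg c').continuousOn_lap hfc').mono
    (inter_subset_left : O ⊆ chartTarget n c')
  have cl : ContinuousOn (fun y => (spaceCoeff g hg c).lap (inChart f c) (Φ y)) O :=
    ((spaceCoeff g hg c).continuousOn_lap hfc).comp (contDiffOn_transition c' c).continuousOn
      fun y hy => (transition_mem hy).1
  have cv : ContinuousOn (volDensity g c') O :=
    (spaceCoeff g hg c').v_smooth.continuousOn.mono inter_subset_left
  have hder : ∀ y ∈ O, HasFDerivWithinAt Φ (jac n c' c y) O y := fun y hy =>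
    (differentiableAt_transition hy).hasFDerivAt.hasFDerivWithinAt
  -- change of variables on the overlap
  have cov : ∀ F : Model n → ℝ,
      ∫ z in overlap n c c', F z = ∫ y in O, |(jac n c' c y).det| * F (Φ y) := by
    intro F
    rw [← image_transition c' c]
    exact integral_image_eq_integral_abs_det_fderiv_smul volume hOm hder (injOn_transition c' c) F
  have key : ∀ η : Model n → ℝ, ContDiff ℝ ∞ η → HasCompactSupport η → tsupport η ⊆ O →
      ∫ y, η y • (((spaceCoeff g hg c').lap (inChart f c') y
        - (spaceCoeff g hg c).lap (inChart f c) (Φ y)) * volDensity g c' y) = 0 := by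
    intro η hη hηc hηO
    -- the test function on the manifold, read in the chart at `c` and extended by zero
    set ηM : M → ℝ := fun x => η (coord n c' x) with hηM
    set S : Set (Model n) := Φ '' tsupport η with hS
    have hSc : IsCompact S := hηc.isCompact.image_of_continuousOn
      ((contDiffOn_transition c' c).continuousOn.mono hηO)
    have hSO : S ⊆ overlap n c c' := by
      rw [← image_transition c' c]; exact image_mono hηO
    set ζ : Model n → ℝ := (overlap n c c').indicator (inChart ηM c) with hζ
    have hζO : ∀ z ∈ overlap n c c', ζ z = inChart ηM c z := fun z hz => indicator_of_mem hz _
    have hζev : ∀ z ∈ overlap n c c', ζ =ᶠ[𝓝 z] inChart ηM c := fun z hz => by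
      filter_upwards [(isOpen_overlap c c').mem_nhds hz] with w hw
      exact hζO w hw
    have hinη : ContDiffOn ℝ ∞ (inChart ηM c) (overlap n c c') :=
      hη.comp_contDiffOn (contDiffOn_transition c c')
    have hζ0 : ∀ z ∉ S, ζ z = 0 := by
      intro z hz
      by_cases hzO : z ∈ overlap n c c'
      · rw [hζO z hzO]
        change η (transition n c c' z) = 0
        by_contra h0
        exact hz ⟨_, subset_tsupport _ h0, transition_transition hzO⟩
      · exact indicator_of_notMem hzO _
    have hζs : ContDiff ℝ ∞ ζ := contDiff_of_contDiffOn_of_zero (isOpen_overlap c c')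
      (hinη.congr hζO) hSc.isClosed hSO hζ0
    have hζt : tsupport ζ ⊆ S := closure_minimal
      (fun z hz => by by_contra h; exact hz (hζ0 z h)) hSc.isClosed
    have hζc : HasCompactSupport ζ := HasCompactSupport.of_support_subset_isCompact hSc
      ((subset_tsupport _).trans hζt)
    obtain ⟨C1, hC1⟩ := (hη.of_le (by simp)).lipschitzWith_of_hasCompactSupport hηc one_ne_zero
    obtain ⟨C2, hC2⟩ := (hζs.of_le (by simp)).lipschitzWith_of_hasCompactSupport hζc one_ne_zero
    -- the weak formulas for the two Laplacians; `J1` and `J2` move the second one to the first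
    -- chart
    have I1 := (spaceCoeff g hg c').integral_mul_lap' (μ := volume) hC1 hηc
      (hηO.trans inter_subset_left) hfc'
    have I2 := (spaceCoeff g hg c).integral_mul_lap' (μ := volume) hC2 hζc
      ((hζt.trans hSO).trans inter_subset_left) hfc
    have hηΦ : ∀ y ∈ O, ζ (Φ y) = η y := by
      intro y hy
      rw [hζO _ (transition_mem hy)]
      change η (transition n c c' (transition n c' c y)) = η y
      rw [transition_transition hy]
    have J1 : ∫ z, ζ z * (spaceCoeff g hg c).lap (inChart f c) z * volDensity g c z
        = ∫ y in O, η y * (spaceCoeff g hg c).lap (inChart f c) (Φ y) * volDensity g c' y := by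
      rw [← setIntegral_eq_integral_of_forall_compl_eq_zero (s := overlap n c c'), cov]
      · refine setIntegral_congr_fun hOm fun y hy => ?_
        simp only [hηΦ y hy, volDensity_transition g hy]
        ring
      · intro z hz
        rw [hζ0 z fun h => hz (hSO h)]; ring
    have J2 : ∫ z, volDensity g c z * (spaceCoeff g hg c).pair z (fderiv ℝ ζ z)
          (fderiv ℝ (inChart f c) z)
        = ∫ y in O, volDensity g c' y * (spaceCoeff g hg c').pair y (fderiv ℝ η y)
          (fderiv ℝ (inChart f c') y) := by
      rw [← setIntegral_eq_integral_of_forall_compl_eq_zero (s := overlap n c c'), cov]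
      · refine setIntegral_congr_fun hOm fun y hy => ?_
        have hΦy := transition_mem hy
        have hd1 : DifferentiableAt ℝ (inChart ηM c) (Φ y) :=
          (hinη.contDiffAt ((isOpen_overlap c c').mem_nhds hΦy)).differentiableAt (by simp)
        have hd2 : DifferentiableAt ℝ (inChart f c) (Φ y) :=
          (hfc.contDiffAt ((isOpen_chartTarget c).mem_nhds hΦy.1)).differentiableAt (by simp)
        have hp := sum_inv_gram_transition g hy hd1 hd2
        have hηy : η =ᶠ[𝓝 y] inChart ηM c' := by
          filter_upwards [(isOpen_chartTarget c').mem_nhds hy.1] with w hw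
          exact congrArg η (coord_param hw).symm
        have e3 : fderiv ℝ ζ (Φ y) = fderiv ℝ (inChart ηM c) (Φ y) := (hζev _ hΦy).fderiv_eq
        simp only [e3, hηy.fderiv_eq, volDensity_transition g hy]
        rw [mul_assoc]
        congr 2
        exact hp.symm
      · intro z hz
        rw [HeatCoeff.fderiv_eq_zero_of_notMem fun h => hz (hSO (hζt h))]
        simp [HeatCoeff.pair]
    have J1' : ∫ y, η y * (spaceCoeff g hg c').lap (inChart f c') y * volDensity g c' y
        = ∫ y in O, η y * (spaceCoeff g hg c').lap (inChart f c') y * volDensity g c' y := by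
      rw [setIntegral_eq_integral_of_forall_compl_eq_zero]
      intro y hy
      rw [image_eq_zero_of_notMem_tsupport fun h => hy (hηO h)]; ring
    have J2' : ∫ y, volDensity g c' y * (spaceCoeff g hg c').pair y (fderiv ℝ η y)
          (fderiv ℝ (inChart f c') y)
        = ∫ y in O, volDensity g c' y * (spaceCoeff g hg c').pair y (fderiv ℝ η y)
          (fderiv ℝ (inChart f c') y) := by
      rw [setIntegral_eq_integral_of_forall_compl_eq_zero]
      intro y hy
      rw [HeatCoeff.fderiv_eq_zero_of_notMem fun h => hy (hηO h)]
      simp [HeatCoeff.pair]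
    have I3 : ∫ y in O, η y * (spaceCoeff g hg c').lap (inChart f c') y * volDensity g c' y
        = ∫ y in O, η y * (spaceCoeff g hg c).lap (inChart f c) (Φ y) * volDensity g c' y := by
      rw [← J1', ← J1]
      exact I1.trans ((congrArg Neg.neg (J2'.trans J2.symm)).trans I2.symm)
    have bc : ∀ {F : Model n → ℝ}, ContinuousOn F O →
        IntegrableOn (fun y => η y * F y * volDensity g c' y) O := by
      intro F hF
      refine Integrable.integrableOn (EssBdd.integrable_of_zero hηc.isCompact
        (EssBdd.of_continuousOn
        hηc.isCompact hηc.isCompact.measurableSet ?_) ?_)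
      · exact (hη.continuous.continuousOn.mul (hF.mono hηO)).mul (cv.mono hηO)
      · intro q hq
        rw [image_eq_zero_of_notMem_tsupport hq]; ring
    rw [← setIntegral_eq_integral_of_forall_compl_eq_zero (s := O)]
    · have : ∀ y, η y • (((spaceCoeff g hg c').lap (inChart f c') y
          - (spaceCoeff g hg c).lap (inChart f c) (Φ y)) * volDensity g c' y)
          = η y * (spaceCoeff g hg c').lap (inChart f c') y * volDensity g c' y
          - η y * (spaceCoeff g hg c).lap (inChart f c) (Φ y) * volDensity g c' y := by
        intro y; rw [smul_eq_mul]; ring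
      simp only [this]
      rw [integral_sub (bc cl') (bc cl), I3, sub_self]
    · intro y hy
      rw [image_eq_zero_of_notMem_tsupport fun h => hy (hηO h)]; simp
  -- the Laplacians agree almost everywhere on the overlap, hence everywhere by continuity
  have hae := hOo.ae_eq_zero_of_integral_contDiff_smul_eq_zero
    (((cl'.sub cl).mul cv).locallyIntegrableOn hOm) key
  refine Measure.eqOn_open_of_ae_eq (μ := volume) ?_ hOo cl' cl
  rw [Filter.EventuallyEq, ae_restrict_iff' hOm]
  filter_upwards [hae] with y hy hyO
  have h1 := (mul_eq_zero.1 (hy hyO)).resolve_right (volDensity_pos g hyO.1).ne'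
  exact sub_eq_zero.1 h1

theorem laplacian_eq {f : M → ℝ} (hf : ContMDiff 𝓘(ℝ, Model n) 𝓘(ℝ, ℝ) ∞ f) {c x : M}
    (hx : x ∈ chartSource n c) :
    laplacian g f x = (spaceCoeff g hg c).lap (inChart f c) (coord n c x) := by
  have h := lap_transition hg hf x c (coord_self_mem hx)
  simp only [transition_coord_self] at h
  exact h

end Invariance

/-! ### The evolving metric in space-time coordinates -/

section SpaceTime

variable {n : ℕ} {M : Type*} [TopologicalSpace M] [ChartedSpace (Model n) M]
  [IsManifold 𝓘(ℝ, Model n) ∞ M]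
  {a b : ℝ} {g : ℝ → SmoothMetric n M} {h : ℝ → BilinField n M}

theorem hasDerivWithinAt_gram (hflow : EvolvesBy g h a b) (c : M) (y : Model n) (i j : Fin n)
    {t : ℝ} (ht : t ∈ Icc a b) :
    HasDerivWithinAt (fun s => gram (g s) c y i j) (2 * components (h t) c y i j) (Icc a b) t :=
  hflow t ht _ _ _

theorem continuousOn_components (hab : a < b) (hg : IsSmoothFamily g a b)
    (hflow : EvolvesBy g h a b) (c : M) (i j : Fin n) :
    ContinuousOn (fun q : Model n × ℝ => components (h q.2) c q.1 i j)
      (chartTarget n c ×ˢ Icc a b) := by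
  have hF := contDiffOn_gram hg c i j
  have hU : UniqueDiffOn ℝ (chartTarget n c ×ˢ Icc a b) :=
    (isOpen_chartTarget c).uniqueDiffOn.prod (uniqueDiffOn_Icc hab)
  have hc : ContinuousOn (fun q => 2⁻¹ * fderivWithin ℝ (fun q : Model n × ℝ =>
      gram (g q.2) c q.1 i j) (chartTarget n c ×ˢ Icc a b) q ((0 : Model n), (1 : ℝ)))
      (chartTarget n c ×ˢ Icc a b) :=
    continuousOn_const.mul ((hF.continuousOn_fderivWithin hU (by simp)).clm_apply
      continuousOn_const)
  refine hc.congr fun q hq => ?_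
  have h1 : HasDerivWithinAt (fun s : ℝ => (q.1, s)) ((0 : Model n), (1 : ℝ)) (Icc a b) q.2 :=
    (hasDerivWithinAt_const _ _ _).prodMk (hasDerivWithinAt_id _ _)
  have h2 := ((hF.differentiableOn (by simp)) q hq).hasFDerivWithinAt
  have h3 := h2.comp_hasDerivWithinAt q.2 h1 fun s hs => mk_mem_prod hq.1 hs
  have h4 := (uniqueDiffOn_Icc hab q.2 hq.2).eq_deriv _ h3
    (hasDerivWithinAt_gram hflow c q.1 i j hq.2)
  beta_reduce
  linarith [h4]

/-- `tr_g h` in the chart centred at `c`. -/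
def trHChart (g : ℝ → SmoothMetric n M) (h : ℝ → BilinField n M) (c : M) (q : Model n × ℝ) : ℝ :=
  ∑ i, ∑ j, (gram (g q.2) c q.1)⁻¹ i j * components (h q.2) c q.1 i j

theorem contDiffOn_gramInv (hg : IsSmoothFamily g a b) (c : M) (i j : Fin n) :
    ContDiffOn ℝ ∞ (fun q : Model n × ℝ => (gram (g q.2) c q.1)⁻¹ i j)
      (chartTarget n c ×ˢ Icc a b) :=
  contDiffOn_inv_apply (contDiffOn_gram hg c) (fun _ hq => (gram_det_pos _ hq.1).ne') i j

theorem contDiffOn_volDensity (hg : IsSmoothFamily g a b) (c : M) :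
    ContDiffOn ℝ ∞ (fun q : Model n × ℝ => volDensity (g q.2) c q.1)
      (chartTarget n c ×ˢ Icc a b) :=
  (contDiffOn_det (contDiffOn_gram hg c)).sqrt fun _ hq => (gram_det_pos _ hq.1).ne'

theorem continuousOn_trHChart (hab : a < b) (hg : IsSmoothFamily g a b)
    (hflow : EvolvesBy g h a b) (c : M) :
    ContinuousOn (trHChart g h c) (chartTarget n c ×ˢ Icc a b) :=
  continuousOn_finsetSum _ fun i _ => continuousOn_finsetSum _ fun j _ =>
    (contDiffOn_gramInv hg c i j).continuousOn.mul (continuousOn_components hab hg hflow c i j)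

/-- The volume density evolves by `∂v/∂t = (tr_g h) v`. -/
theorem hasDerivAt_volDensity (hflow : EvolvesBy g h a b) {c : M} {y : Model n}
    (hy : y ∈ chartTarget n c) {t : ℝ} (ht : t ∈ Ioo a b) :
    HasDerivAt (fun s => volDensity (g s) c y)
      (trHChart g h c (y, t) * volDensity (g t) c y) t := by
  have h1 := hasDerivAt_det (A := fun s => gram (g s) c y)
    (A' := Matrix.of fun i j => 2 * components (h t) c y i j) (t := t) fun i j =>
      (hasDerivWithinAt_gram hflow c y i j (Ioo_subset_Icc_self ht)).hasDerivAt
        (Icc_mem_nhds ht.1 ht.2)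
  have hpos := gram_det_pos (g t) hy
  have h2 : HasDerivAt (fun s => volDensity (g s) c y) _ t := h1.sqrt hpos.ne'
  refine h2.congr_deriv ?_
  have h3 : ∀ i j, (gram (g t) c y).adjugate i j
      = (gram (g t) c y).det * (gram (g t) c y)⁻¹ i j := by
    intro i j
    rw [Matrix.inv_def, Matrix.smul_apply, Ring.inverse_eq_inv', smul_eq_mul,
      mul_inv_cancel_left₀ hpos.ne']
  have h4 : ∑ i, ∑ j, (gram (g t) c y).adjugate i j * (Matrix.of fun i j =>
      2 * components (h t) c y i j) j i = 2 * (gram (g t) c y).det * trHChart g h c (y, t) := by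
    rw [Finset.sum_comm, trHChart]
    simp only [Finset.mul_sum, h3, Matrix.of_apply]
    refine Finset.sum_congr rfl fun i _ => Finset.sum_congr rfl fun j _ => ?_
    rw [gram_inv_symm _ _ _ j i]; ring
  rw [h4, volDensity]
  have h5 : Real.sqrt (gram (g t) c y).det ≠ 0 := (Real.sqrt_pos.2 hpos).ne'
  have h6 := Real.mul_self_sqrt hpos.le
  rw [div_eq_iff (by positivity)]
  linear_combination (-2 * trHChart g h c (y, t)) * h6

/-- The coefficients of the heat equation of the evolving metric in the chart centred at `c`. -/
def stCoeff (hab : a < b) (hg : IsSmoothFamily g a b) (hflow : EvolvesBy g h a b) (c : M) :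
    HeatCoeff (Fin n) (Model n × ℝ) where
  D := chartTarget n c ×ˢ Ioo a b
  isOpen := (isOpen_chartTarget c).prod isOpen_Ioo
  e i := (stdVec i, 0)
  τ := (0, 1)
  v q := volDensity (g q.2) c q.1
  k := trHChart g h c
  G i j q := (gram (g q.2) c q.1)⁻¹ i j
  v_smooth := (contDiffOn_volDensity hg c).mono (prod_mono_right Ioo_subset_Icc_self)
  v_pos _ hq := volDensity_pos _ hq.1
  G_smooth i j := (contDiffOn_gramInv hg c i j).mono (prod_mono_right Ioo_subset_Icc_self)
  G_symm i j _ _ := gram_inv_symm _ c _ i j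
  k_cont := (continuousOn_trHChart hab hg hflow c).mono (prod_mono_right Ioo_subset_Icc_self)
  deriv_v q hq := by
    have hD : IsOpen (chartTarget n c ×ˢ Ioo a b) := (isOpen_chartTarget c).prod isOpen_Ioo
    have h1 : DifferentiableAt ℝ (fun q : Model n × ℝ => volDensity (g q.2) c q.1) q :=
      (((contDiffOn_volDensity hg c).mono (prod_mono_right Ioo_subset_Icc_self)).contDiffAt
        (hD.mem_nhds hq)).differentiableAt (by simp)
    have h2 : HasDerivAt (fun s : ℝ => (q.1, s)) ((0 : Model n), (1 : ℝ)) q.2 :=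
      (hasDerivAt_const _ _).prodMk (hasDerivAt_id _)
    have h3 := h1.hasFDerivAt.comp_hasDerivAt q.2 h2
    exact h3.unique (hasDerivAt_volDensity hflow hq.1 hq.2)

/-! ### Functions on space-time in coordinates -/

/-- The coordinate expression of a function on space-time in the chart of `M` centred at `c`. -/
def stChart (n : ℕ) {M : Type*} [TopologicalSpace M] [ChartedSpace (Model n) M] (f : M × ℝ → ℝ)
    (c : M) (q : Model n × ℝ) : ℝ := f (param n c q.1, q.2)

theorem partialDeriv_stChart {f : M × ℝ → ℝ} {c : M} {q : Model n × ℝ}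
    (hf : DifferentiableAt ℝ (stChart n f c) q) (i : Fin n) :
    partialDeriv i (inChart (fun x => f (x, q.2)) c) q.1
      = fderiv ℝ (stChart n f c) q (stdVec i, 0) := by
  have h2 : HasFDerivAt (fun y : Model n => (y, q.2)) (ContinuousLinearMap.inl ℝ (Model n) ℝ) q.1 :=
    hasFDerivAt_prodMk_left q.1 q.2
  have h3 := HasFDerivAt.comp q.1 (g := stChart n f c) (f := fun y : Model n => (y, q.2))
    hf.hasFDerivAt h2
  have h4 : inChart (fun x => f (x, q.2)) c = stChart n f c ∘ fun y => (y, q.2) := rfl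
  rw [partialDeriv, h4, h3.fderiv]
  simp

theorem differentiableAt_inChart_slice {f : M × ℝ → ℝ} {c : M} {q : Model n × ℝ}
    (hf : DifferentiableAt ℝ (stChart n f c) q) :
    DifferentiableAt ℝ (inChart (fun x => f (x, q.2)) c) q.1 :=
  (HasFDerivAt.comp q.1 (g := stChart n f c) (f := fun y : Model n => (y, q.2))
    hf.hasFDerivAt (hasFDerivAt_prodMk_left q.1 q.2)).differentiableAt

theorem timeDeriv_stChart {f : M × ℝ → ℝ} {c : M} {q : Model n × ℝ}
    (hf : DifferentiableAt ℝ (stChart n f c) q) :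
    timeDeriv f (param n c q.1, q.2) = fderiv ℝ (stChart n f c) q (0, 1) := by
  have h2 : HasDerivAt (fun s : ℝ => (q.1, s)) ((0 : Model n), (1 : ℝ)) q.2 :=
    (hasDerivAt_const _ _).prodMk (hasDerivAt_id _)
  exact (hf.hasFDerivAt.comp_hasDerivAt q.2 h2).deriv

theorem contDiffOn_stChart {f : M × ℝ → ℝ} {S : Set ℝ}
    (hf : ContMDiffOn (𝓘(ℝ, Model n).prod 𝓘(ℝ, ℝ)) 𝓘(ℝ, ℝ) ∞ f (univ ×ˢ S)) (c : M) :
    ContDiffOn ℝ ∞ (stChart n f c) (chartTarget n c ×ˢ S) := by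
  have h3 : ContMDiffOn (𝓘(ℝ, Model n).prod 𝓘(ℝ, ℝ)) (𝓘(ℝ, Model n).prod 𝓘(ℝ, ℝ)) ∞
      (fun q : Model n × ℝ => (param n c q.1, q.2)) (chartTarget n c ×ˢ S) :=
    ((contMDiffOn_param c).comp contMDiffOn_fst fun q hq => hq.1).prodMk contMDiffOn_snd
  rw [← contMDiffOn_iff_contDiffOn, modelWithCornersSelf_prod, ← chartedSpaceSelf_prod]
  have h4 := hf.comp h3 fun q hq => ⟨mem_univ _, hq.2⟩
  exact h4.congr fun q _ => rfl

variable (hab : a < b) (hg : IsSmoothFamily g a b) (hflow : EvolvesBy g h a b)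

theorem spaceGradNormSq_stChart {f : M × ℝ → ℝ} {c : M} {q : Model n × ℝ}
    (hq : q.1 ∈ chartTarget n c) (hf : DifferentiableAt ℝ (stChart n f c) q) :
    spaceGradNormSq g f (param n c q.1, q.2)
      = (stCoeff hab hg hflow c).pair q (fderiv ℝ (stChart n f c) q)
        (fderiv ℝ (stChart n f c) q) := by
  have h1 := gradNormSq_eq (g q.2) (f := fun x => f (x, q.2)) (param_mem hq)
    (by rw [coord_param hq]; exact differentiableAt_inChart_slice hf)
  rw [spaceGradNormSq, h1, coord_param hq]
  simp only [partialDeriv_stChart hf]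
  rfl

theorem trH_stChart {c : M} {q : Model n × ℝ} (hq : q.1 ∈ chartTarget n c) :
    trH g h (param n c q.1, q.2) = trHChart g h c q := by
  rw [trH, metricTrace_eq _ _ (param_mem hq), coord_param hq]
  rfl

include hg in
theorem contDiffOn_gram_slice {t : ℝ} (ht : t ∈ Icc a b) (c : M) (i j : Fin n) :
    ContDiffOn ℝ ∞ (fun y => gram (g t) c y i j) (chartTarget n c) :=
  (contDiffOn_gram hg c i j).comp (f := fun y : Model n => (y, t))
    (contDiff_id.prodMk contDiff_const).contDiffOn fun _ hy => ⟨hy, ht⟩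

theorem spaceLaplacian_stChart {f : M × ℝ → ℝ}
    (hf : ContMDiffOn (𝓘(ℝ, Model n).prod 𝓘(ℝ, ℝ)) 𝓘(ℝ, ℝ) ∞ f (univ ×ˢ Ioo a b)) {c : M}
    {q : Model n × ℝ} (hq : q ∈ chartTarget n c ×ˢ Ioo a b) :
    spaceLaplacian g f (param n c q.1, q.2) = (stCoeff hab hg hflow c).lap (stChart n f c) q := by
  obtain ⟨y, t⟩ := q
  have hy : y ∈ chartTarget n c := hq.1
  have ht : t ∈ Ioo a b := hq.2
  have hsl : ContMDiff 𝓘(ℝ, Model n) 𝓘(ℝ, ℝ) ∞ (fun x => f (x, t)) := by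
    have h1 : ContMDiff 𝓘(ℝ, Model n) (𝓘(ℝ, Model n).prod 𝓘(ℝ, ℝ)) ∞ (fun x : M => (x, t)) :=
      contMDiff_id.prodMk contMDiff_const
    rw [← contMDiffOn_univ]
    exact hf.comp h1.contMDiffOn fun x _ => ⟨mem_univ _, ht⟩
  have hgs := contDiffOn_gram_slice hg (Ioo_subset_Icc_self ht)
  have h2 := laplacian_eq hgs hsl (param_mem hy)
  rw [coord_param hy] at h2
  change laplacian (g t) (fun x => f (x, t)) (param n c y) = _
  rw [h2]
  have hfc := contDiffOn_stChart hf c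
  have hD := (stCoeff hab hg hflow c).isOpen
  -- spatial derivatives of the slice are derivatives in the spatial directions of space-time
  have hflux : ∀ i, (spaceCoeff (g t) hgs c).flux (inChart (fun x => f (x, t)) c) i
      =ᶠ[𝓝 y] (stCoeff hab hg hflow c).flux (stChart n f c) i ∘ fun z => (z, t) := by
    intro i
    filter_upwards [(isOpen_chartTarget c).mem_nhds hy] with z hz
    have hd : DifferentiableAt ℝ (stChart n f c) (z, t) :=
      (hfc.contDiffAt (hD.mem_nhds (mk_mem_prod hz ht))).differentiableAt (by simp)
    simp only [HeatCoeff.flux, Function.comp_apply]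
    congr 1
    refine Finset.sum_congr rfl fun j _ => ?_
    congr 1
    exact partialDeriv_stChart hd j
  simp only [HeatCoeff.lap]
  congr 1
  refine Finset.sum_congr rfl fun i _ => ?_
  have hd : DifferentiableAt ℝ ((stCoeff hab hg hflow c).flux (stChart n f c) i) (y, t) :=
    (((stCoeff hab hg hflow c).flux_smooth hfc i).contDiffAt (hD.mem_nhds hq)).differentiableAt
      (by simp)
  rw [(hflux i).fderiv_eq, (hd.hasFDerivAt.comp y (hasFDerivAt_prodMk_left y t)).fderiv]
  simp only [ContinuousLinearMap.comp_apply, ContinuousLinearMap.inl_apply]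
  rfl

end SpaceTime

/-! ### Measures given by a density in a chart -/

section PushDensity

variable {X Y : Type*} [TopologicalSpace X] [TopologicalSpace Y] [MeasurableSpace X] [BorelSpace X]
  [MeasurableSpace Y] [BorelSpace Y]

/-- The image under the parametrisation `P` of the measure with density `w` on `D`. -/
def pushDensity (μ : Measure Y) (D : Set Y) (w : Y → ℝ) (P : Y → X) : Measure X :=
  ((μ.restrict D).withDensity fun y => ENNReal.ofReal (w y)).map P

variable {μ : Measure Y} {D : Set Y} {w : Y → ℝ} {P : Y → X}

theorem measurableSet_preimage_inter (hD : MeasurableSet D) (hP : ContinuousOn P D) {S : Set X}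
    (hS : MeasurableSet S) : MeasurableSet (P ⁻¹' S ∩ D) := by
  have h1 : MeasurableSet (D.domRestrict P ⁻¹' S) :=
    (continuousOn_iff_continuous_domRestrict.1 hP).measurable hS
  have h2 := hD.subtype_image h1
  convert h2 using 1
  ext y
  simp only [mem_inter_iff, mem_preimage, mem_image, Subtype.exists, exists_and_right,
    exists_eq_right, domRestrict_apply]
  exact ⟨fun h => ⟨h.2, h.1⟩, fun ⟨h, h'⟩ => ⟨h', h⟩⟩

theorem aemeasurable_ofReal (hD : MeasurableSet D) (hw : ContinuousOn w D) :
    AEMeasurable (fun y => ENNReal.ofReal (w y)) (μ.restrict D) :=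
  (hw.aemeasurable hD).ennreal_ofReal

theorem aemeasurable_param (hD : MeasurableSet D) (hP : ContinuousOn P D) :
    AEMeasurable P ((μ.restrict D).withDensity fun y => ENNReal.ofReal (w y)) := by
  have h : AEMeasurable P (μ.restrict D) := by
    classical
    by_cases hX : Nonempty X
    · obtain ⟨x0⟩ := hX
      refine ⟨D.piecewise P fun _ => x0, ?_, ?_⟩
      · intro S hS
        have : (D.piecewise P fun _ => x0) ⁻¹' S
            = (P ⁻¹' S ∩ D) ∪ ((fun _ => x0) ⁻¹' S ∩ Dᶜ) := by
          ext y
          by_cases hy : y ∈ D <;> simp [hy]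
        rw [this]
        exact (measurableSet_preimage_inter hD hP hS).union
          ((measurable_const hS).inter hD.compl)
      · filter_upwards [ae_restrict_mem hD] with y hy
        simp [hy]
    · have : IsEmpty Y := ⟨fun y => hX ⟨P y⟩⟩
      exact (measurable_of_empty P).aemeasurable
  exact h.mono_ac (withDensity_absolutelyContinuous _ _)

theorem pushDensity_apply [SFinite μ] (hD : MeasurableSet D) (hP : ContinuousOn P D)
    {S : Set X} (hS : MeasurableSet S) :
    pushDensity μ D w P S = ∫⁻ y in P ⁻¹' S ∩ D, ENNReal.ofReal (w y) ∂μ := by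
  rw [pushDensity, Measure.map_apply_of_aemeasurable (aemeasurable_param hD hP) hS,
    withDensity_apply', Measure.restrict_restrict' hD]

theorem lintegral_pushDensity (hD : MeasurableSet D) (hP : ContinuousOn P D)
    (hw : ContinuousOn w D) {F : X → ℝ≥0∞} (hF : Measurable F) :
    ∫⁻ x, F x ∂(pushDensity μ D w P) = ∫⁻ y in D, ENNReal.ofReal (w y) * F (P y) ∂μ := by
  rw [pushDensity, lintegral_map' hF.aemeasurable (aemeasurable_param hD hP),
    lintegral_withDensity_eq_lintegral_mul₀' (aemeasurable_ofReal hD hw)]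
  · rfl
  · exact hF.comp_aemeasurable (aemeasurable_param hD hP)

theorem aestronglyMeasurable_pushDensity (hD : MeasurableSet D) (hP : ContinuousOn P D)
    {Q : X → Y} {U : Set X} (hU : MeasurableSet U) (hQ : ContinuousOn Q U)
    (hPU : ∀ y ∈ D, P y ∈ U) (hQP : ∀ y ∈ D, Q (P y) = y) (hPQ : ∀ x ∈ U, P (Q x) = x)
    {F : X → ℝ} (hF : AEStronglyMeasurable (fun y => F (P y)) (μ.restrict D)) :
    AEStronglyMeasurable F (pushDensity μ D w P) := by
  have hPm := aemeasurable_param (μ := μ) (w := w) hD hP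
  have hmem : ∀ᵐ y ∂((μ.restrict D).withDensity fun y => ENNReal.ofReal (w y)), y ∈ D :=
    (withDensity_absolutelyContinuous _ _).ae_le (ae_restrict_mem hD)
  have hUae : ∀ᵐ x ∂(pushDensity μ D w P), x ∈ U := by
    refine (ae_map_iff (p := fun x => x ∈ U) hPm hU).2 ?_
    filter_upwards [hmem] with y hy
    exact hPU y hy
  have hQm : AEMeasurable Q (pushDensity μ D w P) := by
    have h0 : AEMeasurable Q ((pushDensity μ D w P).withDensity fun y => ENNReal.ofReal 1) := by
      have h1 := aemeasurable_param (μ := pushDensity μ D w P) (w := fun _ => 1) hU hQ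
      rwa [Measure.restrict_eq_self_of_ae_mem hUae] at h1
    simpa using h0
  have hmap : (pushDensity μ D w P).map Q
      = (μ.restrict D).withDensity fun y => ENNReal.ofReal (w y) := by
    rw [pushDensity, AEMeasurable.map_map_of_aemeasurable (by exact hQm) hPm]
    have : Q ∘ P =ᵐ[(μ.restrict D).withDensity fun y => ENNReal.ofReal (w y)] id := by
      filter_upwards [hmem] with y hy
      exact hQP y hy
    rw [Measure.map_congr this, Measure.map_id]
  have h1 : AEStronglyMeasurable (fun y => F (P y)) ((pushDensity μ D w P).map Q) := by
    rw [hmap]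
    exact hF.mono_ac (withDensity_absolutelyContinuous _ _)
  refine (h1.comp_aemeasurable hQm).congr ?_
  filter_upwards [hUae] with x hx
  simp [hPQ x hx]

theorem integral_pushDensity (hD : MeasurableSet D) (hP : ContinuousOn P D)
    (hw : ContinuousOn w D) (hw0 : ∀ y ∈ D, 0 ≤ w y) {F : X → ℝ}
    (hF : AEStronglyMeasurable F (pushDensity μ D w P)) :
    ∫ x, F x ∂(pushDensity μ D w P) = ∫ y in D, F (P y) * w y ∂μ := by
  rw [pushDensity] at hF ⊢
  rw [integral_map (aemeasurable_param hD hP) hF,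
    integral_withDensity_eq_integral_toReal_smul₀ (aemeasurable_ofReal hD hw)
      (Eventually.of_forall fun _ => ENNReal.ofReal_lt_top)]
  refine setIntegral_congr_fun hD fun y hy => ?_
  simp only [ENNReal.toReal_ofReal (hw0 y hy), smul_eq_mul, mul_comm]

theorem integrable_pushDensity (hD : MeasurableSet D) (hP : ContinuousOn P D)
    (hw : ContinuousOn w D) (hw0 : ∀ y ∈ D, 0 ≤ w y) {F : X → ℝ}
    (hF : AEStronglyMeasurable F (pushDensity μ D w P)) :
    Integrable F (pushDensity μ D w P) ↔ IntegrableOn (fun y => F (P y) * w y) D μ := by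
  rw [pushDensity] at hF ⊢
  rw [integrable_map_measure hF (aemeasurable_param hD hP),
    integrable_withDensity_iff_integrable_smul₀' (aemeasurable_ofReal hD hw)
      (Eventually.of_forall fun _ => ENNReal.ofReal_lt_top)]
  refine integrable_congr ?_
  filter_upwards [ae_restrict_mem hD] with y hy
  simp only [ENNReal.toReal_ofReal (hw0 y hy), smul_eq_mul, Function.comp_apply, mul_comm]

/-- A supremum of measures that agree on overlaps restricts to each of them. -/
theorem iSup_measure_restrict {ι : Type*} (ν : ι → Measure X) (U : ι → Set X)
    (hU : ∀ i, MeasurableSet (U i)) (hsupp : ∀ i, ν i (U i)ᶜ = 0)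
    (hcompat : ∀ i j S, MeasurableSet S → S ⊆ U i ∩ U j → ν j S = ν i S) (i : ι) :
    (⨆ i, ν i).restrict (U i) = ν i := by
  -- every `ν j` is dominated by `ν i` on `U i` and by the supremum off `U i`
  have hle : (⨆ i, ν i) ≤ ν i + (⨆ i, ν i).restrict (U i)ᶜ := by
    refine iSup_le fun j => Measure.le_iff.2 fun S hS => ?_
    have e1 : ν j (S ∩ U i) ≤ ν i S := by
      have e2 : ν j (S ∩ U i) ≤ ν j (S ∩ (U i ∩ U j)) + ν j (U j)ᶜ := by
        refine (measure_mono ?_).trans (measure_union_le _ _)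
        intro x hx
        by_cases hxj : x ∈ U j
        · exact Or.inl ⟨hx.1, hx.2, hxj⟩
        · exact Or.inr hxj
      rw [hsupp, add_zero, hcompat i j _ (hS.inter ((hU i).inter (hU j))) inter_subset_right] at e2
      exact e2.trans (measure_mono inter_subset_left)
    rw [Measure.add_apply, Measure.restrict_apply hS, ← measure_inter_add_sdiff S (hU i)]
    exact add_le_add e1 (le_iSup ν j _)
  refine le_antisymm ?_ ?_
  · calc (⨆ i, ν i).restrict (U i) ≤ (ν i + (⨆ i, ν i).restrict (U i)ᶜ).restrict (U i) :=
          Measure.restrict_mono Subset.rfl hle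
      _ = (ν i).restrict (U i) := by
          rw [Measure.restrict_add, Measure.restrict_restrict (hU i), inter_compl_self,
            Measure.restrict_empty, add_zero]
      _ ≤ ν i := Measure.restrict_le_self
  · calc ν i = (ν i).restrict (U i) :=
          (Measure.restrict_eq_self_of_ae_mem (mem_ae_iff.2 (hsupp i))).symm
      _ ≤ _ := Measure.restrict_mono Subset.rfl (le_iSup ν i)

end PushDensity

/-! ### The volume and space-time measures in charts -/

section Measures

variable {n : ℕ} {M : Type*} [TopologicalSpace M] [T2Space M] [SecondCountableTopology M]
  [ChartedSpace (Model n) M] [IsManifold 𝓘(ℝ, Model n) ∞ M] [MeasurableSpace M] [BorelSpace M]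

/-- The chart at `c`, inverted, times the identity in time. -/
abbrev stParam (n : ℕ) {M : Type*} [TopologicalSpace M] [ChartedSpace (Model n) M] (c : M)
    (q : Model n × ℝ) : M × ℝ := (param n c q.1, q.2)

/-- The chart at `c` times the identity in time. -/
abbrev stCoord (n : ℕ) {M : Type*} [TopologicalSpace M] [ChartedSpace (Model n) M] (c : M)
    (p : M × ℝ) : Model n × ℝ := (coord n c p.1, p.2)

/-- The volume measure of `G` on the domain of the chart at `c`. -/
def chartVol (G : SmoothMetric n M) (c : M) : Measure M :=
  pushDensity volume (chartTarget n c) (volDensity G c) (param n c)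

/-- The space-time measure on the domain of the chart at `c`. -/
def chartSTVol (g : ℝ → SmoothMetric n M) (a b : ℝ) (c : M) : Measure (M × ℝ) :=
  pushDensity volume (chartTarget n c ×ˢ Ioo a b) (fun q => volDensity (g q.2) c q.1) (stParam n c)

theorem volumeMeasure_eq (G : SmoothMetric n M) : volumeMeasure G = ⨆ c : M, chartVol G c := rfl

theorem spacetimeMeasure_eq (g : ℝ → SmoothMetric n M) (a b : ℝ) :
    spacetimeMeasure g a b = ⨆ c : M, chartSTVol g a b c := rfl

theorem measurableSet_chartTarget (c : M) : MeasurableSet (chartTarget n c) :=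
  (isOpen_chartTarget c).measurableSet

theorem measurableSet_chartSource (c : M) : MeasurableSet (chartSource n c) :=
  (isOpen_chartSource c).measurableSet

theorem continuousOn_stParam (c : M) (S : Set ℝ) :
    ContinuousOn (stParam n c) (chartTarget n c ×ˢ S) :=
  ((continuousOn_param c).comp continuousOn_fst fun _ hq => hq.1).prodMk continuousOn_snd

theorem continuousOn_stCoord (c : M) (S : Set ℝ) :
    ContinuousOn (stCoord n c) (chartSource n c ×ˢ S) :=
  ((continuousOn_coord c).comp continuousOn_fst fun _ hq => hq.1).prodMk continuousOn_snd

theorem chartVol_compl (G : SmoothMetric n M) (c : M) : chartVol G c (chartSource n c)ᶜ = 0 := by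
  rw [chartVol, pushDensity_apply (measurableSet_chartTarget c) (continuousOn_param c)
    (measurableSet_chartSource c).compl]
  have : param n c ⁻¹' (chartSource n c)ᶜ ∩ chartTarget n c = ∅ := by
    ext y
    exact ⟨fun h => h.1 (param_mem h.2), fun h => h.elim⟩
  rw [this, Measure.restrict_empty, lintegral_zero_measure]

/-- On the overlap of two charts the two volume measures agree. -/
theorem chartVol_compat (G : SmoothMetric n M) (c c' : M) {S : Set M} (hS : MeasurableSet S)
    (hSU : S ⊆ chartSource n c ∩ chartSource n c') : chartVol G c' S = chartVol G c S := by
  rw [chartVol, chartVol, pushDensity_apply (measurableSet_chartTarget c')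
      (continuousOn_param c') hS,
    pushDensity_apply (measurableSet_chartTarget c) (continuousOn_param c) hS]
  have hsub : param n c' ⁻¹' S ∩ chartTarget n c' ⊆ overlap n c' c := fun y hy =>
    ⟨hy.2, (hSU hy.1).1⟩
  have himg : param n c ⁻¹' S ∩ chartTarget n c
      = transition n c' c '' (param n c' ⁻¹' S ∩ chartTarget n c') := by
    ext z
    constructor
    · intro hz
      have hz' : z ∈ overlap n c c' := ⟨hz.2, (hSU hz.1).2⟩
      refine ⟨transition n c c' z, ⟨?_, (transition_mem hz').1⟩, transition_transition hz'⟩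
      rw [mem_preimage, param_transition hz']
      exact hz.1
    · rintro ⟨y, hy, rfl⟩
      refine ⟨?_, (transition_mem (hsub hy)).1⟩
      rw [mem_preimage, param_transition (hsub hy)]
      exact hy.1
  have hm := measurableSet_preimage_inter (measurableSet_chartTarget (n := n) c')
    (continuousOn_param c') hS
  rw [himg, lintegral_image_eq_lintegral_abs_det_fderiv_mul volume hm
    (fun y hy => (differentiableAt_transition (hsub hy)).hasFDerivAt.hasFDerivWithinAt)
    ((injOn_transition (n := n) c' c).mono hsub)]
  refine setLIntegral_congr_fun hm fun y hy => ?_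
  rw [volDensity_transition G (hsub hy), ENNReal.ofReal_mul (abs_nonneg _)]
  rfl

/-- On a chart domain the volume measure has the density `√det g` in the coordinates. -/
theorem volumeMeasure_restrict (G : SmoothMetric n M) (c : M) :
    (volumeMeasure G).restrict (chartSource n c) = chartVol G c := by
  rw [volumeMeasure_eq]
  exact iSup_measure_restrict _ (fun c => chartSource n c) (fun c => measurableSet_chartSource c)
    (chartVol_compl G) (fun c c' S hS h => chartVol_compat G c c' hS h) c

variable {g : ℝ → SmoothMetric n M} {a b : ℝ}

theorem continuousOn_volDensity_slice (hg : IsSmoothFamily g a b) (c : M) {t : ℝ}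
    (ht : t ∈ Icc a b) : ContinuousOn (volDensity (g t) c) (chartTarget n c) :=
  (contDiffOn_volDensity hg c).continuousOn.comp (f := fun y : Model n => (y, t))
    (by fun_prop) fun _ hy => ⟨hy, ht⟩

theorem measurableSet_stTarget (c : M) : MeasurableSet (chartTarget n c ×ˢ Ioo a b) :=
  (measurableSet_chartTarget c).prod measurableSet_Ioo

theorem continuousOn_stDensity (hg : IsSmoothFamily g a b) (c : M) :
    ContinuousOn (fun q : Model n × ℝ => volDensity (g q.2) c q.1) (chartTarget n c ×ˢ Ioo a b) :=
  (contDiffOn_volDensity hg c).continuousOn.mono (prod_mono_right Ioo_subset_Icc_self)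

/-- Tonelli's theorem on a chart domain. -/
theorem lintegral_chartSTVol (hg : IsSmoothFamily g a b) (c : M) {F : M × ℝ → ℝ≥0∞}
    (hF : Measurable F) :
    AEMeasurable (fun t => ∫⁻ x, F (x, t) ∂(chartVol (g t) c)) (volume.restrict (Ioo a b)) ∧
    ∫⁻ p, F p ∂(chartSTVol g a b c) = ∫⁻ t in Ioo a b, ∫⁻ x, F (x, t) ∂(chartVol (g t) c) := by
  have hP := continuousOn_stParam (n := n) c (Ioo a b)
  have hD := measurableSet_stTarget (n := n) (a := a) (b := b) c
  have hae : AEMeasurable (fun q : Model n × ℝ =>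
      ENNReal.ofReal (volDensity (g q.2) c q.1) * F (stParam n c q))
      ((volume.restrict (chartTarget n c)).prod (volume.restrict (Ioo a b))) := by
    rw [Measure.prod_restrict, ← Measure.volume_eq_prod]
    exact (aemeasurable_ofReal hD (continuousOn_stDensity hg c)).mul
      (hF.comp_aemeasurable (hP.aemeasurable hD))
  have hslice : ∀ t ∈ Ioo a b, ∫⁻ y in chartTarget n c,
      ENNReal.ofReal (volDensity (g t) c y) * F (param n c y, t)
      = ∫⁻ x, F (x, t) ∂(chartVol (g t) c) := fun t ht =>
    (lintegral_pushDensity (measurableSet_chartTarget c) (continuousOn_param c)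
      (continuousOn_volDensity_slice hg c (Ioo_subset_Icc_self ht))
      (hF.comp measurable_prodMk_right)).symm
  constructor
  · refine AEMeasurable.congr hae.lintegral_prod_left' ?_
    filter_upwards [ae_restrict_mem measurableSet_Ioo] with t ht
    exact hslice t ht
  · rw [chartSTVol, lintegral_pushDensity hD hP (continuousOn_stDensity hg c) hF,
      Measure.volume_eq_prod, ← Measure.prod_restrict, lintegral_prod_symm _ hae]
    exact setLIntegral_congr_fun measurableSet_Ioo fun t ht => hslice t ht

theorem chartSTVol_apply (hg : IsSmoothFamily g a b) (c : M) {S : Set (M × ℝ)}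
    (hS : MeasurableSet S) :
    chartSTVol g a b c S = ∫⁻ t in Ioo a b, chartVol (g t) c {x | (x, t) ∈ S} := by
  rw [← lintegral_indicator_one hS, (lintegral_chartSTVol hg c (measurable_one.indicator hS)).2]
  refine lintegral_congr fun t => ?_
  exact (lintegral_indicator_one (measurable_prodMk_right hS) :)

/-- On a chart domain the space-time measure has the density `√det g` in the coordinates. -/
theorem spacetimeMeasure_restrict (hg : IsSmoothFamily g a b) (c : M) :
    (spacetimeMeasure g a b).restrict (chartSource n c ×ˢ univ) = chartSTVol g a b c := by
  rw [spacetimeMeasure_eq]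
  refine iSup_measure_restrict _ (fun c => chartSource n c ×ˢ univ)
    (fun c => (measurableSet_chartSource c).prod MeasurableSet.univ) (fun c => ?_)
    (fun c c' S hS h => ?_) c
  · rw [chartSTVol_apply hg c ((measurableSet_chartSource c).prod MeasurableSet.univ).compl]
    refine (lintegral_congr fun t => ?_).trans lintegral_zero
    rw [← chartVol_compl (g t) c]
    congr 1
    ext x
    simp
  · rw [chartSTVol_apply hg c hS, chartSTVol_apply hg c' hS]
    refine lintegral_congr fun t => ?_
    exact chartVol_compat (g t) c c' (measurable_prodMk_right hS) fun x hx =>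
      ⟨(h hx).1.1, (h hx).2.1⟩

variable (n M) in
theorem exists_countable_charts [Nonempty M] :
    ∃ c : ℕ → M, ⋃ k, chartSource n (c k) = (univ : Set M) := by
  obtain ⟨s, hs, hu⟩ := TopologicalSpace.countable_cover_nhds
    (fun x : M => (isOpen_chartSource (n := n) x).mem_nhds (mem_extChartAt_source x))
  have hne : s.Nonempty := by
    by_contra h
    rw [not_nonempty_iff_eq_empty] at h
    have hx := mem_univ (Classical.arbitrary M)
    rw [← hu, h] at hx
    simp at hx
  obtain ⟨c, rfl⟩ := hs.exists_eq_range hne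
  exact ⟨c, by rw [← hu, biUnion_range]⟩

/-- Tonelli's theorem for the space-time measure `dμ dt`. -/
theorem lintegral_spacetimeMeasure (hg : IsSmoothFamily g a b) {F : M × ℝ → ℝ≥0∞}
    (hF : Measurable F) :
    ∫⁻ p, F p ∂(spacetimeMeasure g a b)
      = ∫⁻ t in Ioo a b, ∫⁻ x, F (x, t) ∂(volumeMeasure (g t)) := by
  rcases isEmpty_or_nonempty M with hM | hM
  · simp [lintegral_of_isEmpty]
  obtain ⟨c, hc⟩ := exists_countable_charts n M
  set U : ℕ → Set M := fun k => chartSource n (c k) with hU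
  have hUm : ∀ k, MeasurableSet (U k) := fun k => measurableSet_chartSource _
  set D : ℕ → Set M := disjointed U with hDdef
  have hDm : ∀ k, MeasurableSet (D k) := fun k => MeasurableSet.disjointed hUm k
  have hDU : ∀ k, D k ⊆ U k := disjointed_subset U
  have hDd : Pairwise (Function.onFun Disjoint D) := disjoint_disjointed U
  have hDu : ⋃ k, D k = univ := by rw [hDdef, iUnion_disjointed, hc]
  have hFk : ∀ k, Measurable ((D k ×ˢ (univ : Set ℝ)).indicator F) := fun k =>
    hF.indicator ((hDm k).prod MeasurableSet.univ)
  have h1 : ∀ k, ∫⁻ p in D k ×ˢ univ, F p ∂(spacetimeMeasure g a b)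
      = ∫⁻ p, (D k ×ˢ (univ : Set ℝ)).indicator F p ∂(chartSTVol g a b (c k)) := fun k => by
    rw [lintegral_indicator ((hDm k).prod MeasurableSet.univ), ← spacetimeMeasure_restrict hg,
      Measure.restrict_restrict ((hDm k).prod MeasurableSet.univ), inter_eq_left.2
      (prod_mono_left (hDU k))]
  have h2 : ∀ k t, ∫⁻ x in D k, F (x, t) ∂(volumeMeasure (g t))
      = ∫⁻ x, (D k ×ˢ (univ : Set ℝ)).indicator F (x, t) ∂(chartVol (g t) (c k)) := fun k t => by
    have : (fun x => (D k ×ˢ (univ : Set ℝ)).indicator F (x, t))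
        = (D k).indicator fun x => F (x, t) := by
      funext x
      by_cases hx : x ∈ D k <;> simp [hx, indicator]
    rw [this, lintegral_indicator (hDm k), ← volumeMeasure_restrict,
      Measure.restrict_restrict (hDm k), inter_eq_left.2 (hDU k)]
  calc ∫⁻ p, F p ∂(spacetimeMeasure g a b)
      = ∫⁻ p in ⋃ k, D k ×ˢ univ, F p ∂(spacetimeMeasure g a b) := by
        rw [← iUnion_prod_const, hDu, univ_prod_univ, setLIntegral_univ]
    _ = ∑' k, ∫⁻ p in D k ×ˢ univ, F p ∂(spacetimeMeasure g a b) :=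
        lintegral_iUnion (fun k => (hDm k).prod MeasurableSet.univ)
          (fun i j hij => Disjoint.set_prod_left (hDd hij) _ _) _
    _ = ∑' k, ∫⁻ t in Ioo a b, ∫⁻ x, (D k ×ˢ (univ : Set ℝ)).indicator F (x, t)
          ∂(chartVol (g t) (c k)) := tsum_congr fun k => by
        rw [h1, (lintegral_chartSTVol hg (c k) (hFk k)).2]
    _ = ∫⁻ t in Ioo a b, ∑' k, ∫⁻ x, (D k ×ˢ (univ : Set ℝ)).indicator F (x, t)
          ∂(chartVol (g t) (c k)) :=
        (lintegral_tsum fun k => (lintegral_chartSTVol hg (c k) (hFk k)).1).symm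
    _ = ∫⁻ t in Ioo a b, ∫⁻ x, F (x, t) ∂(volumeMeasure (g t)) := by
        refine lintegral_congr fun t => ?_
        rw [← setLIntegral_univ (μ := volumeMeasure (g t)), ← hDu, lintegral_iUnion hDm hDd]
        exact tsum_congr fun k => (h2 k t).symm

theorem aestronglyMeasurable_of_charts (hg : IsSmoothFamily g a b) {F : M × ℝ → ℝ}
    (hF : ∀ c : M, AEStronglyMeasurable (stChart n F c)
      (volume.restrict (chartTarget n c ×ˢ Ioo a b))) :
    AEStronglyMeasurable F (spacetimeMeasure g a b) := by
  rcases isEmpty_or_nonempty M with hM | hM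
  · exact (measurable_of_empty F).aestronglyMeasurable
  obtain ⟨c, hc⟩ := exists_countable_charts n M
  have hu : ⋃ k, chartSource n (c k) ×ˢ (univ : Set ℝ) = univ := by
    rw [← iUnion_prod_const, hc, univ_prod_univ]
  rw [← Measure.restrict_univ (μ := spacetimeMeasure g a b), ← hu, aestronglyMeasurable_iUnion_iff]
  intro k
  rw [spacetimeMeasure_restrict hg]
  exact aestronglyMeasurable_pushDensity (Q := stCoord n (c k))
    (measurableSet_stTarget (c k)) (continuousOn_stParam _ _)
    ((measurableSet_chartSource (c k)).prod MeasurableSet.univ) (continuousOn_stCoord _ _)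
    (fun q hq => ⟨param_mem hq.1, mem_univ _⟩)
    (fun q hq => Prod.ext (coord_param hq.1) rfl) (fun p hp => Prod.ext (param_coord hp.1) rfl)
    (hF (c k))

theorem integral_spacetimeMeasure_chart (hg : IsSmoothFamily g a b) (c : M) {F : M × ℝ → ℝ}
    (hF : AEStronglyMeasurable F (spacetimeMeasure g a b))
    (h0 : ∀ p, p.1 ∉ chartSource n c → F p = 0) :
    ∫ p, F p ∂(spacetimeMeasure g a b)
      = ∫ q in chartTarget n c ×ˢ Ioo a b, stChart n F c q * volDensity (g q.2) c q.1 := by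
  rw [← setIntegral_eq_integral_of_forall_compl_eq_zero (s := chartSource n c ×ˢ univ)
    (fun p hp => h0 p fun h => hp ⟨h, mem_univ _⟩), spacetimeMeasure_restrict hg]
  have hF' : AEStronglyMeasurable F (chartSTVol g a b c) := by
    rw [← spacetimeMeasure_restrict hg]
    exact hF.restrict
  exact integral_pushDensity (measurableSet_stTarget c) (continuousOn_stParam _ _)
    (continuousOn_stDensity hg c) (fun q hq => (volDensity_pos _ hq.1).le) hF'

theorem integrable_spacetimeMeasure_chart (hg : IsSmoothFamily g a b) (c : M) {F : M × ℝ → ℝ}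
    (hF : AEStronglyMeasurable F (spacetimeMeasure g a b))
    (h0 : ∀ p, p.1 ∉ chartSource n c → F p = 0) :
    Integrable F (spacetimeMeasure g a b) ↔ IntegrableOn
      (fun q => stChart n F c q * volDensity (g q.2) c q.1) (chartTarget n c ×ˢ Ioo a b) := by
  rw [← integrableOn_iff_integrable_of_support_subset (s := chartSource n c ×ˢ (univ : Set ℝ))
    (fun p hp => ⟨by_contra fun h => hp (h0 p h), mem_univ _⟩), IntegrableOn,
    spacetimeMeasure_restrict hg]
  have hF' : AEStronglyMeasurable F (chartSTVol g a b c) := by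
    rw [← spacetimeMeasure_restrict hg]
    exact hF.restrict
  exact integrable_pushDensity (measurableSet_stTarget c) (continuousOn_stParam _ _)
    (continuousOn_stDensity hg c) (fun q hq => (volDensity_pos _ hq.1).le) hF'

theorem ae_mem_Ioo (hg : IsSmoothFamily g a b) :
    ∀ᵐ p ∂(spacetimeMeasure g a b), p.2 ∈ Ioo a b := by
  have hS : MeasurableSet {p : M × ℝ | p.2 ∈ Ioo a b}ᶜ := (measurable_snd measurableSet_Ioo).compl
  change spacetimeMeasure g a b {p : M × ℝ | p.2 ∈ Ioo a b}ᶜ = 0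
  rw [← lintegral_indicator_one hS, lintegral_spacetimeMeasure hg
    (measurable_one.indicator hS)]
  refine (setLIntegral_congr_fun measurableSet_Ioo fun t ht => ?_).trans lintegral_zero
  refine (lintegral_congr fun x => ?_).trans lintegral_zero
  exact indicator_of_notMem (not_not_intro ht) _

theorem aestronglyMeasurable_of_continuousOn (hg : IsSmoothFamily g a b) {F : M × ℝ → ℝ}
    (hF : ContinuousOn F (univ ×ˢ Ioo a b)) :
    AEStronglyMeasurable F (spacetimeMeasure g a b) :=
  aestronglyMeasurable_of_charts hg fun c =>
    (hF.comp (continuousOn_stParam c _) fun _ hq => ⟨mem_univ _, hq.2⟩).aestronglyMeasurable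
      (measurableSet_stTarget c)

theorem isLocallyFiniteMeasure_spacetimeMeasure (hg : IsSmoothFamily g a b) :
    IsLocallyFiniteMeasure (spacetimeMeasure g a b) := by
  refine ⟨fun p => ?_⟩
  set c := p.1 with hcdef
  have hy : coord n c c ∈ chartTarget n c := coord_mem (mem_extChartAt_source c)
  obtain ⟨r, hr, hsub⟩ := Metric.nhds_basis_closedBall.mem_iff.1
    ((isOpen_chartTarget c).mem_nhds hy)
  set V : Set M := chartSource n c ∩ coord n c ⁻¹' Metric.ball (coord n c c) r with hV
  have hVo : IsOpen V := (continuousOn_coord c).isOpen_inter_preimage (isOpen_chartSource c)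
    Metric.isOpen_ball
  have hVc : c ∈ V := ⟨mem_extChartAt_source c, Metric.mem_ball_self hr⟩
  have hVS : V ×ˢ (univ : Set ℝ) ⊆ chartSource n c ×ˢ univ := prod_mono_left inter_subset_left
  have hVm : MeasurableSet (V ×ˢ (univ : Set ℝ)) := hVo.measurableSet.prod MeasurableSet.univ
  refine ⟨V ×ˢ univ, prod_mem_nhds (hVo.mem_nhds hVc) univ_mem, ?_⟩
  rw [← inter_eq_left.2 hVS, ← Measure.restrict_apply hVm, spacetimeMeasure_restrict hg, chartSTVol,
    pushDensity_apply (measurableSet_stTarget c) (continuousOn_stParam _ _) hVm]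
  set C : Set (Model n × ℝ) := Metric.closedBall (coord n c c) r ×ˢ Icc a b with hC
  have hCc : IsCompact C := (isCompact_closedBall _ _).prod isCompact_Icc
  obtain ⟨B, hB⟩ := hCc.exists_bound_of_continuousOn
    ((contDiffOn_volDensity hg c).continuousOn.mono (prod_mono_left hsub))
  refine lt_of_le_of_lt (setLIntegral_mono_ae' (g := fun _ => ENNReal.ofReal B)
    (measurableSet_preimage_inter (measurableSet_stTarget c) (continuousOn_stParam _ _) hVm)
    (Eventually.of_forall fun q hq => ?_)) ?_
  · refine ENNReal.ofReal_le_ofReal ((le_abs_self _).trans (hB q ⟨?_, Ioo_subset_Icc_self hq.2.2⟩))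
    have h1 : coord n c (param n c q.1) ∈ Metric.ball (coord n c c) r := hq.1.1.2
    rw [coord_param hq.2.1] at h1
    exact Metric.ball_subset_closedBall h1
  · rw [setLIntegral_const]
    refine ENNReal.mul_lt_top ENNReal.ofReal_lt_top (lt_of_le_of_lt (measure_mono ?_)
      hCc.measure_lt_top)
    intro q hq
    have h1 : coord n c (param n c q.1) ∈ Metric.ball (coord n c c) r := hq.1.1.2
    rw [coord_param hq.2.1] at h1
    exact ⟨Metric.ball_subset_closedBall h1, Ioo_subset_Icc_self hq.2.2⟩

end Measures

/-! ### The local identity for locally Lipschitz functions -/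

section Local

variable {E : Type*} [NormedAddCommGroup E] [NormedSpace ℝ E]
  [FiniteDimensional ℝ E] [MeasurableSpace E] [BorelSpace E] {μ : Measure E}
  [μ.IsAddHaarMeasure]

/-- Rademacher's theorem for locally Lipschitz functions on a set. -/
theorem ae_differentiableAt_of_locallyLipschitz {D : Set E} {u : E → ℝ}
    (hu : ∀ x ∈ D, ∃ C : ℝ≥0, ∃ U ∈ 𝓝 x, LipschitzOnWith C u U) :
    ∀ᵐ x ∂μ, x ∈ D → DifferentiableAt ℝ u x := by
  have h0 : μ {x | x ∈ D ∧ ¬ DifferentiableAt ℝ u x} = 0 := by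
    refine measure_null_of_locally_null _ fun x hx => ?_
    obtain ⟨C, U, hU, hL⟩ := hu x hx.1
    obtain ⟨V, hVU, hV, hxV⟩ := mem_nhds_iff.1 hU
    refine ⟨V ∩ {x | x ∈ D ∧ ¬ DifferentiableAt ℝ u x},
      inter_mem (mem_nhdsWithin_of_mem_nhds (hV.mem_nhds hxV)) self_mem_nhdsWithin, ?_⟩
    have h1 := (hL.mono hVU).ae_differentiableWithinAt_of_mem (μ := μ)
    refine measure_mono_null (fun y hy => ?_) (ae_iff.1 h1)
    exact fun h => hy.2.2 ((h hy.1).differentiableAt (hV.mem_nhds hy.1))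
  rw [ae_iff]
  refine measure_mono_null (fun y hy => ?_) h0
  simpa using hy

variable {ι : Type*} [Fintype ι] (c : HeatCoeff ι E)

namespace HeatCoeff

/-- The local identity for a locally Lipschitz function `u`. The remaining weak form is
the integral of `(∂u/∂τ + Δu + k u) A(u) f / u` for smooth `u`, and nonnegative for subsolutions. -/
theorem integral_gap_local {R₁ R₀ : ℝ} (h : R₁ ≤ R₀) (h1 : 0 < R₁) {u f : E → ℝ}
    (hu : ∀ x ∈ c.D, ∃ C : ℝ≥0, ∃ U ∈ 𝓝 x, LipschitzOnWith C u U) (hpos : ∀ x ∈ c.D, 0 < u x)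
    (hf : ContDiff ℝ ∞ f) (hfc : HasCompactSupport f) (hfD : tsupport f ⊆ c.D) :
    Integrable (c.gap R₁ R₀ u f) μ ∧
    Integrable (fun q => levelB R₁ R₀ (u q) * (fderiv ℝ f q c.τ - c.lap f q) * c.v q) μ ∧
    (ContDiffOn ℝ ∞ u c.D → ∫ q, c.gap R₁ R₀ u f q ∂μ
        - ∫ q, levelB R₁ R₀ (u q) * (fderiv ℝ f q c.τ - c.lap f q) * c.v q ∂μ
        = ∫ q, (fderiv ℝ u q c.τ + c.lap u q + c.k q * u q) * testFun R₁ R₀ u f q * c.v q ∂μ) ∧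
    ((∀ q, 0 ≤ f q) → (∀ η : E → ℝ, ContDiff ℝ ∞ η → HasCompactSupport η → tsupport η ⊆ c.D →
      (∀ q, 0 ≤ η q) → 0 ≤ ∫ q, u q * (c.lap η q - fderiv ℝ η q c.τ) * c.v q ∂μ) →
      0 ≤ ∫ q, c.gap R₁ R₀ u f q ∂μ
        - ∫ q, levelB R₁ R₀ (u q) * (fderiv ℝ f q c.τ - c.lap f q) * c.v q ∂μ) := by
  have hK := hfc.isCompact
  have h0 : 0 < R₀ := h1.trans_le h
  -- near the support of `f` one may replace `u` by a globally Lipschitz function with positive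
  -- bounds
  obtain ⟨w, C, m, B, hw, hm, hmw, hwB, D', hD', hKD', hD'D, heq⟩ :=
    exists_lipschitzWith_eqOn c.isOpen hK hfD hu hpos
  set c' := c.restrict D' hD' hD'D with hc'
  have hev : ∀ q ∈ D', u =ᶠ[𝓝 q] w := fun q hq => by
    filter_upwards [hD'.mem_nhds hq] with z hz
    exact heq hz
  have hwpos : ∀ q, 0 < w q := fun q => hm.trans_le (hmw q)
  have e1 : c.gap R₁ R₀ u f = c'.gap R₁ R₀ w f := by
    funext q
    by_cases hq : q ∈ tsupport f
    · rw [gap, gap, (hev q (hKD' hq)).fderiv_eq, heq (hKD' hq)]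
      rfl
    · simp [gap, image_eq_zero_of_notMem_tsupport hq]
  have e2 : (fun q => levelB R₁ R₀ (u q) * (fderiv ℝ f q c.τ - c.lap f q) * c.v q)
      = fun q => levelB R₁ R₀ (w q) * (fderiv ℝ f q c'.τ - c'.lap f q) * c'.v q := by
    funext q
    by_cases hq : q ∈ tsupport f
    · rw [heq (hKD' hq)]
      rfl
    · rw [fderiv_eq_zero_of_notMem hq, c.lap_eq_zero hq, c'.lap_eq_zero hq]
      simp
  obtain ⟨Cf, hCf⟩ := (hf.of_le (by simp)).lipschitzWith_of_hasCompactSupport hfc one_ne_zero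
  obtain ⟨Z, hZ⟩ := hf.continuous.bounded_above_of_compact_support hfc
  obtain ⟨Cζ, hζ⟩ := exists_lipschitzWith_testFun h h1 hw hm hmw hCf hZ
  have hζs : tsupport (testFun R₁ R₀ w f) ⊆ tsupport f := tsupport_testFun _ _ _ _
  have hζc : HasCompactSupport (testFun R₁ R₀ w f) :=
    HasCompactSupport.of_support_subset_isCompact hK ((subset_tsupport _).trans hζs)
  have hid := c'.integral_gap (μ := μ) h h1 hw hm hmw hf hfc hKD'
  have bc : ∀ {F : E → ℝ}, ContinuousOn F c.D → EssBdd (μ.restrict (tsupport f)) F := fun h =>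
    c.essBdd_of_contOn hK hfD h
  have hcB : Continuous fun q => levelB R₁ R₀ (w q) :=
    continuous_iff_continuousAt.2 fun q =>
      (hasDerivAt_levelB h1 h0 (hwpos q)).continuousAt.comp hw.continuous.continuousAt
  have bB := bc hcB.continuousOn
  have bf := bc hf.continuous.continuousOn
  have bv := bc c.v_smooth.continuousOn
  have bk := bc c.k_cont
  have hf' : Continuous fun q => fderiv ℝ f q c.τ :=
    (hf.continuous_fderiv (by simp)).clm_apply continuous_const
  have hcA : Continuous fun q => levelA R₁ R₀ (w q) := by
    unfold levelA
    exact (continuous_const.min hw.continuous).sub (continuous_const.min hw.continuous)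
  have bstep : EssBdd (μ.restrict (tsupport f))
      (fun q => (if R₀ < w q then R₀ else 0) - (if R₁ < w q then R₁ else 0)) := by
    have hstep : ∀ R : ℝ, EssBdd (μ.restrict (tsupport f)) (fun q => if R < w q then R else 0) :=
      fun R => by
        refine ⟨(Measurable.ite (measurableSet_lt measurable_const hw.continuous.measurable)
          measurable_const measurable_const).aestronglyMeasurable, |R|, ?_⟩
        filter_upwards with q
        split_ifs <;> simp
    exact (hstep R₀).sub (hstep R₁)
  have i1 : Integrable (c'.gap R₁ R₀ w f) μ := by
    refine EssBdd.integrable_of_zero hK (((((bstep.mul ((c.essBdd_pair hK hfD hw hw).mul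
      (bc (F := fun q => (w q ^ 2)⁻¹) ?_))).add (((bc hcA.continuousOn).sub bB).mul bk)).mul
        bf).mul bv)) ?_
    · exact ((hw.continuous.pow 2).inv₀ fun q => (pow_pos (hwpos q) 2).ne').continuousOn
    · intro q hq
      rw [gap, image_eq_zero_of_notMem_tsupport hq, mul_zero, zero_mul]
  have i2 : Integrable (fun q => levelB R₁ R₀ (w q) * (fderiv ℝ f q c'.τ - c'.lap f q) * c'.v q)
      μ := by
    refine EssBdd.integrable_of_zero hK ((bB.mul ((bc hf'.continuousOn).sub
      (bc (c.continuousOn_lap hf.contDiffOn)))).mul bv) fun q hq => ?_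
    rw [fderiv_eq_zero_of_notMem hq, c'.lap_eq_zero hq]
    simp
  have hR : ∫ q, c.gap R₁ R₀ u f q ∂μ
        - ∫ q, levelB R₁ R₀ (u q) * (fderiv ℝ f q c.τ - c.lap f q) * c.v q ∂μ
      = ∫ q, c'.weak w (testFun R₁ R₀ w f) q ∂μ := by
    rw [e1, e2, hid]
    ring
  refine ⟨e1 ▸ i1, e2 ▸ i2, ?_, ?_⟩
  · intro hus
    have hws : ContDiffOn ℝ ∞ w c'.D := (hus.mono hD'D).congr fun q hq => (heq hq).symm
    rw [hR, c'.integral_weak_of_smooth hw hws hζ hζc (hζs.trans hKD')]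
    congr 1
    funext q
    by_cases hq : q ∈ tsupport f
    · have hq' := hKD' hq
      rw [testFun, testFun, (hev q hq').fderiv_eq, c.lap_congr (hev q hq'), heq hq']
      rfl
    · simp [testFun, image_eq_zero_of_notMem_tsupport hq]
  · intro hf0 hsub
    rw [hR]
    refine c'.integral_weak_nonneg hw hζ hζc (hζs.trans hKD')
      (fun q => testFun_nonneg h (hwpos q) (hf0 q)) fun η hη hηc hηD hη0 => ?_
    have := hsub η hη hηc (hηD.trans hD'D) hη0
    convert this using 2
    funext q
    by_cases hq : q ∈ tsupport η
    · rw [heq (hηD hq)]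
      rfl
    · rw [fderiv_eq_zero_of_notMem hq, c.lap_eq_zero hq, c'.lap_eq_zero hq]
      simp

theorem lap_sum {κ : Type*} (s : Finset κ) {f : κ → E → ℝ} {q : E} (hq : q ∈ c.D)
    (hf : ∀ k ∈ s, ContDiffOn ℝ ∞ (f k) c.D) :
    c.lap (fun z => ∑ k ∈ s, f k z) q = ∑ k ∈ s, c.lap (f k) q := by
  have hfl : ∀ i, c.flux (fun z => ∑ k ∈ s, f k z) i
      =ᶠ[𝓝 q] fun z => ∑ k ∈ s, c.flux (f k) i z := by
    intro i
    filter_upwards [c.isOpen.mem_nhds hq] with z hz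
    have : fderiv ℝ (fun z => ∑ k ∈ s, f k z) z = ∑ k ∈ s, fderiv ℝ (f k) z :=
      fderiv_fun_sum fun k hk =>
        ((hf k hk).contDiffAt (c.isOpen.mem_nhds hz)).differentiableAt (by simp)
    simp only [flux, this, sum_apply, Finset.mul_sum]
    exact Finset.sum_comm
  have hd : ∀ i, fderiv ℝ (c.flux (fun z => ∑ k ∈ s, f k z) i) q
      = ∑ k ∈ s, fderiv ℝ (c.flux (f k) i) q := by
    intro i
    rw [(hfl i).fderiv_eq]
    exact fderiv_fun_sum fun k hk =>
      ((c.flux_smooth (hf k hk) i).contDiffAt (c.isOpen.mem_nhds hq)).differentiableAt (by simp)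
  simp only [lap, hd, sum_apply]
  rw [← Finset.mul_sum, Finset.sum_comm]

end HeatCoeff

end Local

/-! ### Functions in charts -/

section Charts

variable {n : ℕ} {M : Type*} [TopologicalSpace M] [T2Space M] [SecondCountableTopology M]
  [ChartedSpace (Model n) M] [IsManifold 𝓘(ℝ, Model n) ∞ M] [MeasurableSpace M] [BorelSpace M]
  {g : ℝ → SmoothMetric n M} {h : ℝ → BilinField n M} {a b : ℝ}

theorem continuousOn_of_charts {F : M × ℝ → ℝ} {S : Set ℝ}
    (hF : ∀ c : M, ContinuousOn (stChart n F c) (chartTarget n c ×ˢ S)) :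
    ContinuousOn F (univ ×ˢ S) := by
  rintro ⟨x, t⟩ hp
  have hx : x ∈ chartSource n x := mem_extChartAt_source x
  have h1 : ContinuousOn (stChart n F x ∘ stCoord n x) (chartSource n x ×ˢ S) :=
    (hF x).comp (continuousOn_stCoord x S) fun p hp => ⟨coord_mem hp.1, hp.2⟩
  have h2 : ContinuousOn F (chartSource n x ×ˢ S) := h1.congr fun p hp => by
    change F p = F (param n x (coord n x p.1), p.2)
    rw [param_coord hp.1]
  refine (h2 (x, t) ⟨hx, hp.2⟩).mono_of_mem_nhdsWithin ?_
  have : chartSource n x ×ˢ (univ : Set ℝ) ∈ 𝓝 (x, t) :=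
    prod_mem_nhds ((isOpen_chartSource x).mem_nhds hx) univ_mem
  filter_upwards [mem_nhdsWithin_of_mem_nhds this, self_mem_nhdsWithin] with p h1 h2
  exact ⟨h1.1, h2.2⟩

/-- The Lipschitz hypothesis, which is made in the chart centred at each point, holds in every
chart, since the changes of charts are locally Lipschitz. -/
theorem locallyLipschitz_stChart {Ψ : M × ℝ → ℝ} (hΨ : AssumptionLipschitz n a b Ψ) (c : M)
    {q : Model n × ℝ} (hq : q ∈ chartTarget n c ×ˢ Ioo a b) :
    ∃ C : ℝ≥0, ∃ U ∈ 𝓝 q, LipschitzOnWith C (stChart n Ψ c) U := by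
  obtain ⟨y, t⟩ := q
  have hy : y ∈ chartTarget n c := hq.1
  have ht : t ∈ Ioo a b := hq.2
  obtain ⟨s, hts, hsb⟩ := exists_between ht.2
  set x := param n c y with hx
  have hyx : y ∈ overlap n c x := ⟨hy, mem_extChartAt_source x⟩
  obtain ⟨C, U, hU, hL⟩ := hΨ s ⟨ht.1.trans hts, hsb⟩ x t ⟨ht.1.le, hts.le⟩
  rw [nhdsWithin_eq_nhds.2 (prod_mem_nhds univ_mem (Icc_mem_nhds ht.1 hts))] at hU
  set Θ : Model n × ℝ → Model n × ℝ := fun q => (transition n c x q.1, q.2) with hΘ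
  have hΘd : ContDiffAt ℝ 1 Θ (y, t) := by
    have h1 : ContDiffAt ℝ 1 (transition n c x) y :=
      ((contDiffOn_transition c x).contDiffAt ((isOpen_overlap c x).mem_nhds hyx)).of_le (by simp)
    exact (h1.comp (y, t) contDiffAt_fst).prodMk contDiffAt_snd
  obtain ⟨C', V, hV, hL'⟩ := hΘd.exists_lipschitzOnWith
  have hΘU : Θ ⁻¹' U ∈ 𝓝 (y, t) := hΘd.continuousAt.preimage_mem_nhds hU
  have hO : overlap n c x ×ˢ (univ : Set ℝ) ∈ 𝓝 (y, t) :=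
    prod_mem_nhds ((isOpen_overlap c x).mem_nhds hyx) univ_mem
  refine ⟨C * C', V ∩ Θ ⁻¹' U ∩ overlap n c x ×ˢ univ, inter_mem (inter_mem hV hΘU) hO, ?_⟩
  have h3 := hL.comp (hL'.mono (inter_subset_left.trans inter_subset_left :
    V ∩ Θ ⁻¹' U ∩ overlap n c x ×ˢ univ ⊆ V)) fun q hq => hq.1.2
  intro p hp q hq
  have e : ∀ q ∈ overlap n c x ×ˢ (univ : Set ℝ), stChart n Ψ c q
      = ((fun q : Model n × ℝ => Ψ ((extChartAt 𝓘(ℝ, Model n) x).symm q.1, q.2)) ∘ Θ) q := by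
    intro q hq
    change Ψ (param n c q.1, q.2) = Ψ (param n x (transition n c x q.1), q.2)
    rw [param_transition hq.1]
  rw [e p hp.2, e q hq.2]
  exact h3 hp hq

theorem continuousOn_of_lipschitz {Ψ : M × ℝ → ℝ} (hΨ : AssumptionLipschitz n a b Ψ) :
    ContinuousOn Ψ (univ ×ˢ Ioo a b) :=
  continuousOn_of_charts fun c q hq => by
    obtain ⟨C, U, hU, hL⟩ := locallyLipschitz_stChart hΨ c hq
    exact (hL.continuousOn.continuousAt hU).continuousWithinAt

theorem hasFDerivAt_stChart_logFun {Ψ : M × ℝ → ℝ} {c : M} {q : Model n × ℝ}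
    (hpos : 0 < stChart n Ψ c q) (hd : DifferentiableAt ℝ (stChart n Ψ c) q) :
    HasFDerivAt (stChart n (logFun Ψ) c)
      ((stChart n Ψ c q)⁻¹ • fderiv ℝ (stChart n Ψ c) q) q :=
  hd.hasFDerivAt.log hpos.ne'

variable (hab : a < b) (hg : IsSmoothFamily g a b) (hflow : EvolvesBy g h a b)

theorem spaceGradNormSq_logFun {Ψ : M × ℝ → ℝ} {c : M} {q : Model n × ℝ}
    (hq : q.1 ∈ chartTarget n c) (hpos : 0 < stChart n Ψ c q)
    (hd : DifferentiableAt ℝ (stChart n Ψ c) q) :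
    spaceGradNormSq g (logFun Ψ) (stParam n c q) = (stCoeff hab hg hflow c).pair q
      (fderiv ℝ (stChart n Ψ c) q) (fderiv ℝ (stChart n Ψ c) q) / stChart n Ψ c q ^ 2 := by
  have h1 := hasFDerivAt_stChart_logFun hpos hd
  rw [stParam, spaceGradNormSq_stChart hab hg hflow hq h1.differentiableAt, h1.fderiv]
  simp only [HeatCoeff.pair, smul_apply, smul_eq_mul, Finset.sum_div]
  refine Finset.sum_congr rfl fun i _ => Finset.sum_congr rfl fun j _ => ?_
  field_simp

end Charts

/-! ### The local identity on the manifold -/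

section Global

variable {n : ℕ} {M : Type*} [TopologicalSpace M] [T2Space M] [SecondCountableTopology M]
  [ChartedSpace (Model n) M] [IsManifold 𝓘(ℝ, Model n) ∞ M] [MeasurableSpace M] [BorelSpace M]
  {g : ℝ → SmoothMetric n M} {h : ℝ → BilinField n M} {a b : ℝ}

theorem isOpen_stTarget (c : M) : IsOpen (chartTarget n c ×ˢ Ioo a b) :=
  (isOpen_chartTarget c).prod isOpen_Ioo

theorem stParam_stCoord {c : M} {p : M × ℝ} (hp : p.1 ∈ chartSource n c) :
    stParam n c (stCoord n c p) = p := Prod.ext (param_coord hp) rfl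

theorem stCoord_stParam {c : M} {q : Model n × ℝ} (hq : q.1 ∈ chartTarget n c) :
    stCoord n c (stParam n c q) = q := Prod.ext (coord_param hq) rfl

theorem laplacian_congr (G : SmoothMetric n M) {f f' : M → ℝ} {x : M} (hf : f =ᶠ[𝓝 x] f') :
    laplacian G f x = laplacian G f' x := by
  have hy : coord n x x ∈ chartTarget n x := coord_mem (mem_extChartAt_source x)
  have h1 : inChart f x =ᶠ[𝓝 (coord n x x)] inChart f' x := by
    have hc : ContinuousAt (param n x) (coord n x x) :=
      (continuousOn_param x).continuousAt ((isOpen_chartTarget x).mem_nhds hy)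
    have : Tendsto (param n x) (𝓝 (coord n x x)) (𝓝 x) := by
      have h2 := hc.tendsto
      rwa [param_coord (mem_extChartAt_source x)] at h2
    exact this.eventually hf
  have h2 : ∀ j, (fun z => partialDeriv j (inChart f x) z)
      =ᶠ[𝓝 (coord n x x)] fun z => partialDeriv j (inChart f' x) z := fun j => by
    filter_upwards [h1.eventuallyEq_nhds] with z hz
    rw [partialDeriv, partialDeriv, hz.fderiv_eq]
  have h3 : ∀ i, (fun z => volDensity G x z *
      ∑ j, (gram G x z)⁻¹ i j * partialDeriv j (inChart f x) z) =ᶠ[𝓝 (coord n x x)]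
      fun z => volDensity G x z *
        ∑ j, (gram G x z)⁻¹ i j * partialDeriv j (inChart f' x) z := fun i => by
    filter_upwards [eventually_all.2 h2] with z hz
    rw [Finset.sum_congr rfl fun j _ => by rw [hz j]]
  simp only [laplacian]
  congr 1
  refine Finset.sum_congr rfl fun i _ => ?_
  rw [partialDeriv, partialDeriv]
  rw [(h3 i).fderiv_eq]

theorem laplacian_const_mul (G : SmoothMetric n M) (k : ℝ) (f : M → ℝ) (x : M) :
    laplacian G (fun x => k * f x) x = k * laplacian G f x := by
  have h1 : ∀ (j : Fin n) z, partialDeriv j (inChart (fun x => k * f x) x) z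
      = k * partialDeriv j (inChart f x) z := fun j z => by
    have : inChart (n := n) (fun x => k * f x) x = k • inChart f x := rfl
    rw [partialDeriv, this, fderiv_const_smul_field]
    rfl
  have h2 : ∀ i : Fin n, (fun z => volDensity G x z *
      ∑ j, (gram G x z)⁻¹ i j * partialDeriv j (inChart (fun x => k * f x) x) z) =
      k • fun z => volDensity G x z *
        ∑ j, (gram G x z)⁻¹ i j * partialDeriv j (inChart f x) z := fun i => by
    funext z
    simp only [h1, Pi.smul_apply, smul_eq_mul, Finset.mul_sum]
    exact Finset.sum_congr rfl fun j _ => by ring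
  simp only [laplacian, h2]
  have h3 : ∀ (i : Fin n) (F : Model n → ℝ) z, partialDeriv i (k • F) z = k * partialDeriv i F z :=
    fun i F z => by rw [partialDeriv, fderiv_const_smul_field]; rfl
  simp only [h3, ← Finset.mul_sum]
  ring

theorem heatOp_congr {f f' : M × ℝ → ℝ} {p : M × ℝ} (hf : f =ᶠ[𝓝 p] f') :
    heatOp g f p = heatOp g f' p := by
  obtain ⟨x, t⟩ := p
  have h1 : (fun s => f (x, s)) =ᶠ[𝓝 t] fun s => f' (x, s) :=
    (Continuous.prodMk_right x).tendsto t |>.eventually hf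
  have h2 : (fun y => f (y, t)) =ᶠ[𝓝 x] fun y => f' (y, t) :=
    (Continuous.prodMk_left t).tendsto x |>.eventually hf
  rw [heatOp, heatOp, timeDeriv, timeDeriv, h1.deriv_eq, spaceLaplacian, spaceLaplacian,
    laplacian_congr _ h2]

theorem heatOp_eq_zero {f : M × ℝ → ℝ} {p : M × ℝ} (hp : p ∉ tsupport f) : heatOp g f p = 0 := by
  rw [heatOp_congr (f' := fun _ => 0) (notMem_tsupport_iff_eventuallyEq.1 hp)]
  have h0 : (fun _ : M => (0 : ℝ)) = fun x => 0 * (fun _ : M => (0 : ℝ)) x := by simp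
  rw [heatOp, timeDeriv, spaceLaplacian]
  simp only [deriv_const]
  rw [h0, laplacian_const_mul]
  simp

variable (hab : a < b) (hg : IsSmoothFamily g a b) (hflow : EvolvesBy g h a b)

include hab hg hflow in
theorem continuousOn_trH : ContinuousOn (trH g h) (univ ×ˢ Icc a b) :=
  continuousOn_of_charts fun c => (continuousOn_trHChart hab hg hflow c).congr fun _ hq =>
    trH_stChart hq.1

theorem heatOp_stChart {f : M × ℝ → ℝ}
    (hf : ContMDiffOn (𝓘(ℝ, Model n).prod 𝓘(ℝ, ℝ)) 𝓘(ℝ, ℝ) ∞ f (univ ×ˢ Ioo a b)) {c : M}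
    {q : Model n × ℝ} (hq : q ∈ chartTarget n c ×ˢ Ioo a b) :
    heatOp g f (stParam n c q) = fderiv ℝ (stChart n f c) q (0, 1)
      - (stCoeff hab hg hflow c).lap (stChart n f c) q := by
  rw [heatOp, spaceLaplacian_stChart hab hg hflow hf hq, timeDeriv_stChart]
  exact ((contDiffOn_stChart hf c).contDiffAt ((isOpen_stTarget c).mem_nhds hq)).differentiableAt
    (by simp)

include hab hg hflow in
theorem continuousOn_heatOp {f : M × ℝ → ℝ}
    (hf : ContMDiffOn (𝓘(ℝ, Model n).prod 𝓘(ℝ, ℝ)) 𝓘(ℝ, ℝ) ∞ f (univ ×ˢ Ioo a b)) :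
    ContinuousOn (heatOp g f) (univ ×ˢ Ioo a b) :=
  continuousOn_of_charts fun c => by
    have h1 := contDiffOn_stChart hf c
    have h2 := (stCoeff hab hg hflow c).continuousOn_lap h1
    have h3 := (h1.continuousOn_fderiv_of_isOpen (isOpen_stTarget c) (by simp)).clm_apply
      (continuousOn_const (c := ((0 : Model n), (1 : ℝ))))
    exact (h3.sub h2).congr fun q hq => heatOp_stChart hab hg hflow hf hq

include hab hg hflow in
theorem heatOp_sum {κ : Type*} (s : Finset κ) {f : κ → M × ℝ → ℝ}
    (hf : ∀ k ∈ s, ContMDiffOn (𝓘(ℝ, Model n).prod 𝓘(ℝ, ℝ)) 𝓘(ℝ, ℝ) ∞ (f k) (univ ×ˢ Ioo a b))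
    {p : M × ℝ} (hp : p.2 ∈ Ioo a b) :
    heatOp g (fun p => ∑ k ∈ s, f k p) p = ∑ k ∈ s, heatOp g (f k) p := by
  set c := p.1
  have hc : p.1 ∈ chartSource n c := mem_extChartAt_source c
  have hq : stCoord n c p ∈ chartTarget n c ×ˢ Ioo a b := ⟨coord_mem hc, hp⟩
  have hsum : ContMDiffOn (𝓘(ℝ, Model n).prod 𝓘(ℝ, ℝ)) 𝓘(ℝ, ℝ) ∞ (fun p => ∑ k ∈ s, f k p)
      (univ ×ˢ Ioo a b) := contMDiffOn_finsetSum hf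
  rw [← stParam_stCoord hc, heatOp_stChart hab hg hflow hsum hq,
    Finset.sum_congr rfl fun k hk => heatOp_stChart hab hg hflow (hf k hk) hq,
    Finset.sum_sub_distrib]
  have e : stChart n (fun p => ∑ k ∈ s, f k p) c = fun z => ∑ k ∈ s, stChart n (f k) c z := rfl
  rw [e, HeatCoeff.lap_sum _ _ hq fun k hk => contDiffOn_stChart (hf k hk) c,
    fderiv_fun_sum fun k hk => ((contDiffOn_stChart (hf k hk) c).contDiffAt
      ((isOpen_stTarget c).mem_nhds hq)).differentiableAt (by simp)]
  simp only [sum_apply]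

theorem integrable_of_continuousOn_of_zero (hg : IsSmoothFamily g a b) {F : M × ℝ → ℝ}
    {K : Set (M × ℝ)} (hK : IsCompact K) (hKS : K ⊆ univ ×ˢ Ioo a b)
    (hF : ContinuousOn F (univ ×ˢ Ioo a b)) (h0 : ∀ p ∉ K, F p = 0) :
    Integrable F (spacetimeMeasure g a b) := by
  have := isLocallyFiniteMeasure_spacetimeMeasure hg
  rw [← integrableOn_iff_integrable_of_support_subset (s := K)
    (fun p hp => by_contra fun h => hp (h0 p h))]
  exact (hF.mono hKS).integrableOn_compact hK

include hab hg hflow in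
theorem aestronglyMeasurable_spaceGradNormSq {Ψ : M × ℝ → ℝ}
    (hΨ : ∀ x : M, ∀ t ∈ Ico a b, 0 < Ψ (x, t)) (hΨ_lip : AssumptionLipschitz n a b Ψ) :
    AEStronglyMeasurable (spaceGradNormSq g (logFun Ψ)) (spacetimeMeasure g a b) := by
  refine aestronglyMeasurable_of_charts hg fun c => ?_
  have hD := measurableSet_stTarget (n := n) (a := a) (b := b) c
  set C := stCoeff hab hg hflow c with hC
  have hcont : ContinuousOn (stChart n Ψ c) (chartTarget n c ×ˢ Ioo a b) := fun q hq => by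
    obtain ⟨_, U, hU, hL⟩ := locallyLipschitz_stChart hΨ_lip c hq
    exact (hL.continuousOn.continuousAt hU).continuousWithinAt
  have h1 : AEStronglyMeasurable (fun q => C.pair q (fderiv ℝ (stChart n Ψ c) q)
      (fderiv ℝ (stChart n Ψ c) q) / stChart n Ψ c q ^ 2)
      (volume.restrict (chartTarget n c ×ˢ Ioo a b)) := by
    have hm : ∀ w : Model n × ℝ, AEStronglyMeasurable (fun q => fderiv ℝ (stChart n Ψ c) q w)
        (volume.restrict (chartTarget n c ×ˢ Ioo a b)) := fun w =>
      (measurable_fderiv_apply_const ℝ _ w).aestronglyMeasurable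
    have hs : AEStronglyMeasurable (stChart n Ψ c)
        (volume.restrict (chartTarget n c ×ˢ Ioo a b)) := hcont.aestronglyMeasurable hD
    refine (AEMeasurable.div ?_ (hs.aemeasurable.pow_const 2)).aestronglyMeasurable
    refine AEStronglyMeasurable.aemeasurable ?_
    unfold HeatCoeff.pair
    exact Finset.aestronglyMeasurable_fun_sum _ fun i _ =>
      Finset.aestronglyMeasurable_fun_sum _ fun j _ =>
      (((C.G_smooth i j).continuousOn.aestronglyMeasurable hD).mul (hm _)).mul (hm _)
  refine h1.congr ?_
  have : (volume : Measure (Model n × ℝ)).IsAddHaarMeasure := by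
    rw [Measure.volume_eq_prod]; infer_instance
  filter_upwards [ae_restrict_mem hD, ae_restrict_of_ae (ae_differentiableAt_of_locallyLipschitz
    (fun q hq => locallyLipschitz_stChart hΨ_lip c hq))] with q hq hd
  exact (spaceGradNormSq_logFun hab hg hflow hq.1 (hΨ _ _ (Ioo_subset_Ico_self hq.2)) (hd hq)).symm

/-- A function with compact support in the chart, carried over to the manifold. -/
def liftChart (n : ℕ) {M : Type*} [TopologicalSpace M] [ChartedSpace (Model n) M] (c : M)
    (η : Model n × ℝ → ℝ) (p : M × ℝ) : ℝ :=
  open Classical in if p.1 ∈ chartSource n c then η (stCoord n c p) else 0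

theorem stChart_liftChart {c : M} {η : Model n × ℝ → ℝ} {q : Model n × ℝ}
    (hq : q.1 ∈ chartTarget n c) : stChart n (liftChart n c η) c q = η q := by
  rw [stChart, liftChart, if_pos (param_mem hq)]
  exact congrArg η (stCoord_stParam hq)

theorem liftChart_smooth {c : M} {η : Model n × ℝ → ℝ} (hη : ContDiff ℝ ∞ η)
    (hηc : HasCompactSupport η) (hηD : tsupport η ⊆ chartTarget n c ×ˢ Ioo a b) :
    ContMDiff (𝓘(ℝ, Model n).prod 𝓘(ℝ, ℝ)) 𝓘(ℝ, ℝ) ∞ (liftChart n c η) ∧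
    HasCompactSupport (liftChart n c η) ∧
    tsupport (liftChart n c η) ⊆ chartSource n c ×ˢ Ioo a b := by
  have hK : IsCompact (stParam n c '' tsupport η) :=
    hηc.isCompact.image_of_continuousOn ((continuousOn_stParam c _).mono hηD)
  have hsupp : Function.support (liftChart n c η) ⊆ stParam n c '' tsupport η := by
    intro p hp
    rw [Function.mem_support, liftChart] at hp
    split_ifs at hp with hc
    · exact ⟨stCoord n c p, subset_tsupport _ hp, stParam_stCoord hc⟩
    · exact (hp rfl).elim
  have hts : tsupport (liftChart n c η) ⊆ stParam n c '' tsupport η :=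
    closure_minimal hsupp hK.isClosed
  have hsub : stParam n c '' tsupport η ⊆ chartSource n c ×ˢ Ioo a b := by
    rintro _ ⟨q, hq, rfl⟩
    exact ⟨param_mem (hηD hq).1, (hηD hq).2⟩
  refine ⟨contMDiff_of_tsupport fun p hp => ?_,
    HasCompactSupport.of_support_subset_isCompact hK hsupp, hts.trans hsub⟩
  have hpc := (hsub (hts hp)).1
  have hev : liftChart n c η =ᶠ[𝓝 p] fun p => η (stCoord n c p) := by
    filter_upwards [((isOpen_chartSource c).prod isOpen_univ).mem_nhds
      (⟨hpc, mem_univ _⟩ : p ∈ chartSource n c ×ˢ univ)] with z hz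
    rw [liftChart, if_pos hz.1]
  refine ContMDiffAt.congr_of_eventuallyEq ?_ hev
  have h1 : ContMDiffAt (𝓘(ℝ, Model n).prod 𝓘(ℝ, ℝ)) 𝓘(ℝ, Model n) ∞
      (fun p : M × ℝ => coord n c p.1) p :=
    ((contMDiffOn_coord c).contMDiffAt ((isOpen_chartSource c).mem_nhds hpc)).comp p contMDiffAt_fst
  have h2 : ContMDiffAt (𝓘(ℝ, Model n).prod 𝓘(ℝ, ℝ)) 𝓘(ℝ, Model n × ℝ) ∞ (stCoord n c) p :=
    h1.prodMk_space contMDiffAt_snd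
  exact hη.contMDiff.contMDiffAt.comp p h2

end Global

section Global

variable {n : ℕ} {M : Type*} [TopologicalSpace M] [T2Space M] [SecondCountableTopology M]
  [ChartedSpace (Model n) M] [IsManifold 𝓘(ℝ, Model n) ∞ M] [MeasurableSpace M] [BorelSpace M]
  {g : ℝ → SmoothMetric n M} {h : ℝ → BilinField n M} {a b : ℝ}

/-- The integrand of `R₀ P(r₀) - R₁ P(r₁)` without the factor `φ`, for `Rᵢ = rᵢ^{-n}`: the terms
`Rᵢ (ψ + n log rᵢ)₊` add up to `B - A` in the coefficient of `tr_g h`. -/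
def gapFun (g : ℝ → SmoothMetric n M) (h : ℝ → BilinField n M) (R₁ R₀ : ℝ) (Ψ : M × ℝ → ℝ)
    (p : M × ℝ) : ℝ :=
  ((if R₀ < Ψ p then R₀ else 0) - (if R₁ < Ψ p then R₁ else 0)) * spaceGradNormSq g (logFun Ψ) p
    + (levelA R₁ R₀ (Ψ p) - levelB R₁ R₀ (Ψ p)) * trH g h p

variable (hab : a < b) (hg : IsSmoothFamily g a b) (hflow : EvolvesBy g h a b)
  {Ψ : M × ℝ → ℝ} (hΨ : ∀ x : M, ∀ t ∈ Ico a b, 0 < Ψ (x, t))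
  (hΨ_lip : AssumptionLipschitz n a b Ψ) {R₁ R₀ : ℝ} (hR : R₁ ≤ R₀) (hR1 : 0 < R₁)

include hΨ hΨ_lip hR hR1 in
theorem continuousOn_levelB : ContinuousOn (fun p => levelB R₁ R₀ (Ψ p)) (univ ×ˢ Ioo a b) := by
  intro p hp
  exact ((hasDerivAt_levelB hR1 (hR1.trans_le hR)
    (hΨ p.1 p.2 (Ioo_subset_Ico_self hp.2))).continuousAt).comp_continuousWithinAt
      (continuousOn_of_lipschitz hΨ_lip p hp)

include hΨ_lip in
theorem continuousOn_levelA : ContinuousOn (fun p => levelA R₁ R₀ (Ψ p)) (univ ×ˢ Ioo a b) := by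
  have h1 : Continuous (levelA R₁ R₀) := by
    unfold levelA
    exact (continuous_const.min continuous_id).sub (continuous_const.min continuous_id)
  exact h1.comp_continuousOn (continuousOn_of_lipschitz hΨ_lip)

include hg hΨ_lip in
theorem aestronglyMeasurable_step (R k : ℝ) :
    AEStronglyMeasurable (fun p => if R < Ψ p then k else 0) (spacetimeMeasure g a b) := by
  have hm := (aestronglyMeasurable_of_continuousOn hg
    (continuousOn_of_lipschitz hΨ_lip)).aemeasurable
  have h1 : Measurable fun y : ℝ => if R < y then k else 0 :=
    Measurable.ite measurableSet_Ioi measurable_const measurable_const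
  exact (h1.comp_aemeasurable hm).aestronglyMeasurable

include hab hg hflow hΨ hΨ_lip hR hR1 in
theorem aestronglyMeasurable_gapFun :
    AEStronglyMeasurable (gapFun g h R₁ R₀ Ψ) (spacetimeMeasure g a b) :=
  (((aestronglyMeasurable_step hg hΨ_lip R₀ R₀).sub (aestronglyMeasurable_step hg hΨ_lip R₁ R₁)).mul
    (aestronglyMeasurable_spaceGradNormSq hab hg hflow hΨ hΨ_lip)).add
    (aestronglyMeasurable_of_continuousOn hg (((continuousOn_levelA hΨ_lip).sub
      (continuousOn_levelB hΨ hΨ_lip hR hR1)).mul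
      ((continuousOn_trH hab hg hflow).mono (prod_mono_right Ioo_subset_Icc_self))))

include hab hg hflow in
theorem conjHeatQuotient_stChart
    (hs : ContMDiffOn (𝓘(ℝ, Model n).prod 𝓘(ℝ, ℝ)) 𝓘(ℝ, ℝ) ∞ Ψ (univ ×ˢ Ioo a b)) {c : M}
    {q : Model n × ℝ} (hq : q ∈ chartTarget n c ×ˢ Ioo a b) :
    conjHeatQuotient g h Ψ (stParam n c q) = (fderiv ℝ (stChart n Ψ c) q (0, 1)
      + (stCoeff hab hg hflow c).lap (stChart n Ψ c) q + trHChart g h c q * stChart n Ψ c q)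
        / stChart n Ψ c q := by
  rw [conjHeatQuotient, spaceLaplacian_stChart hab hg hflow hs hq, timeDeriv_stChart,
    trH_stChart hq.1]
  · rfl
  · exact ((contDiffOn_stChart hs c).contDiffAt ((isOpen_stTarget c).mem_nhds hq)).differentiableAt
      (by simp)

include hab hg hflow hΨ in
theorem continuousOn_conjHeatQuotient
    (hs : ContMDiffOn (𝓘(ℝ, Model n).prod 𝓘(ℝ, ℝ)) 𝓘(ℝ, ℝ) ∞ Ψ (univ ×ˢ Ioo a b)) :
    ContinuousOn (conjHeatQuotient g h Ψ) (univ ×ˢ Ioo a b) :=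
  continuousOn_of_charts fun c => by
    have h1 := contDiffOn_stChart hs c
    have h2 := (stCoeff hab hg hflow c).continuousOn_lap h1
    have h3 := (h1.continuousOn_fderiv_of_isOpen (isOpen_stTarget c) (by simp)).clm_apply
      (continuousOn_const (c := ((0 : Model n), (1 : ℝ))))
    have h4 := (continuousOn_trHChart hab hg hflow c).mono (prod_mono_right Ioo_subset_Icc_self)
    exact (((h3.add h2).add (h4.mul h1.continuousOn)).div h1.continuousOn fun q hq =>
      (hΨ _ _ (Ioo_subset_Ico_self hq.2)).ne').congr fun q hq =>
        conjHeatQuotient_stChart hab hg hflow hs hq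

include hab hg hflow hΨ hΨ_lip hR hR1 in
/-- The local identity for test functions supported in one chart. -/
theorem integral_gapFun_chart (c : M) {η : M × ℝ → ℝ}
    (hη : ContMDiff (𝓘(ℝ, Model n).prod 𝓘(ℝ, ℝ)) 𝓘(ℝ, ℝ) ∞ η) (hηc : HasCompactSupport η)
    (hηD : tsupport η ⊆ chartSource n c ×ˢ Ioo a b) :
    Integrable (fun p => gapFun g h R₁ R₀ Ψ p * η p) (spacetimeMeasure g a b) ∧
    (ContMDiffOn (𝓘(ℝ, Model n).prod 𝓘(ℝ, ℝ)) 𝓘(ℝ, ℝ) ∞ Ψ (univ ×ˢ Ioo a b) →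
      ∫ p, gapFun g h R₁ R₀ Ψ p * η p ∂(spacetimeMeasure g a b)
        - ∫ p, levelB R₁ R₀ (Ψ p) * heatOp g η p ∂(spacetimeMeasure g a b)
        = ∫ p, levelA R₁ R₀ (Ψ p) * conjHeatQuotient g h Ψ p * η p ∂(spacetimeMeasure g a b)) ∧
    (IsDistribSubsolution g a b Ψ → (∀ p, 0 ≤ η p) →
      0 ≤ ∫ p, gapFun g h R₁ R₀ Ψ p * η p ∂(spacetimeMeasure g a b)
        - ∫ p, levelB R₁ R₀ (Ψ p) * heatOp g η p ∂(spacetimeMeasure g a b)) := by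
  set D : Set (Model n × ℝ) := chartTarget n c ×ˢ Ioo a b with hDdef
  have hDo : IsOpen D := isOpen_stTarget c
  set C := stCoeff hab hg hflow c with hC
  have : (volume : Measure (Model n × ℝ)).IsAddHaarMeasure := by
    rw [Measure.volume_eq_prod]; infer_instance
  set u := stChart n Ψ c with hudef
  have hu : ∀ q ∈ D, ∃ C : ℝ≥0, ∃ U ∈ 𝓝 q, LipschitzOnWith C u U := fun q hq =>
    locallyLipschitz_stChart hΨ_lip c hq
  have hpos : ∀ q ∈ D, 0 < u q := fun q hq => hΨ _ _ (Ioo_subset_Ico_self hq.2)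
  -- the test function in the chart, extended by zero
  set f : Model n × ℝ → ℝ := D.indicator (stChart n η c) with hfdef
  have hK : IsCompact (stCoord n c '' tsupport η) :=
    hηc.isCompact.image_of_continuousOn ((continuousOn_stCoord c _).mono hηD)
  have hKD : stCoord n c '' tsupport η ⊆ D := by
    rintro _ ⟨p, hp, rfl⟩
    exact ⟨coord_mem (hηD hp).1, (hηD hp).2⟩
  have hf0 : ∀ q ∉ stCoord n c '' tsupport η, f q = 0 := by
    intro q hq
    by_cases hqD : q ∈ D
    · rw [hfdef, indicator_of_mem hqD]
      exact image_eq_zero_of_notMem_tsupport (f := η) fun h' =>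
        hq ⟨stParam n c q, h', stCoord_stParam hqD.1⟩
    · exact indicator_of_notMem hqD _
  have hfη : ∀ q ∈ D, f =ᶠ[𝓝 q] stChart n η c := fun q hq => by
    filter_upwards [hDo.mem_nhds hq] with z hz
    exact indicator_of_mem hz _
  have hηs : ContDiffOn ℝ ∞ (stChart n η c) D := contDiffOn_stChart hη.contMDiffOn c
  have hf : ContDiff ℝ ∞ f := contDiff_of_contDiffOn_of_zero hDo
    (hηs.congr fun q hq => indicator_of_mem hq _) hK.isClosed hKD hf0
  have hfs : tsupport f ⊆ stCoord n c '' tsupport η :=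
    closure_minimal (fun q hq => by_contra fun h' => hq (hf0 q h')) hK.isClosed
  have hfc : HasCompactSupport f := HasCompactSupport.of_support_subset_isCompact hK
    ((subset_tsupport _).trans hfs)
  obtain ⟨i1, -, e1, e2⟩ := C.integral_gap_local (μ := volume) hR hR1 hu hpos hf hfc (hfs.trans hKD)
  -- the integrals over the manifold are those in the chart
  have hz : ∀ p : M × ℝ, p.1 ∉ chartSource n c → p ∉ tsupport η := fun p hp h' => hp (hηD h').1
  have m1 : AEStronglyMeasurable (fun p => gapFun g h R₁ R₀ Ψ p * η p) (spacetimeMeasure g a b) :=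
    (aestronglyMeasurable_gapFun hab hg hflow hΨ hΨ_lip hR hR1).mul
      (aestronglyMeasurable_of_continuousOn hg hη.continuous.continuousOn)
  have z1 : ∀ p : M × ℝ, p.1 ∉ chartSource n c → gapFun g h R₁ R₀ Ψ p * η p = 0 := fun p hp => by
    rw [image_eq_zero_of_notMem_tsupport (hz p hp), mul_zero]
  have m2 : AEStronglyMeasurable (fun p => levelB R₁ R₀ (Ψ p) * heatOp g η p)
      (spacetimeMeasure g a b) := aestronglyMeasurable_of_continuousOn hg
    ((continuousOn_levelB hΨ hΨ_lip hR hR1).mul (continuousOn_heatOp hab hg hflow hη.contMDiffOn))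
  have z2 : ∀ p : M × ℝ, p.1 ∉ chartSource n c → levelB R₁ R₀ (Ψ p) * heatOp g η p = 0 :=
    fun p hp => by rw [heatOp_eq_zero (hz p hp), mul_zero]
  have hae : ∀ᵐ q ∂(volume.restrict D), C.gap R₁ R₀ u f q
      = stChart n (fun p => gapFun g h R₁ R₀ Ψ p * η p) c q * volDensity (g q.2) c q.1 := by
    filter_upwards [ae_restrict_mem hDo.measurableSet, ae_restrict_of_ae
      (ae_differentiableAt_of_locallyLipschitz hu)] with q hq hd
    have h1 := spaceGradNormSq_logFun hab hg hflow hq.1 (hpos q hq) (hd hq)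
    have h2 : trH g h (param n c q.1, q.2) = _ := trH_stChart hq.1
    have h3 : f q = η (param n c q.1, q.2) := indicator_of_mem hq _
    rw [HeatCoeff.gap, stChart, gapFun, h1, h2, h3]
    rfl
  have hsupp : ∀ q ∉ D, C.gap R₁ R₀ u f q = 0 := fun q hq => by
    rw [HeatCoeff.gap, hfdef, indicator_of_notMem hq, mul_zero, zero_mul]
  have e3 : ∫ p, gapFun g h R₁ R₀ Ψ p * η p ∂(spacetimeMeasure g a b)
      = ∫ q, C.gap R₁ R₀ u f q := by
    rw [integral_spacetimeMeasure_chart hg c m1 z1,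
      ← setIntegral_eq_integral_of_forall_compl_eq_zero hsupp]
    exact (integral_congr_ae hae).symm
  have hheat : ∀ q ∈ D, heatOp g η (stParam n c q) = fderiv ℝ f q C.τ - C.lap f q := fun q hq => by
    rw [heatOp_stChart hab hg hflow hη.contMDiffOn hq, C.lap_congr (hfη q hq), (hfη q hq).fderiv_eq]
    rfl
  have e4 : ∫ p, levelB R₁ R₀ (Ψ p) * heatOp g η p ∂(spacetimeMeasure g a b)
      = ∫ q, levelB R₁ R₀ (u q) * (fderiv ℝ f q C.τ - C.lap f q) * C.v q := by
    rw [integral_spacetimeMeasure_chart hg c m2 z2]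
    refine Eq.trans ?_ (setIntegral_eq_integral_of_forall_compl_eq_zero (s := D) fun q hq => ?_)
    · refine setIntegral_congr_fun hDo.measurableSet fun q hq => ?_
      rw [← hheat q hq]
      rfl
    · have hq' : q ∉ tsupport f := fun h' => hq (hKD (hfs h'))
      rw [HeatCoeff.fderiv_eq_zero_of_notMem hq', C.lap_eq_zero hq']
      simp
  refine ⟨(integrable_spacetimeMeasure_chart hg c m1 z1).2 (i1.integrableOn.congr_fun_ae hae),
    ?_, ?_⟩
  · intro hs
    rw [e3, e4, e1 (contDiffOn_stChart hs c)]
    have m3 : AEStronglyMeasurable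
        (fun p => levelA R₁ R₀ (Ψ p) * conjHeatQuotient g h Ψ p * η p) (spacetimeMeasure g a b) :=
      aestronglyMeasurable_of_continuousOn hg (((continuousOn_levelA hΨ_lip).mul
        (continuousOn_conjHeatQuotient hab hg hflow hΨ hs)).mul hη.continuous.continuousOn)
    have z3 : ∀ p : M × ℝ, p.1 ∉ chartSource n c →
        levelA R₁ R₀ (Ψ p) * conjHeatQuotient g h Ψ p * η p = 0 := fun p hp => by
      rw [image_eq_zero_of_notMem_tsupport (hz p hp), mul_zero]
    rw [integral_spacetimeMeasure_chart hg c m3 z3]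
    refine Eq.trans (setIntegral_eq_integral_of_forall_compl_eq_zero (s := D)
      fun q hq => ?_).symm ?_
    · rw [testFun, hfdef, indicator_of_notMem hq, mul_zero, mul_zero, zero_mul]
    · refine setIntegral_congr_fun hDo.measurableSet fun q hq => ?_
      have h3 : f q = η (param n c q.1, q.2) := indicator_of_mem hq _
      have h4 := conjHeatQuotient_stChart hab hg hflow hs hq
      simp only [stChart, testFun, h3] at h4 ⊢
      rw [h4]
      change (fderiv ℝ u q (0, 1) + C.lap u q + trHChart g h c q * u q)
        * (levelA R₁ R₀ (u q) * (u q)⁻¹ * η (param n c q.1, q.2)) * volDensity (g q.2) c q.1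
        = levelA R₁ R₀ (u q) * ((fderiv ℝ u q (0, 1) + C.lap u q + trHChart g h c q * u q) / u q)
          * η (param n c q.1, q.2) * volDensity (g q.2) c q.1
      ring
  · intro hsub hη0
    rw [e3, e4]
    -- a test function in the chart is carried over to the manifold
    refine e2 (fun q => indicator_nonneg (fun q _ => hη0 _) q) fun θ hθ hθc hθD hθ0 => ?_
    obtain ⟨l1, l2, l3⟩ := liftChart_smooth hθ hθc hθD
    have hl := hsub (liftChart n c θ) l1 l2 (l3.trans (prod_mono_left (subset_univ _))) fun p => by
      rw [liftChart]
      split_ifs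
      · exact hθ0 _
      · exact le_rfl
    have hz' : ∀ p : M × ℝ, p.1 ∉ chartSource n c → p ∉ tsupport (liftChart n c θ) :=
      fun p hp h' => hp (l3 h').1
    have e5 : ∀ p, Ψ p * (spaceLaplacian g (liftChart n c θ) p - timeDeriv (liftChart n c θ) p)
        = -(Ψ p * heatOp g (liftChart n c θ) p) := fun p => by rw [heatOp]; ring
    have m4 : AEStronglyMeasurable (fun p => -(Ψ p * heatOp g (liftChart n c θ) p))
        (spacetimeMeasure g a b) := aestronglyMeasurable_of_continuousOn hg
      ((continuousOn_of_lipschitz hΨ_lip).mul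
        (continuousOn_heatOp hab hg hflow l1.contMDiffOn)).neg
    have z4 : ∀ p : M × ℝ, p.1 ∉ chartSource n c → -(Ψ p * heatOp g (liftChart n c θ) p) = 0 :=
      fun p hp => by rw [heatOp_eq_zero (hz' p hp), mul_zero, neg_zero]
    simp only [e5] at hl
    rw [integral_spacetimeMeasure_chart hg c m4 z4] at hl
    refine hl.trans_eq ?_
    refine Eq.trans ?_ (setIntegral_eq_integral_of_forall_compl_eq_zero (s := D) fun q hq => ?_)
    · refine setIntegral_congr_fun hDo.measurableSet fun q hq => ?_
      have hev : stChart n (liftChart n c θ) c =ᶠ[𝓝 q] θ := by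
        filter_upwards [hDo.mem_nhds hq] with z hz
        exact stChart_liftChart hz.1
      have h6 : heatOp g (liftChart n c θ) (param n c q.1, q.2) = _ :=
        heatOp_stChart hab hg hflow l1.contMDiffOn hq
      simp only [stChart]
      rw [h6, hev.fderiv_eq, HeatCoeff.lap_congr _ hev]
      change -(u q * (fderiv ℝ θ q (0, 1) - C.lap θ q)) * volDensity (g q.2) c q.1
        = u q * (C.lap θ q - fderiv ℝ θ q (0, 1)) * volDensity (g q.2) c q.1
      ring
    · have hq' : q ∉ tsupport θ := fun h' => hq (hθD h')
      rw [HeatCoeff.fderiv_eq_zero_of_notMem hq', C.lap_eq_zero hq']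
      simp

end Global

section Global

variable {n : ℕ} {M : Type*} [TopologicalSpace M] [T2Space M] [SecondCountableTopology M]
  [ChartedSpace (Model n) M] [IsManifold 𝓘(ℝ, Model n) ∞ M] [MeasurableSpace M] [BorelSpace M]
  {g : ℝ → SmoothMetric n M} {h : ℝ → BilinField n M} {a b : ℝ}

/-- A compactly supported smooth function on space-time is a finite sum of such functions, each
supported over one chart domain. -/
theorem exists_chart_decomposition {η : M × ℝ → ℝ}
    (hη : ContMDiff (𝓘(ℝ, Model n).prod 𝓘(ℝ, ℝ)) 𝓘(ℝ, ℝ) ∞ η) (hηc : HasCompactSupport η)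
    (hηD : tsupport η ⊆ univ ×ˢ Ioo a b) :
    ∃ (t : Finset M) (f : t → M × ℝ → ℝ), (∀ p, η p = ∑ k, f k p) ∧
      ∀ k, ContMDiff (𝓘(ℝ, Model n).prod 𝓘(ℝ, ℝ)) 𝓘(ℝ, ℝ) ∞ (f k) ∧ HasCompactSupport (f k) ∧
        tsupport (f k) ⊆ chartSource n (k : M) ×ˢ Ioo a b ∧
        ∀ p, 0 ≤ η p → 0 ≤ f k p := by
  have : LocallyCompactSpace M := Manifold.locallyCompact_of_finiteDimensional 𝓘(ℝ, Model n)
  have hK : IsCompact (Prod.fst '' tsupport η) := hηc.isCompact.image continuous_fst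
  obtain ⟨t, -, ht⟩ := hK.elim_nhds_subcover (fun x => chartSource n x)
    fun x _ => (isOpen_chartSource x).mem_nhds (mem_extChartAt_source x)
  obtain ⟨ρ, hρ⟩ := SmoothPartitionOfUnity.exists_isSubordinate 𝓘(ℝ, Model n) hK.isClosed
    (fun k : t => chartSource n (k : M)) (fun k => isOpen_chartSource _)
    (ht.trans (iUnion₂_subset fun x hx => subset_iUnion_of_subset (⟨x, hx⟩ : t) Subset.rfl))
  have hts : ∀ k, tsupport (fun p : M × ℝ => ρ k p.1 * η p) ⊆ tsupport η := fun k =>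
    closure_mono fun p hp => right_ne_zero_of_mul hp
  refine ⟨t, fun k p => ρ k p.1 * η p, fun p => ?_, fun k => ⟨?_, ?_, ?_, ?_⟩⟩
  · rw [← Finset.sum_mul]
    by_cases hp : p ∈ tsupport η
    · have h1 := ρ.sum_eq_one (mem_image_of_mem Prod.fst hp)
      rw [finsum_eq_sum_of_fintype] at h1
      rw [h1, one_mul]
    · rw [image_eq_zero_of_notMem_tsupport hp, mul_zero]
  · exact ((ρ k).contMDiff.comp contMDiff_fst).mul hη
  · exact HasCompactSupport.of_support_subset_isCompact hηc ((subset_tsupport _).trans (hts k))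
  · intro p hp
    refine ⟨hρ k ?_, (hηD (hts k hp)).2⟩
    have h1 : tsupport (fun p : M × ℝ => ρ k p.1 * η p) ⊆ Prod.fst ⁻¹' tsupport (ρ k) :=
      closure_minimal (fun q hq => subset_tsupport _ (left_ne_zero_of_mul hq))
        ((isClosed_tsupport _).preimage continuous_fst)
    exact h1 hp
  · exact fun p hp => mul_nonneg (ρ.nonneg k p.1) hp

variable (hab : a < b) (hg : IsSmoothFamily g a b) (hflow : EvolvesBy g h a b)
  {Ψ : M × ℝ → ℝ} (hΨ : ∀ x : M, ∀ t ∈ Ico a b, 0 < Ψ (x, t))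
  (hΨ_lip : AssumptionLipschitz n a b Ψ) {R₁ R₀ : ℝ} (hR : R₁ ≤ R₀) (hR1 : 0 < R₁)

include hab hg hflow hΨ hΨ_lip hR hR1 in
/-- The identity behind the monotonicity formula, for test functions with compact support in
`M × (a, b)`. -/
theorem integral_gapFun {η : M × ℝ → ℝ}
    (hη : ContMDiff (𝓘(ℝ, Model n).prod 𝓘(ℝ, ℝ)) 𝓘(ℝ, ℝ) ∞ η) (hηc : HasCompactSupport η)
    (hηD : tsupport η ⊆ univ ×ˢ Ioo a b) :
    (ContMDiffOn (𝓘(ℝ, Model n).prod 𝓘(ℝ, ℝ)) 𝓘(ℝ, ℝ) ∞ Ψ (univ ×ˢ Ioo a b) →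
      ∫ p, gapFun g h R₁ R₀ Ψ p * η p ∂(spacetimeMeasure g a b)
        - ∫ p, levelB R₁ R₀ (Ψ p) * heatOp g η p ∂(spacetimeMeasure g a b)
        = ∫ p, levelA R₁ R₀ (Ψ p) * conjHeatQuotient g h Ψ p * η p ∂(spacetimeMeasure g a b)) ∧
    (IsDistribSubsolution g a b Ψ → (∀ p, 0 ≤ η p) →
      0 ≤ ∫ p, gapFun g h R₁ R₀ Ψ p * η p ∂(spacetimeMeasure g a b)
        - ∫ p, levelB R₁ R₀ (Ψ p) * heatOp g η p ∂(spacetimeMeasure g a b)) := by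
  obtain ⟨t, f, hsum, hf⟩ := exists_chart_decomposition hη hηc hηD
  have hloc := fun k : t => integral_gapFun_chart hab hg hflow hΨ hΨ_lip hR hR1 (k : M) (hf k).1
    (hf k).2.1 (hf k).2.2.1
  have hS : ∀ k, tsupport (f k) ⊆ univ ×ˢ Ioo a b := fun k =>
    (hf k).2.2.1.trans (prod_mono_left (subset_univ _))
  have e1 : ∫ p, gapFun g h R₁ R₀ Ψ p * η p ∂(spacetimeMeasure g a b)
      = ∑ k, ∫ p, gapFun g h R₁ R₀ Ψ p * f k p ∂(spacetimeMeasure g a b) := by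
    simp only [hsum, Finset.mul_sum]
    exact integral_finsetSum _ fun k _ => (hloc k).1
  have e2 : ∫ p, levelB R₁ R₀ (Ψ p) * heatOp g η p ∂(spacetimeMeasure g a b)
      = ∑ k, ∫ p, levelB R₁ R₀ (Ψ p) * heatOp g (f k) p ∂(spacetimeMeasure g a b) := by
    rw [← integral_finsetSum]
    · refine integral_congr_ae ?_
      filter_upwards [ae_mem_Ioo hg] with p hp
      rw [show η = fun p => ∑ k, f k p from funext hsum, heatOp_sum hab hg hflow _
        (fun k _ => (hf k).1.contMDiffOn) hp, Finset.mul_sum]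
    · exact fun k _ => integrable_of_continuousOn_of_zero hg (hf k).2.1.isCompact (hS k)
        ((continuousOn_levelB hΨ hΨ_lip hR hR1).mul
          (continuousOn_heatOp hab hg hflow (hf k).1.contMDiffOn))
        fun p hp => by rw [heatOp_eq_zero hp, mul_zero]
  rw [e1, e2, ← Finset.sum_sub_distrib]
  constructor
  · intro hs
    rw [Finset.sum_congr rfl fun k _ => (hloc k).2.1 hs, ← integral_finsetSum]
    · simp only [hsum, Finset.mul_sum]
    · exact fun k _ => integrable_of_continuousOn_of_zero hg (hf k).2.1.isCompact (hS k)
        (((continuousOn_levelA hΨ_lip).mul (continuousOn_conjHeatQuotient hab hg hflow hΨ hs)).mul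
          (hf k).1.continuous.continuousOn)
        fun p hp => by rw [image_eq_zero_of_notMem_tsupport hp, mul_zero]
  · intro hsub hη0
    exact Finset.sum_nonneg fun k _ => (hloc k).2.2 hsub fun p => (hf k).2.2.2 p (hη0 p)

end Global

/-! ### Bounds for the second level function -/

/-- Bounds for `B` by the logarithm, through which the decay of the slice integrals of `|ψ|`
enters. -/
theorem levelB_nonneg_and_le {R₁ R₀ y : ℝ} (h : R₁ ≤ R₀) (h1 : 0 < R₁) (hy : 0 < y) :
    0 ≤ levelB R₁ R₀ y ∧ levelB R₁ R₀ y ≤ (R₀ - R₁) * max 0 (Real.log y - Real.log R₁) := by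
  have h0 : 0 < R₀ := h1.trans_le h
  -- `R x⁻¹ ≥ 1 + log (R x⁻¹)` in the two forms that are used
  have key : ∀ x, R₁ ≤ x → R₁ * (Real.log x - Real.log R₁) ≤ x - R₁ ∧
      x - R₁ ≤ x * (Real.log x - Real.log R₁) := fun x hx => by
    have hx0 : 0 < x := h1.trans_le hx
    have a1 := Real.log_le_sub_one_of_pos (div_pos hx0 h1)
    have a2 := Real.log_le_sub_one_of_pos (div_pos h1 hx0)
    rw [Real.log_div hx0.ne' h1.ne'] at a1
    rw [Real.log_div h1.ne' hx0.ne'] at a2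
    constructor
    · have := mul_le_mul_of_nonneg_left a1 h1.le
      have e : R₁ * (x / R₁ - 1) = x - R₁ := by field_simp
      linarith
    · have := mul_le_mul_of_nonneg_left a2 hx0.le
      have e : x * (R₁ / x - 1) = R₁ - x := by field_simp
      linarith
  rcases le_total y R₁ with c1 | c1
  · rw [levelB_eq_zero h hy c1]
    exact ⟨le_rfl, mul_nonneg (sub_nonneg.2 h) (le_max_left _ _)⟩
  have l1 : 0 ≤ Real.log y - Real.log R₁ := sub_nonneg.2 (Real.log_le_log h1 c1)
  rw [levelB, levelA, max_eq_right l1, min_eq_left c1]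
  obtain ⟨k1, k2⟩ := key y c1
  rcases le_total y R₀ with c0 | c0
  · rw [min_eq_right c0, max_eq_left (sub_nonpos.2 (Real.log_le_log hy c0))]
    have := mul_le_mul_of_nonneg_right c0 l1
    constructor <;> nlinarith
  · have l0 : 0 ≤ Real.log y - Real.log R₀ := sub_nonneg.2 (Real.log_le_log h0 c0)
    obtain ⟨k3, k4⟩ := key R₀ h
    rw [min_eq_left c0, max_eq_right l0]
    have := mul_nonneg (sub_nonneg.2 h) l0
    constructor <;> nlinarith

section Global

variable {n : ℕ} {M : Type*} [TopologicalSpace M] [T2Space M] [SecondCountableTopology M]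
  [ChartedSpace (Model n) M] [IsManifold 𝓘(ℝ, Model n) ∞ M] [MeasurableSpace M] [BorelSpace M]
  {g : ℝ → SmoothMetric n M} {h : ℝ → BilinField n M} {a b : ℝ}

/-! ### Boundedness up to the final time -/

/-- In a chart, `∂φ/∂t - Δφ` extends continuously to the final time. -/
theorem exists_continuousOn_heatOp (hab : a < b) (hg : IsSmoothFamily g a b)
    (hflow : EvolvesBy g h a b) {φ : M × ℝ → ℝ}
    (hφ : ContMDiffOn (𝓘(ℝ, Model n).prod 𝓘(ℝ, ℝ)) 𝓘(ℝ, ℝ) ∞ φ (univ ×ˢ Ioc a b)) (c : M) :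
    ∃ H : Model n × ℝ → ℝ, ContinuousOn H (chartTarget n c ×ˢ Ioc a b) ∧
      ∀ q ∈ chartTarget n c ×ˢ Ioo a b, heatOp g φ (stParam n c q) = H q := by
  set D := chartTarget n c ×ˢ Ioc a b with hD
  set C := stCoeff hab hg hflow c with hC
  have hDo : IsOpen (chartTarget n c ×ˢ Ioo a b) := isOpen_stTarget c
  have hsub : chartTarget n c ×ˢ Ioo a b ⊆ D := prod_mono_right Ioo_subset_Ioc_self
  have hU : UniqueDiffOn ℝ D := (isOpen_chartTarget c).uniqueDiffOn.prod (uniqueDiffOn_Ioc a b)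
  have hF : ContDiffOn ℝ ∞ (stChart n φ c) D := contDiffOn_stChart hφ c
  have hDI : D ⊆ chartTarget n c ×ˢ Icc a b := prod_mono_right Ioc_subset_Icc_self
  have hv : ContDiffOn ℝ ∞ C.v D := (contDiffOn_volDensity hg c).mono hDI
  have hG : ∀ i j, ContDiffOn ℝ ∞ (C.G i j) D := fun i j => (contDiffOn_gramInv hg c i j).mono hDI
  have hF' : ContDiffOn ℝ ∞ (fderivWithin ℝ (stChart n φ c) D) D := hF.fderivWithin hU (by simp)
  have hfl : ∀ i, ContDiffOn ℝ ∞ (fun z => C.v z * ∑ j, C.G i j z *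
      fderivWithin ℝ (stChart n φ c) D z (C.e j)) D := fun i =>
    hv.mul (ContDiffOn.sum fun j _ => (hG i j).mul (hF'.clm_apply contDiffOn_const))
  have heq : ∀ q ∈ chartTarget n c ×ˢ Ioo a b, ∀ {f : Model n × ℝ → ℝ},
      fderivWithin ℝ f D q = fderiv ℝ f q := fun q hq _ =>
    fderivWithin_of_mem_nhds (mem_of_superset (hDo.mem_nhds hq) hsub)
  -- the coordinate formula with derivatives within `D`, which are one-sided at the final time
  refine ⟨fun q => fderivWithin ℝ (stChart n φ c) D q C.τ - (C.v q)⁻¹ *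
    ∑ i, fderivWithin ℝ (fun z => C.v z * ∑ j, C.G i j z *
      fderivWithin ℝ (stChart n φ c) D z (C.e j)) D q (C.e i), ?_, fun q hq => ?_⟩
  · refine (hF'.continuousOn.clm_apply continuousOn_const).sub
      ((hv.continuousOn.inv₀ fun q hq => (volDensity_pos _ hq.1).ne').mul
        (continuousOn_finsetSum _ fun i _ => ?_))
    exact ((hfl i).continuousOn_fderivWithin hU (by simp)).clm_apply continuousOn_const
  · rw [heatOp_stChart hab hg hflow (hφ.mono (prod_mono_right Ioo_subset_Ioc_self)) hq]
    beta_reduce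
    rw [heq q hq]
    congr 1
    rw [HeatCoeff.lap]
    congr 1
    refine Finset.sum_congr rfl fun i _ => ?_
    rw [heq q hq]
    have : (fun z => C.v z * ∑ j, C.G i j z * fderivWithin ℝ (stChart n φ c) D z (C.e j))
        =ᶠ[𝓝 q] C.flux (stChart n φ c) i := by
      filter_upwards [hDo.mem_nhds hq] with z hz
      rw [HeatCoeff.flux, heq z hz]
    rw [this.fderiv_eq]

theorem exists_bound_heatOp (hab : a < b) (hg : IsSmoothFamily g a b)
    (hflow : EvolvesBy g h a b) {φ : M × ℝ → ℝ}
    (hφ : ContMDiffOn (𝓘(ℝ, Model n).prod 𝓘(ℝ, ℝ)) 𝓘(ℝ, ℝ) ∞ φ (univ ×ˢ Ioc a b))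
    {K : Set (M × ℝ)} (hK : IsCompact K) (hKs : K ⊆ univ ×ˢ Ioc a b) :
    ∃ B, 0 ≤ B ∧ ∀ p ∈ K, p.2 ∈ Ioo a b → |heatOp g φ p| ≤ B := by
  refine hK.induction_on (p := fun K => ∃ B, 0 ≤ B ∧ ∀ p ∈ K, p.2 ∈ Ioo a b → |heatOp g φ p| ≤ B)
    ⟨0, le_rfl, by simp⟩ ?_ ?_ ?_
  · rintro s t hst ⟨B, hB, h⟩
    exact ⟨B, hB, fun p hp => h p (hst hp)⟩
  · rintro s t ⟨B, hB, h⟩ ⟨B', hB', h'⟩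
    exact ⟨max B B', le_max_of_le_left hB, fun p hp hp2 => hp.elim
      (fun hp => (h p hp hp2).trans (le_max_left _ _))
      (fun hp => (h' p hp hp2).trans (le_max_right _ _))⟩
  · rintro ⟨x, t⟩ hp
    obtain ⟨H, hH, hHeq⟩ := exists_continuousOn_heatOp hab hg hflow hφ x
    have hx : x ∈ chartSource n x := mem_extChartAt_source x
    have hc : ContinuousOn (fun p => |H (stCoord n x p)|) (chartSource n x ×ˢ Ioc a b) :=
      (hH.comp (continuousOn_stCoord x _) fun p hp => ⟨coord_mem hp.1, hp.2⟩).abs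
    have h1 : ∀ᶠ p in 𝓝[chartSource n x ×ˢ Ioc a b] (x, t),
        |H (stCoord n x p)| < |H (stCoord n x (x, t))| + 1 :=
      (hc (x, t) ⟨hx, (hKs hp).2⟩).eventually (gt_mem_nhds (lt_add_one _))
    have h2 : chartSource n x ×ˢ (univ : Set ℝ) ∈ 𝓝[K] (x, t) := mem_nhdsWithin_of_mem_nhds
      (prod_mem_nhds ((isOpen_chartSource x).mem_nhds hx) univ_mem)
    rw [eventually_nhdsWithin_iff] at h1
    refine ⟨_, inter_mem h2 (mem_nhdsWithin_of_mem_nhds h1), |H (stCoord n x (x, t))| + 1,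
      by positivity, fun p hp hp2 => ?_⟩
    rw [← stParam_stCoord hp.1.1, hHeq _ ⟨coord_mem hp.1.1, hp2⟩]
    exact (hp.2 ⟨hp.1.1, Ioo_subset_Ioc_self hp2⟩).le

/-! ### Superlevel sets -/

/-- The part of the superlevel set `{Ψ > R}` in the open time interval. -/
def superlevel (a b : ℝ) (Ψ : M × ℝ → ℝ) (R : ℝ) : Set (M × ℝ) := {p | p.2 ∈ Ioo a b ∧ R < Ψ p}

variable (hab : a < b) (hg : IsSmoothFamily g a b) (hflow : EvolvesBy g h a b)
  {Ψ : M × ℝ → ℝ} (hΨ : ∀ x : M, ∀ t ∈ Ico a b, 0 < Ψ (x, t))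
  (hΨ_lip : AssumptionLipschitz n a b Ψ)

include hΨ_lip in
theorem isOpen_superlevel (R : ℝ) : IsOpen (superlevel a b Ψ R) := by
  have h1 := (continuousOn_of_lipschitz hΨ_lip).isOpen_inter_preimage
    (isOpen_univ.prod isOpen_Ioo) (isOpen_Ioi (a := R))
  convert h1 using 1
  ext p
  simp [superlevel]

include hg in
theorem heatball_ae_eq (r : ℝ) :
    heatball n a b Ψ r =ᵐ[spacetimeMeasure g a b] superlevel a b Ψ (r ^ n)⁻¹ := by
  filter_upwards [ae_mem_Ioo hg] with p hp
  exact propext ⟨fun h => ⟨hp, h.2⟩, fun h => ⟨Ioo_subset_Ico_self h.1, h.2⟩⟩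

theorem timeSlice_heatball {r t : ℝ} (ht : t ∈ Ioo a b) :
    timeSlice (heatball n a b Ψ r) t = timeSlice (superlevel a b Ψ (r ^ n)⁻¹) t := by
  ext x
  exact ⟨fun h => ⟨ht, h.2⟩, fun h => ⟨Ioo_subset_Ico_self ht, h.2⟩⟩

theorem setLIntegral_spacetimeMeasure (hg : IsSmoothFamily g a b) {E : Set (M × ℝ)} (hE : IsOpen E)
    (hES : E ⊆ univ ×ˢ Ioo a b) {J : Set ℝ} (hJ : MeasurableSet J) {F : M × ℝ → ℝ}
    (hF : ContinuousOn F (univ ×ˢ Ioo a b)) :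
    ∫⁻ p in E ∩ univ ×ˢ J, ENNReal.ofReal (F p) ∂(spacetimeMeasure g a b)
      = ∫⁻ t in Ioo a b, J.indicator (fun t => ∫⁻ x in timeSlice E t, ENNReal.ofReal (F (x, t))
        ∂(volumeMeasure (g t))) t := by
  have hS : MeasurableSet ((univ : Set M) ×ˢ Ioo a b) := MeasurableSet.univ.prod measurableSet_Ioo
  have hEJ : MeasurableSet (E ∩ univ ×ˢ J) := hE.measurableSet.inter (MeasurableSet.univ.prod hJ)
  classical
  have hm : Measurable (((univ : Set M) ×ˢ Ioo a b).piecewise F 0) :=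
    hF.measurable_piecewise continuousOn_const hS
  have e1 : ∫⁻ p in E ∩ univ ×ˢ J, ENNReal.ofReal (F p) ∂(spacetimeMeasure g a b)
      = ∫⁻ p, (E ∩ univ ×ˢ J).indicator
        (fun p => ENNReal.ofReal (((univ : Set M) ×ˢ Ioo a b).piecewise F 0 p)) p
          ∂(spacetimeMeasure g a b) := by
    rw [lintegral_indicator hEJ]
    refine setLIntegral_congr_fun hEJ fun p hp => ?_
    rw [piecewise_eq_of_mem _ _ _ (hES hp.1)]
  rw [e1, lintegral_spacetimeMeasure hg (hm.ennreal_ofReal.indicator hEJ)]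
  refine setLIntegral_congr_fun measurableSet_Ioo fun t ht => ?_
  have hEt : MeasurableSet (timeSlice E t) := measurable_prodMk_right hE.measurableSet
  by_cases htJ : t ∈ J
  · rw [indicator_of_mem htJ, ← lintegral_indicator hEt]
    refine lintegral_congr fun x => ?_
    by_cases hx : x ∈ timeSlice E t
    · have hx' : (x, t) ∈ E := hx
      have hm' : (x, t) ∈ E ∩ univ ×ˢ J := ⟨hx', ⟨mem_univ _, htJ⟩⟩
      rw [indicator_of_mem hx, indicator_of_mem hm', piecewise_eq_of_mem _ _ _ (hES hx')]
    · rw [indicator_of_notMem hx, indicator_of_notMem fun h' => hx h'.1]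
  · rw [indicator_of_notMem htJ]
    refine (lintegral_congr fun x => ?_).trans lintegral_zero
    exact indicator_of_notMem (fun h' => htJ h'.2.2) _

end Global

section Global

variable {n : ℕ} {M : Type*} [TopologicalSpace M] [T2Space M] [SecondCountableTopology M]
  [ChartedSpace (Model n) M] [IsManifold 𝓘(ℝ, Model n) ∞ M] [MeasurableSpace M] [BorelSpace M]
  {g : ℝ → SmoothMetric n M} {h : ℝ → BilinField n M} {a b : ℝ}

/-! ### Integrability on the heatball -/

theorem gradNormSq_nonneg (G : SmoothMetric n M) (f : M → ℝ) (x : M) : 0 ≤ gradNormSq G f x := by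
  have hy : coord n x x ∈ chartTarget n x := coord_mem (mem_extChartAt_source x)
  have h1 := (gram_posDef G hy).inv.posSemidef.dotProduct_mulVec_nonneg
    (fun i => partialDeriv i (inChart f x) (coord n x x))
  rw [star_trivial] at h1
  rw [gradNormSq]
  exact h1.trans_eq (sum_mul_mul_eq_dotProduct _ _ _).symm

variable (hab : a < b) (hg : IsSmoothFamily g a b) (hflow : EvolvesBy g h a b)
  {Ψ : M × ℝ → ℝ} (hΨ : ∀ x : M, ∀ t ∈ Ico a b, 0 < Ψ (x, t))
  (hΨ_lip : AssumptionLipschitz n a b Ψ)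
  {rbar : ℝ} (hrbar : 0 < rbar) (hΨ_rad : AssumptionRadius g a b Ψ rbar)
  {K : Set (M × ℝ)} (hK : IsCompact K) (hKs : K ⊆ univ ×ˢ Ioc a b)
  (hsmall : ∀ x : M, ∀ t ∈ Ico a b, (x, t) ∉ K → Ψ (x, t) ≤ (rbar ^ n)⁻¹)

include hΨ hΨ_lip in
theorem continuousOn_logFun : ContinuousOn (logFun Ψ) (univ ×ˢ Ioo a b) :=
  (continuousOn_of_lipschitz hΨ_lip).log fun p hp => (hΨ p.1 p.2 (Ioo_subset_Ico_self hp.2)).ne'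

include hsmall in
theorem superlevel_subset : superlevel a b Ψ (rbar ^ n)⁻¹ ⊆ K := fun p hp =>
  by_contra fun h => (hsmall p.1 p.2 (Ioo_subset_Ico_self hp.1) h).not_gt hp.2

theorem superlevel_subset_univ_prod (R : ℝ) : superlevel a b Ψ R ⊆ univ ×ˢ Ioo a b := fun _ hp =>
  ⟨mem_univ _, hp.1⟩

include hg hK in
theorem measure_compact_lt_top : spacetimeMeasure g a b K < ⊤ :=
  have := isLocallyFiniteMeasure_spacetimeMeasure hg
  hK.measure_lt_top

include hab hg hΨ hΨ_lip hΨ_rad hK hKs hsmall in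
/-- Near the final time the slice integrals of `|ψ|` are bounded, and up to an earlier time `ψ` is
bounded on the heatball, which lies in a compact set. -/
theorem integrableOn_logFun :
    IntegrableOn (logFun Ψ) (superlevel a b Ψ (rbar ^ n)⁻¹) (spacetimeMeasure g a b) := by
  set E := superlevel a b Ψ (rbar ^ n)⁻¹ with hE
  have hEo : IsOpen E := isOpen_superlevel hΨ_lip _
  have hc := continuousOn_logFun hΨ hΨ_lip
  refine ⟨(aestronglyMeasurable_of_continuousOn hg hc).restrict, ?_⟩
  rw [hasFiniteIntegral_iff_norm]
  simp only [Real.norm_eq_abs]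
  have h1 : ∀ᶠ s in 𝓝[<] b, ∫⁻ x in timeSlice E s, ENNReal.ofReal |logFun Ψ (x, s)|
      ∂(volumeMeasure (g s)) ≤ 1 := by
    filter_upwards [hΨ_rad.1.eventually (ge_mem_nhds zero_lt_one), Ioo_mem_nhdsLT hab] with s hs hs'
    rwa [timeSlice_heatball hs'] at hs
  obtain ⟨l, hl, hl1⟩ := (mem_nhdsLT_iff_exists_Ioo_subset' hab).1 h1
  have hsplit : E = E ∩ univ ×ˢ Ioi l ∪ E ∩ univ ×ˢ Iic l := by
    rw [← inter_union_distrib_left, ← prod_union, union_comm, Iic_union_Ioi, univ_prod_univ,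
      inter_univ]
  rw [hsplit]
  refine lt_of_le_of_lt (lintegral_union_le _ _ _) (ENNReal.add_lt_top.2 ⟨?_, ?_⟩)
  · rw [setLIntegral_spacetimeMeasure hg hEo (superlevel_subset_univ_prod _) measurableSet_Ioi
      hc.abs]
    refine lt_of_le_of_lt (setLIntegral_mono_ae' (g := fun _ => 1) measurableSet_Ioo
      (Eventually.of_forall fun t ht => ?_)) (by simp)
    by_cases htl : t ∈ Ioi l
    · rw [indicator_of_mem htl]
      exact hl1 ⟨htl, ht.2⟩
    · rw [indicator_of_notMem htl]
      exact zero_le_one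
  · have hK' : IsCompact (K ∩ univ ×ˢ Iic l) := hK.inter_right (isClosed_univ.prod isClosed_Iic)
    obtain ⟨B, hB⟩ := hK'.exists_bound_of_continuousOn (f := logFun Ψ)
      (hc.mono fun p hp => ⟨mem_univ _, (hKs hp.1).2.1, lt_of_le_of_lt hp.2.2 hl⟩)
    have hEK : E ∩ univ ×ˢ Iic l ⊆ K ∩ univ ×ˢ Iic l :=
      inter_subset_inter_left _ (superlevel_subset hsmall)
    refine lt_of_le_of_lt (setLIntegral_mono_ae' (g := fun _ => ENNReal.ofReal B)
      (hEo.measurableSet.inter (MeasurableSet.univ.prod measurableSet_Iic))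
      (Eventually.of_forall fun p hp => ENNReal.ofReal_le_ofReal (hB p (hEK hp)))) ?_
    rw [setLIntegral_const]
    exact ENNReal.mul_lt_top ENNReal.ofReal_lt_top (lt_of_le_of_lt
      (measure_mono (hEK.trans inter_subset_left)) (measure_compact_lt_top hg hK))

include hab hg hflow hΨ hΨ_lip hΨ_rad in
theorem integrableOn_spaceGradNormSq :
    IntegrableOn (spaceGradNormSq g (logFun Ψ)) (superlevel a b Ψ (rbar ^ n)⁻¹)
      (spacetimeMeasure g a b) := by
  refine ⟨(aestronglyMeasurable_spaceGradNormSq hab hg hflow hΨ hΨ_lip).restrict, ?_⟩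
  rw [hasFiniteIntegral_iff_norm, ← setLIntegral_congr (heatball_ae_eq hg rbar)]
  convert hΨ_rad.2.1 using 4 with p
  exact Real.norm_of_nonneg (gradNormSq_nonneg _ _ _)

/-- The function that dominates all integrands of the theorem on the heatball. -/
def domFun (g : ℝ → SmoothMetric n M) (Ψ : M × ℝ → ℝ) (p : M × ℝ) : ℝ :=
  spaceGradNormSq g (logFun Ψ) p + |logFun Ψ p| + 1

theorem domFun_bounds (p : M × ℝ) : 0 ≤ spaceGradNormSq g (logFun Ψ) p ∧
    spaceGradNormSq g (logFun Ψ) p ≤ domFun g Ψ p ∧ |logFun Ψ p| ≤ domFun g Ψ p ∧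
    1 ≤ domFun g Ψ p := by
  have h1 : 0 ≤ spaceGradNormSq g (logFun Ψ) p := gradNormSq_nonneg _ _ _
  have h2 := abs_nonneg (logFun Ψ p)
  unfold domFun
  exact ⟨h1, by linarith, by linarith, by linarith⟩

include hab hg hflow hΨ hΨ_lip hΨ_rad hK hKs hsmall in
theorem integrableOn_of_le_domFun {F : M × ℝ → ℝ} {B : ℝ}
    (hF : AEStronglyMeasurable F (spacetimeMeasure g a b))
    (hle : ∀ p ∈ superlevel a b Ψ (rbar ^ n)⁻¹, |F p| ≤ B * domFun g Ψ p) :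
    IntegrableOn F (superlevel a b Ψ (rbar ^ n)⁻¹) (spacetimeMeasure g a b) := by
  have h1 : IntegrableOn (fun _ => (1 : ℝ)) (superlevel a b Ψ (rbar ^ n)⁻¹)
      (spacetimeMeasure g a b) := integrableOn_const
    (lt_of_le_of_lt (measure_mono (superlevel_subset hsmall)) (measure_compact_lt_top hg hK)).ne
  have h2 : IntegrableOn (fun p => B * domFun g Ψ p) (superlevel a b Ψ (rbar ^ n)⁻¹)
      (spacetimeMeasure g a b) :=
    (((integrableOn_spaceGradNormSq hab hg hflow hΨ hΨ_lip hΨ_rad).add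
      (integrableOn_logFun hab hg hΨ hΨ_lip hΨ_rad hK hKs hsmall).abs).add h1).const_mul B
  refine h2.mono' hF.restrict ?_
  filter_upwards [ae_restrict_mem (isOpen_superlevel hΨ_lip _).measurableSet] with p hp
  exact hle p hp

include hab hΨ hrbar hΨ_rad in
/-- The slice integrals of `B(Ψ)` tend to zero at the final time. -/
theorem tendsto_slice_levelB {R₁ R₀ : ℝ} (hR : R₁ ≤ R₀) (hR1 : (rbar ^ n)⁻¹ ≤ R₁) :
    Tendsto (fun t => ∫⁻ x in timeSlice (superlevel a b Ψ (rbar ^ n)⁻¹) t,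
      ENNReal.ofReal (levelB R₁ R₀ (Ψ (x, t))) ∂(volumeMeasure (g t))) (𝓝[<] b) (𝓝 0) := by
  have hR0 : 0 < R₁ := (inv_pos.2 (pow_pos hrbar n)).trans_le hR1
  have hvol := hΨ_rad.2.2
  have hnn : 0 ≤ R₀ - R₁ := sub_nonneg.2 hR
  -- for `rbar ≤ 1` one has `log R₁ ≥ 0`, and the volume of the slices does not enter
  set β : ℝ := if rbar ≤ 1 then 0 else |Real.log R₁| with hβ
  have hβ0 : 0 ≤ β := by rw [hβ]; split_ifs; exacts [le_rfl, abs_nonneg _]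
  have hbd : ∀ y, 0 < y → levelB R₁ R₀ y ≤ (R₀ - R₁) * |Real.log y| + (R₀ - R₁) * β := by
    intro y hy
    refine (levelB_nonneg_and_le hR hR0 hy).2.trans ?_
    rw [← mul_add]
    refine mul_le_mul_of_nonneg_left (max_le (by positivity) ?_) hnn
    have h1 := le_abs_self (Real.log y)
    rw [hβ]
    split_ifs with hr
    · have : 1 ≤ R₁ := (one_le_inv₀ (pow_pos hrbar n)).2 (pow_le_one₀ hrbar.le hr) |>.trans hR1
      have := Real.log_nonneg this
      linarith
    · have := neg_abs_le (Real.log R₁)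
      linarith
  have hlim : Tendsto (fun t => ENNReal.ofReal (R₀ - R₁) *
      ∫⁻ x in timeSlice (heatball n a b Ψ rbar) t, ENNReal.ofReal |logFun Ψ (x, t)|
        ∂(volumeMeasure (g t)) + ENNReal.ofReal ((R₀ - R₁) * β) *
        volumeMeasure (g t) (timeSlice (heatball n a b Ψ rbar) t)) (𝓝[<] b) (𝓝 0) := by
    have l1 := ENNReal.Tendsto.const_mul (a := ENNReal.ofReal (R₀ - R₁)) hΨ_rad.1
      (Or.inr ENNReal.ofReal_ne_top)
    rw [mul_zero] at l1
    have l2 : Tendsto (fun t => ENNReal.ofReal ((R₀ - R₁) * β) *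
        volumeMeasure (g t) (timeSlice (heatball n a b Ψ rbar) t)) (𝓝[<] b) (𝓝 0) := by
      by_cases hr : rbar ≤ 1
      · simp [hβ, hr]
      · have := ENNReal.Tendsto.const_mul (a := ENNReal.ofReal ((R₀ - R₁) * β))
          (hvol (not_le.1 hr)) (Or.inr ENNReal.ofReal_ne_top)
        rwa [mul_zero] at this
    simpa using l1.add l2
  refine tendsto_of_tendsto_of_tendsto_of_le_of_le' tendsto_const_nhds hlim
    (Eventually.of_forall fun _ => zero_le) ?_
  filter_upwards [Ioo_mem_nhdsLT hab] with t ht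
  rw [timeSlice_heatball ht]
  set Et := timeSlice (superlevel a b Ψ (rbar ^ n)⁻¹) t
  calc ∫⁻ x in Et, ENNReal.ofReal (levelB R₁ R₀ (Ψ (x, t))) ∂(volumeMeasure (g t))
      ≤ ∫⁻ x in Et, (ENNReal.ofReal (R₀ - R₁) * ENNReal.ofReal |logFun Ψ (x, t)|
          + ENNReal.ofReal ((R₀ - R₁) * β)) ∂(volumeMeasure (g t)) := by
        refine lintegral_mono fun x => ?_
        rw [← ENNReal.ofReal_mul hnn, ← ENNReal.ofReal_add (by positivity) (by positivity)]
        exact ENNReal.ofReal_le_ofReal (hbd _ (hΨ x t (Ioo_subset_Ico_self ht)))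
    _ = _ := by
        rw [lintegral_add_right _ measurable_const, setLIntegral_const,
          lintegral_const_mul' _ _ ENNReal.ofReal_ne_top]

end Global

/-! ### Cutting off in time -/

/-- A smooth function of time that vanishes for `t ≥ b - ε` and equals one for `t ≤ b - 2ε`. -/
def timeCut (b ε t : ℝ) : ℝ := Real.smoothTransition ((b - t) / ε - 1)

theorem contDiff_timeCut (b ε : ℝ) : ContDiff ℝ ∞ (timeCut b ε) :=
  Real.smoothTransition.contDiff.comp (by fun_prop)

theorem timeCut_nonneg (b ε t : ℝ) : 0 ≤ timeCut b ε t := Real.smoothTransition.nonneg _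

theorem timeCut_le_one (b ε t : ℝ) : timeCut b ε t ≤ 1 := Real.smoothTransition.le_one _

theorem timeCut_eq_zero {b ε t : ℝ} (hε : 0 < ε) (ht : b - ε ≤ t) : timeCut b ε t = 0 :=
  Real.smoothTransition.zero_of_nonpos (by
    rw [sub_nonpos, div_le_one hε]; linarith)

theorem timeCut_eq_one {b ε t : ℝ} (hε : 0 < ε) (ht : t ≤ b - 2 * ε) : timeCut b ε t = 1 :=
  Real.smoothTransition.one_of_one_le (by
    have : 2 ≤ (b - t) / ε := by rw [le_div_iff₀ hε]; linarith
    linarith)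

theorem deriv_timeCut_eq_zero {b ε t : ℝ} (hε : 0 < ε) (ht : t ≤ b - 2 * ε) :
    deriv (timeCut b ε) t = 0 := by
  apply IsLocalMax.deriv_eq_zero
  refine Eventually.of_forall fun s => ?_
  rw [timeCut_eq_one hε ht]
  exact timeCut_le_one _ _ _

theorem exists_bound_deriv_timeCut :
    ∃ C, 0 ≤ C ∧ ∀ b ε t, 0 < ε → |deriv (timeCut b ε) t| ≤ C / ε := by
  have hd : Continuous (deriv Real.smoothTransition) :=
    (Real.smoothTransition.contDiff (n := 1)).continuous_deriv le_rfl
  have hc : HasCompactSupport (deriv Real.smoothTransition) := by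
    refine HasCompactSupport.intro (isCompact_Icc (a := (0 : ℝ)) (b := 1)) fun x hx => ?_
    rcases le_or_gt x 0 with h0 | h0
    · refine IsLocalMin.deriv_eq_zero (Eventually.of_forall fun s => ?_)
      rw [Real.smoothTransition.zero_of_nonpos h0]
      exact Real.smoothTransition.nonneg s
    · refine IsLocalMax.deriv_eq_zero (Eventually.of_forall fun s => ?_)
      have h1 : 1 ≤ x := le_of_not_ge fun h' => hx ⟨h0.le, h'⟩
      rw [Real.smoothTransition.one_of_one_le h1]
      exact Real.smoothTransition.le_one s
  obtain ⟨C, hC⟩ := hc.exists_bound_of_continuous hd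
  refine ⟨C, (norm_nonneg _).trans (hC 0), fun b ε t hε => ?_⟩
  have h1 : HasDerivAt (fun t => (b - t) / ε - 1) (-1 / ε) t :=
    (((hasDerivAt_id t).const_sub b).div_const ε).sub_const 1
  have h2 : HasDerivAt Real.smoothTransition (deriv Real.smoothTransition ((b - t) / ε - 1))
      ((b - t) / ε - 1) :=
    ((Real.smoothTransition.contDiff (n := 1)).differentiable (by simp) _).hasDerivAt
  have h3 : HasDerivAt (timeCut b ε) _ t := HasDerivAt.comp t h2 h1
  rw [h3.deriv, abs_mul, abs_div, abs_neg, abs_one, abs_of_pos hε, ← div_eq_mul_one_div]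
  gcongr
  exact hC _

section Global

variable {n : ℕ} {M : Type*} [TopologicalSpace M] [T2Space M] [SecondCountableTopology M]
  [ChartedSpace (Model n) M] [IsManifold 𝓘(ℝ, Model n) ∞ M] [MeasurableSpace M] [BorelSpace M]
  {g : ℝ → SmoothMetric n M} {h : ℝ → BilinField n M} {a b : ℝ}

theorem heatOp_time_mul {θ : ℝ → ℝ} {f : M × ℝ → ℝ} {p : M × ℝ}
    (hθ : DifferentiableAt ℝ θ p.2) (hf : DifferentiableAt ℝ (fun s => f (p.1, s)) p.2) :
    heatOp g (fun p => θ p.2 * f p) p = deriv θ p.2 * f p + θ p.2 * heatOp g f p := by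
  rw [heatOp, heatOp, timeDeriv, timeDeriv, spaceLaplacian, spaceLaplacian]
  simp only [laplacian_const_mul]
  rw [deriv_fun_mul hθ hf]
  ring

theorem exists_spacetime_cutoff {K : Set (M × ℝ)} (hK : IsCompact K)
    (hKs : K ⊆ univ ×ˢ Ioc a b) :
    ∃ κ : M × ℝ → ℝ, ContMDiff (𝓘(ℝ, Model n).prod 𝓘(ℝ, ℝ)) 𝓘(ℝ, ℝ) ∞ κ ∧ HasCompactSupport κ ∧
      tsupport κ ⊆ univ ×ˢ Ioi a ∧ (∀ p ∈ K, ∀ᶠ z in 𝓝 p, κ z = 1) ∧ ∀ p, 0 ≤ κ p := by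
  have : LocallyCompactSpace M := Manifold.locallyCompact_of_finiteDimensional 𝓘(ℝ, Model n)
  have hO : IsOpen ((univ : Set M) ×ˢ Ioi a) := isOpen_univ.prod isOpen_Ioi
  obtain ⟨L, hL, hKL, hLO⟩ := exists_compact_between hK hO
    (hKs.trans (prod_mono_right fun t ht => ht.1))
  obtain ⟨κ, h1, h2, h3⟩ := exists_contMDiffMap_one_nhds_of_subset_interior (n := ⊤)
    (𝓘(ℝ, Model n).prod 𝓘(ℝ, ℝ)) hK.isClosed hKL
  have hs : Function.support κ ⊆ L := fun p hp => by_contra fun h => hp (h2 p h)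
  exact ⟨κ, κ.contMDiff, HasCompactSupport.of_support_subset_isCompact hL hs,
    (closure_minimal hs hL.isClosed).trans hLO,
    fun p hp => (eventually_nhdsSet_iff_forall.1 h1) p hp, fun p => (h3 p).1⟩

/-- Cut off by `κ` in space-time and by `timeCut` before the final time, `φ` becomes a test
function on `M × (a, b)`. -/
theorem cutoff_test_function {φ κ : M × ℝ → ℝ}
    (hφ : ContMDiffOn (𝓘(ℝ, Model n).prod 𝓘(ℝ, ℝ)) 𝓘(ℝ, ℝ) ∞ φ (univ ×ˢ Ioc a b))
    (hκ : ContMDiff (𝓘(ℝ, Model n).prod 𝓘(ℝ, ℝ)) 𝓘(ℝ, ℝ) ∞ κ) (hκc : HasCompactSupport κ)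
    (hκs : tsupport κ ⊆ univ ×ˢ Ioi a) {ε : ℝ} (hε : 0 < ε) :
    ContMDiff (𝓘(ℝ, Model n).prod 𝓘(ℝ, ℝ)) 𝓘(ℝ, ℝ) ∞
      (fun p => κ p * (timeCut b ε p.2 * φ p)) ∧
    HasCompactSupport (fun p => κ p * (timeCut b ε p.2 * φ p)) ∧
    tsupport (fun p => κ p * (timeCut b ε p.2 * φ p)) ⊆ univ ×ˢ Ioo a b := by
  have hts : tsupport (fun p => κ p * (timeCut b ε p.2 * φ p)) ⊆ tsupport κ :=
    closure_mono fun p hp => left_ne_zero_of_mul hp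
  have hts' : tsupport (fun p => κ p * (timeCut b ε p.2 * φ p)) ⊆ univ ×ˢ Iic (b - ε) := by
    refine closure_minimal (fun p hp => ⟨mem_univ _, ?_⟩) (isClosed_univ.prod isClosed_Iic)
    by_contra h'
    refine hp ?_
    beta_reduce
    rw [timeCut_eq_zero hε (le_of_not_ge h'), zero_mul, mul_zero]
  have hsub : tsupport (fun p => κ p * (timeCut b ε p.2 * φ p)) ⊆ univ ×ˢ Ioo a b := fun p hp =>
    ⟨mem_univ _, (hκs (hts hp)).2, lt_of_le_of_lt (hts' hp).2 (by linarith)⟩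
  refine ⟨contMDiff_of_tsupport fun p hp => ?_, HasCompactSupport.of_support_subset_isCompact hκc
    ((subset_tsupport _).trans hts), hsub⟩
  have hp' := hsub hp
  have h1 : ContMDiffAt (𝓘(ℝ, Model n).prod 𝓘(ℝ, ℝ)) 𝓘(ℝ, ℝ) ∞ φ p :=
    hφ.contMDiffAt (mem_of_superset ((isOpen_univ.prod isOpen_Ioo).mem_nhds hp')
      (prod_mono_right Ioo_subset_Ioc_self))
  have h2 : ContMDiffAt (𝓘(ℝ, Model n).prod 𝓘(ℝ, ℝ)) 𝓘(ℝ, ℝ) ∞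
      (fun p : M × ℝ => timeCut b ε p.2) p :=
    (contDiff_timeCut b ε).contMDiff.contMDiffAt.comp p contMDiffAt_snd
  exact hκ.contMDiffAt.mul (h2.mul h1)

theorem differentiableAt_time {φ : M × ℝ → ℝ}
    (hφ : ContMDiffOn (𝓘(ℝ, Model n).prod 𝓘(ℝ, ℝ)) 𝓘(ℝ, ℝ) ∞ φ (univ ×ˢ Ioo a b)) {p : M × ℝ}
    (hp : p.2 ∈ Ioo a b) : DifferentiableAt ℝ (fun s => φ (p.1, s)) p.2 := by
  have hc : p.1 ∈ chartSource n p.1 := mem_extChartAt_source p.1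
  have hq : stCoord n p.1 p ∈ chartTarget n p.1 ×ˢ Ioo a b := ⟨coord_mem hc, hp⟩
  have h1 : DifferentiableAt ℝ (stChart n φ p.1) (stCoord n p.1 p) :=
    ((contDiffOn_stChart hφ p.1).contDiffAt ((isOpen_stTarget p.1).mem_nhds hq)).differentiableAt
      (by simp)
  have h2 : HasDerivAt (fun s : ℝ => (coord n p.1 p.1, s)) ((0 : Model n), (1 : ℝ)) p.2 :=
    (hasDerivAt_const _ _).prodMk (hasDerivAt_id _)
  have h3 := (h1.hasFDerivAt.comp_hasDerivAt p.2 h2).differentiableAt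
  have e : (stChart n φ p.1 ∘ fun s => (coord n p.1 p.1, s)) = fun s => φ (p.1, s) := by
    funext s
    change φ (param n p.1 (coord n p.1 p.1), s) = _
    rw [param_coord hc]
  rwa [e] at h3

theorem tendsto_integral_timeCut (hg : IsSmoothFamily g a b) {E : Set (M × ℝ)} {F : M × ℝ → ℝ}
    (hF : IntegrableOn F E (spacetimeMeasure g a b)) :
    Tendsto (fun ε => ∫ p in E, timeCut b ε p.2 * F p ∂(spacetimeMeasure g a b)) (𝓝[>] 0)
      (𝓝 (∫ p in E, F p ∂(spacetimeMeasure g a b))) := by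
  refine tendsto_integral_filter_of_dominated_convergence (fun p => |F p|) ?_ ?_ hF.abs ?_
  · refine Eventually.of_forall fun ε => AEStronglyMeasurable.mul ?_ hF.1
    exact (((contDiff_timeCut b ε).continuous.comp continuous_snd).measurable).aestronglyMeasurable
  · refine Eventually.of_forall fun ε => Eventually.of_forall fun p => ?_
    rw [norm_mul, Real.norm_of_nonneg (timeCut_nonneg _ _ _)]
    exact mul_le_of_le_one_left (norm_nonneg _) (timeCut_le_one _ _ _)
  · filter_upwards [ae_restrict_of_ae (ae_mem_Ioo hg)] with p hp
    refine tendsto_const_nhds.congr' ?_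
    have : (0 : ℝ) < (b - p.2) / 2 := by linarith [hp.2]
    filter_upwards [Ioo_mem_nhdsGT this] with ε hε
    rw [timeCut_eq_one hε.1 (by linarith [hε.2]), one_mul]

end Global

section Global

variable {n : ℕ} {M : Type*} [TopologicalSpace M] [T2Space M] [SecondCountableTopology M]
  [ChartedSpace (Model n) M] [IsManifold 𝓘(ℝ, Model n) ∞ M] [MeasurableSpace M] [BorelSpace M]
  {g : ℝ → SmoothMetric n M} {h : ℝ → BilinField n M} {a b : ℝ}

/-! ### The identity for functions smooth up to the final time -/

variable (hab : a < b) (hg : IsSmoothFamily g a b) (hflow : EvolvesBy g h a b)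
  {Ψ : M × ℝ → ℝ} (hΨ : ∀ x : M, ∀ t ∈ Ico a b, 0 < Ψ (x, t))
  (hΨ_lip : AssumptionLipschitz n a b Ψ)
  {rbar : ℝ} (hrbar : 0 < rbar) (hΨ_rad : AssumptionRadius g a b Ψ rbar)
  {K : Set (M × ℝ)} (hK : IsCompact K) (hKs : K ⊆ univ ×ˢ Ioc a b)
  (hsmall : ∀ x : M, ∀ t ∈ Ico a b, (x, t) ∉ K → Ψ (x, t) ≤ (rbar ^ n)⁻¹)
  {φ : M × ℝ → ℝ}
  (hφ : ContMDiffOn (𝓘(ℝ, Model n).prod 𝓘(ℝ, ℝ)) 𝓘(ℝ, ℝ) ∞ φ (univ ×ˢ Ioc a b))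

include hΨ in
theorem levelB_nonneg_and_le_logFun {R₁ R₀ : ℝ} (hR : R₁ ≤ R₀) (hR1 : 0 < R₁) {p : M × ℝ}
    (hp : p.2 ∈ Ioo a b) : 0 ≤ levelB R₁ R₀ (Ψ p) ∧
      levelB R₁ R₀ (Ψ p) ≤ (R₀ - R₁) * (1 + |Real.log R₁|) * domFun g Ψ p := by
  obtain ⟨h1, h2⟩ := levelB_nonneg_and_le hR hR1 (hΨ p.1 p.2 (Ioo_subset_Ico_self hp))
  refine ⟨h1, h2.trans ?_⟩
  rw [mul_assoc]
  refine mul_le_mul_of_nonneg_left ?_ (sub_nonneg.2 hR)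
  obtain ⟨-, -, d1, d2⟩ := domFun_bounds (g := g) (Ψ := Ψ) p
  have h3 := le_abs_self (logFun Ψ p)
  have h4 := neg_abs_le (Real.log R₁)
  have h5 := mul_le_mul_of_nonneg_left d2 (abs_nonneg (Real.log R₁))
  have h6 : Real.log (Ψ p) = logFun Ψ p := rfl
  refine max_le (by positivity) ?_
  rw [h6]
  linarith

include hab hg hflow hΨ hΨ_lip hΨ_rad hK hKs hsmall hrbar hφ in
/-- The error term from the cut-off in time vanishes in the limit: the derivative of the cut-off is
`O(1/ε)` on a time interval of length `2ε`, where the slice integrals of `B(Ψ)` are small. -/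
theorem tendsto_integral_levelB_deriv {R₁ R₀ : ℝ} (hR : R₁ ≤ R₀) (hR1 : (rbar ^ n)⁻¹ ≤ R₁) :
    Tendsto (fun ε => ∫ p in superlevel a b Ψ (rbar ^ n)⁻¹, levelB R₁ R₀ (Ψ p) *
      (deriv (timeCut b ε) p.2 * φ p) ∂(spacetimeMeasure g a b)) (𝓝[>] 0) (𝓝 0) := by
  set E := superlevel a b Ψ (rbar ^ n)⁻¹ with hE
  have hR0 : 0 < R₁ := (inv_pos.2 (pow_pos hrbar n)).trans_le hR1
  have hEo : IsOpen E := isOpen_superlevel hΨ_lip _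
  obtain ⟨C, hC0, hC⟩ := exists_bound_deriv_timeCut
  obtain ⟨B, hB⟩ := hK.exists_bound_of_continuousOn (hφ.continuousOn.mono hKs)
  have hEK : E ⊆ K := superlevel_subset hsmall
  set B' := max B 0 with hB'
  have hBφ : ∀ p ∈ E, |φ p| ≤ B' := fun p hp => (hB p (hEK hp)).trans (le_max_left _ _)
  have hB0 : 0 ≤ B' := le_max_right _ _
  rw [Metric.tendsto_nhds]
  intro e he
  set δ := e / (2 * C * B' + 1) with hδ
  have hδ0 : 0 < δ := by positivity
  have hδe : 2 * C * B' * δ < e := by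
    rw [hδ, mul_div_assoc', div_lt_iff₀ (by positivity)]
    nlinarith
  -- close to the final time the slice integrals are at most `δ`
  obtain ⟨l, hl, hlδ⟩ := (mem_nhdsLT_iff_exists_Ioo_subset' hab).1
    ((tendsto_slice_levelB (g := g) hab hΨ hrbar hΨ_rad hR hR1).eventually
      (ge_mem_nhds (ENNReal.ofReal_pos.2 hδ0)))
  have hlb : (0 : ℝ) < (b - l) / 2 := by have : l < b := hl; linarith
  filter_upwards [Ioo_mem_nhdsGT hlb] with ε hε
  have hε0 : 0 < ε := hε.1
  have hlε : l < b - 2 * ε := by linarith [hε.2]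
  set k := C / ε * B' with hk
  have hk0 : 0 ≤ k := by positivity
  have hpt : ∀ p ∈ E, ENNReal.ofReal ‖levelB R₁ R₀ (Ψ p) * (deriv (timeCut b ε) p.2 * φ p)‖
      ≤ (univ ×ˢ Ioi (b - 2 * ε)).indicator
        (fun p => ENNReal.ofReal k * ENNReal.ofReal (levelB R₁ R₀ (Ψ p))) p := by
    intro p hp
    have hp2 : p.2 ∈ Ioo a b := hp.1
    obtain ⟨b1, -⟩ := levelB_nonneg_and_le_logFun (g := g) hΨ hR hR0 hp2
    by_cases ht : p.2 ∈ Ioi (b - 2 * ε)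
    · rw [indicator_of_mem (show p ∈ univ ×ˢ Ioi (b - 2 * ε) from ⟨mem_univ _, ht⟩),
        ← ENNReal.ofReal_mul hk0]
      refine ENNReal.ofReal_le_ofReal ?_
      rw [norm_mul, norm_mul, Real.norm_of_nonneg b1, mul_comm]
      refine mul_le_mul_of_nonneg_right ?_ b1
      exact mul_le_mul (hC b ε p.2 hε0) (hBφ p hp) (norm_nonneg _) (by positivity)
    · rw [deriv_timeCut_eq_zero hε0 (not_lt.1 ht)]
      simp
  have hJ : MeasurableSet ((univ : Set M) ×ˢ Ioi (b - 2 * ε)) :=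
    MeasurableSet.univ.prod measurableSet_Ioi
  have hlint : ∫⁻ p in E, ENNReal.ofReal ‖levelB R₁ R₀ (Ψ p) * (deriv (timeCut b ε) p.2 * φ p)‖
      ∂(spacetimeMeasure g a b) ≤ ENNReal.ofReal (2 * C * B' * δ) := by
    calc _ ≤ ∫⁻ p in E, (univ ×ˢ Ioi (b - 2 * ε)).indicator
          (fun p => ENNReal.ofReal k * ENNReal.ofReal (levelB R₁ R₀ (Ψ p))) p
          ∂(spacetimeMeasure g a b) :=
          setLIntegral_mono_ae' hEo.measurableSet (Eventually.of_forall hpt)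
      _ = ENNReal.ofReal k * ∫⁻ p in E ∩ univ ×ˢ Ioi (b - 2 * ε),
            ENNReal.ofReal (levelB R₁ R₀ (Ψ p)) ∂(spacetimeMeasure g a b) := by
          rw [lintegral_indicator hJ, Measure.restrict_restrict hJ, inter_comm,
            lintegral_const_mul' _ _ ENNReal.ofReal_ne_top]
      _ ≤ ENNReal.ofReal k * (ENNReal.ofReal δ * ENNReal.ofReal (2 * ε)) := by
          refine mul_le_mul_right ?_ _
          rw [setLIntegral_spacetimeMeasure hg hEo (superlevel_subset_univ_prod _)
            measurableSet_Ioi (continuousOn_levelB hΨ hΨ_lip hR hR0)]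
          calc _ ≤ ∫⁻ t in Ioo a b,
                  (Ioo (b - 2 * ε) b).indicator (fun _ => ENNReal.ofReal δ) t := by
                refine setLIntegral_mono_ae' measurableSet_Ioo (Eventually.of_forall fun t ht => ?_)
                by_cases ht' : t ∈ Ioi (b - 2 * ε)
                · rw [indicator_of_mem ht',
                    indicator_of_mem (show t ∈ Ioo (b - 2 * ε) b from ⟨ht', ht.2⟩)]
                  exact hlδ ⟨hlε.trans ht', ht.2⟩
                · rw [indicator_of_notMem ht']
                  exact zero_le
            _ ≤ ∫⁻ t, (Ioo (b - 2 * ε) b).indicator (fun _ => ENNReal.ofReal δ) t :=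
                setLIntegral_le_lintegral _ _
            _ = ENNReal.ofReal δ * ENNReal.ofReal (2 * ε) := by
                rw [lintegral_indicator measurableSet_Ioo, setLIntegral_const, Real.volume_Ioo]
                congr 2
                ring
      _ = ENNReal.ofReal (2 * C * B' * δ) := by
          rw [← ENNReal.ofReal_mul hδ0.le, ← ENNReal.ofReal_mul hk0]
          congr 1
          rw [hk]
          field_simp
  rw [Real.dist_eq, sub_zero]
  refine lt_of_le_of_lt ((norm_integral_le_lintegral_norm _).trans
    (ENNReal.toReal_le_of_le_ofReal (by positivity) hlint)) hδe

include hab hg hflow hΨ hΨ_lip hΨ_rad hK hKs hsmall hrbar hφ in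
/-- The identity of `integral_gapFun` for functions `φ` that are smooth up to the final time, with
all integrals over the largest heatball. -/
theorem integral_gapFun_superlevel {R₁ R₀ : ℝ} (hR : R₁ ≤ R₀) (hR1 : (rbar ^ n)⁻¹ ≤ R₁) :
    IntegrableOn (fun p => gapFun g h R₁ R₀ Ψ p * φ p) (superlevel a b Ψ (rbar ^ n)⁻¹)
      (spacetimeMeasure g a b) ∧
    IntegrableOn (fun p => levelB R₁ R₀ (Ψ p) * heatOp g φ p) (superlevel a b Ψ (rbar ^ n)⁻¹)
      (spacetimeMeasure g a b) ∧
    (ContMDiffOn (𝓘(ℝ, Model n).prod 𝓘(ℝ, ℝ)) 𝓘(ℝ, ℝ) ∞ Ψ (univ ×ˢ Ioo a b) →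
      IntegrableOn (conjHeatQuotient g h Ψ) (superlevel a b Ψ (rbar ^ n)⁻¹)
        (spacetimeMeasure g a b) →
      ∫ p in superlevel a b Ψ (rbar ^ n)⁻¹, gapFun g h R₁ R₀ Ψ p * φ p ∂(spacetimeMeasure g a b)
        - ∫ p in superlevel a b Ψ (rbar ^ n)⁻¹, levelB R₁ R₀ (Ψ p) * heatOp g φ p
          ∂(spacetimeMeasure g a b)
        = ∫ p in superlevel a b Ψ (rbar ^ n)⁻¹, levelA R₁ R₀ (Ψ p) * conjHeatQuotient g h Ψ p * φ p
          ∂(spacetimeMeasure g a b)) ∧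
    (IsDistribSubsolution g a b Ψ → (∀ x : M, ∀ t ∈ Ioc a b, 0 ≤ φ (x, t)) →
      0 ≤ ∫ p in superlevel a b Ψ (rbar ^ n)⁻¹, gapFun g h R₁ R₀ Ψ p * φ p ∂(spacetimeMeasure g a b)
        - ∫ p in superlevel a b Ψ (rbar ^ n)⁻¹, levelB R₁ R₀ (Ψ p) * heatOp g φ p
          ∂(spacetimeMeasure g a b)) := by
  set E := superlevel a b Ψ (rbar ^ n)⁻¹ with hE
  set ν := spacetimeMeasure g a b with hν
  have hR0 : 0 < R₁ := (inv_pos.2 (pow_pos hrbar n)).trans_le hR1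
  have hEK : E ⊆ K := superlevel_subset hsmall
  have hEo : IsOpen E := isOpen_superlevel hΨ_lip _
  have hφS : ContMDiffOn (𝓘(ℝ, Model n).prod 𝓘(ℝ, ℝ)) 𝓘(ℝ, ℝ) ∞ φ (univ ×ˢ Ioo a b) :=
    hφ.mono (prod_mono_right Ioo_subset_Ioc_self)
  obtain ⟨Bφ, hBφ⟩ := hK.exists_bound_of_continuousOn (hφ.continuousOn.mono hKs)
  obtain ⟨T, hT⟩ := hK.exists_bound_of_continuousOn
    ((continuousOn_trH (h := h) hab hg hflow).mono
      (hKs.trans (prod_mono_right Ioc_subset_Icc_self)))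
  obtain ⟨H, hH0, hH⟩ := exists_bound_heatOp hab hg hflow hφ hK hKs
  have mφ : AEStronglyMeasurable φ ν := aestronglyMeasurable_of_continuousOn hg hφS.continuousOn
  have mH : AEStronglyMeasurable (heatOp g φ) ν :=
    aestronglyMeasurable_of_continuousOn hg (continuousOn_heatOp hab hg hflow hφS)
  have mB : AEStronglyMeasurable (fun p => levelB R₁ R₀ (Ψ p)) ν :=
    aestronglyMeasurable_of_continuousOn hg (continuousOn_levelB hΨ hΨ_lip hR hR0)
  have hdom : ∀ {F : M × ℝ → ℝ} {B : ℝ}, AEStronglyMeasurable F ν →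
      (∀ p ∈ E, |F p| ≤ B * domFun g Ψ p) → IntegrableOn F E ν :=
    integrableOn_of_le_domFun hab hg hflow hΨ hΨ_lip hΨ_rad hK hKs hsmall
  have hB := fun p (hp : p ∈ E) => levelB_nonneg_and_le_logFun (g := g) hΨ hR hR0
    (show p.2 ∈ Ioo a b from hp.1)
  have hA : ∀ p, |levelA R₁ R₀ (Ψ p)| ≤ R₀ - R₁ := fun p => abs_levelA_le hR _
  set β := (R₀ - R₁) * (1 + |Real.log R₁|) with hβ
  have hgap : ∀ p ∈ E, |gapFun g h R₁ R₀ Ψ p| ≤ (R₀ + R₁ + (R₀ - R₁ + β) * |T|) * domFun g Ψ p := by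
    intro p hp
    obtain ⟨d0, d1, d2, d3⟩ := domFun_bounds (g := g) (Ψ := Ψ) p
    obtain ⟨b0, b1⟩ := hB p hp
    have t1 : |trH g h p| ≤ |T| := (hT p (hEK hp)).trans (le_abs_self T)
    have s1 : |(if R₀ < Ψ p then R₀ else 0) - (if R₁ < Ψ p then R₁ else 0)| ≤ R₀ + R₁ := by
      refine (abs_sub _ _).trans (add_le_add ?_ ?_) <;> split_ifs <;>
        simp [abs_of_pos, hR0, hR0.trans_le hR, hR0.le, (hR0.trans_le hR).le]
    have s2 : |levelA R₁ R₀ (Ψ p) - levelB R₁ R₀ (Ψ p)| ≤ (R₀ - R₁ + β) * domFun g Ψ p := by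
      refine (abs_sub _ _).trans ?_
      rw [add_mul, abs_of_nonneg b0]
      exact add_le_add ((hA p).trans (le_mul_of_one_le_right (sub_nonneg.2 hR) d3)) b1
    rw [gapFun, add_mul]
    refine (abs_add_le _ _).trans (add_le_add ?_ ?_)
    · rw [abs_mul, abs_of_nonneg d0]
      exact mul_le_mul s1 d1 d0 (by linarith [hR0.trans_le hR])
    · rw [abs_mul, mul_right_comm]
      exact mul_le_mul s2 t1 (abs_nonneg _) ((abs_nonneg _).trans s2)
  have hφE : ∀ p ∈ E, |φ p| ≤ |Bφ| := fun p hp => (hBφ p (hEK hp)).trans (le_abs_self _)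
  have i1 : IntegrableOn (fun p => gapFun g h R₁ R₀ Ψ p * φ p) E ν := by
    refine hdom (B := (R₀ + R₁ + (R₀ - R₁ + β) * |T|) * |Bφ|)
      ((aestronglyMeasurable_gapFun hab hg hflow hΨ hΨ_lip hR hR0).mul mφ) fun p hp => ?_
    rw [abs_mul, mul_right_comm]
    exact mul_le_mul (hgap p hp) (hφE p hp) (abs_nonneg _) ((abs_nonneg _).trans (hgap p hp))
  have i2 : IntegrableOn (fun p => levelB R₁ R₀ (Ψ p) * heatOp g φ p) E ν := by
    refine hdom (B := β * H) (mB.mul mH) fun p hp => ?_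
    obtain ⟨b0, b1⟩ := hB p hp
    rw [abs_mul, abs_of_nonneg b0, mul_right_comm]
    exact mul_le_mul b1 (hH p (hEK hp) hp.1) (abs_nonneg _) (b0.trans b1)
  refine ⟨i1, i2, ?_⟩
  -- off the heatball all integrands vanish
  have hoff : ∀ p, p.2 ∈ Ioo a b → p ∉ E → Ψ p ≤ R₁ ∧ 0 < Ψ p := fun p hp hpE =>
    ⟨(not_lt.1 fun h' => hpE ⟨hp, h'⟩).trans hR1, hΨ p.1 p.2 (Ioo_subset_Ico_self hp)⟩
  -- the admissible test functions `κ χ φ`, where `κ = 1` near `K` and `χ` is the cut-off in time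
  obtain ⟨κ, hκ, hκc, hκs, hκ1, hκ0⟩ := exists_spacetime_cutoff (n := n) hK hKs
  set η : ℝ → M × ℝ → ℝ := fun ε p => κ p * (timeCut b ε p.2 * φ p) with hη
  have hηE : ∀ ε, ∀ p ∈ E, η ε =ᶠ[𝓝 p] fun p => timeCut b ε p.2 * φ p := fun ε p hp => by
    filter_upwards [hκ1 p (hEK hp)] with z hz
    rw [hη]
    beta_reduce
    rw [hz, one_mul]
  have e1 : ∀ ε, ∫ p, gapFun g h R₁ R₀ Ψ p * η ε p ∂ν
      = ∫ p in E, timeCut b ε p.2 * (gapFun g h R₁ R₀ Ψ p * φ p) ∂ν := fun ε => by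
    rw [← setIntegral_eq_integral_of_ae_compl_eq_zero (s := E)]
    · refine setIntegral_congr_fun hEo.measurableSet fun p hp => ?_
      rw [(hηE ε p hp).eq_of_nhds]
      ring
    · filter_upwards [ae_mem_Ioo hg] with p hp hpE
      obtain ⟨o1, o2⟩ := hoff p hp hpE
      rw [gapFun, if_neg (o1.trans hR).not_gt, if_neg o1.not_gt, levelA_eq_zero hR o1,
        levelB_eq_zero hR o2 o1]
      simp
  have e2 : ∀ ε, ∫ p, levelB R₁ R₀ (Ψ p) * heatOp g (η ε) p ∂ν
      = ∫ p in E, (levelB R₁ R₀ (Ψ p) * (deriv (timeCut b ε) p.2 * φ p)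
        + timeCut b ε p.2 * (levelB R₁ R₀ (Ψ p) * heatOp g φ p)) ∂ν := fun ε => by
    rw [← setIntegral_eq_integral_of_ae_compl_eq_zero (s := E)]
    · refine setIntegral_congr_fun hEo.measurableSet fun p hp => ?_
      rw [heatOp_congr (g := g) (hηE ε p hp), heatOp_time_mul
        ((contDiff_timeCut b ε).differentiable (by simp) _) (differentiableAt_time hφS hp.1)]
      ring
    · filter_upwards [ae_mem_Ioo hg] with p hp hpE
      obtain ⟨o1, o2⟩ := hoff p hp hpE
      rw [levelB_eq_zero hR o2 o1, zero_mul]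
  have hcut : ∀ ε, AEStronglyMeasurable (fun p : M × ℝ => timeCut b ε p.2) ν := fun ε =>
    (((contDiff_timeCut b ε).continuous.comp continuous_snd).measurable).aestronglyMeasurable
  have i3 : ∀ ε, IntegrableOn (fun p => timeCut b ε p.2 * (levelB R₁ R₀ (Ψ p) * heatOp g φ p))
      E ν :=
    fun ε => i2.abs.mono' ((hcut ε).restrict.mul i2.1) (Eventually.of_forall fun p => by
      rw [norm_mul, Real.norm_of_nonneg (timeCut_nonneg _ _ _)]
      exact mul_le_of_le_one_left (norm_nonneg _) (timeCut_le_one _ _ _))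
  have i4 : ∀ ε, 0 < ε →
      IntegrableOn (fun p => levelB R₁ R₀ (Ψ p) * (deriv (timeCut b ε) p.2 * φ p)) E ν := by
    intro ε hε
    obtain ⟨C, hC0, hC⟩ := exists_bound_deriv_timeCut
    have hcd : Continuous fun p : M × ℝ => deriv (timeCut b ε) p.2 :=
      ((contDiff_timeCut b ε).continuous_deriv (by simp)).comp continuous_snd
    refine hdom (B := β * (C / ε * |Bφ|)) (mB.mul (hcd.measurable.aestronglyMeasurable.mul mφ))
      fun p hp => ?_
    obtain ⟨b0, b1⟩ := hB p hp
    rw [abs_mul, abs_of_nonneg b0, mul_right_comm, abs_mul]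
    exact mul_le_mul b1 (mul_le_mul (hC b ε p.2 hε) (hφE p hp) (abs_nonneg _) (by positivity))
      (by positivity) (b0.trans b1)
  have hlim : Tendsto (fun ε => ∫ p, gapFun g h R₁ R₀ Ψ p * η ε p ∂ν
      - ∫ p, levelB R₁ R₀ (Ψ p) * heatOp g (η ε) p ∂ν) (𝓝[>] 0)
      (𝓝 (∫ p in E, gapFun g h R₁ R₀ Ψ p * φ p ∂ν
        - ∫ p in E, levelB R₁ R₀ (Ψ p) * heatOp g φ p ∂ν)) := by
    have l1 := tendsto_integral_timeCut hg i1
    have l2 := tendsto_integral_timeCut hg i2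
    have l3 := tendsto_integral_levelB_deriv hab hg hflow hΨ hΨ_lip hrbar hΨ_rad hK hKs hsmall hφ
      hR hR1
    have l4 := l1.sub (l3.add l2)
    rw [zero_add] at l4
    refine l4.congr' ?_
    filter_upwards [self_mem_nhdsWithin] with ε hε
    rw [e1, e2, integral_add (i4 ε hε) (i3 ε)]
  constructor
  · intro hs hcq
    have i5 : IntegrableOn (fun p => levelA R₁ R₀ (Ψ p) * conjHeatQuotient g h Ψ p * φ p) E ν := by
      refine (hcq.abs.const_mul ((R₀ - R₁) * |Bφ|)).mono'
        ((((aestronglyMeasurable_of_continuousOn hg (continuousOn_levelA hΨ_lip)).restrict).mul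
          hcq.1).mul mφ.restrict) ?_
      filter_upwards [ae_restrict_mem hEo.measurableSet] with p hp
      rw [norm_mul, norm_mul, mul_right_comm (R₀ - R₁)]
      refine mul_le_mul ?_ (hφE p hp) (norm_nonneg _)
        (mul_nonneg (sub_nonneg.2 hR) (abs_nonneg _))
      exact mul_le_mul_of_nonneg_right (hA p) (abs_nonneg _)
    refine tendsto_nhds_unique hlim ((tendsto_integral_timeCut hg i5).congr' ?_)
    filter_upwards [self_mem_nhdsWithin] with ε hε
    obtain ⟨c1, c2, c3⟩ := cutoff_test_function hφ hκ hκc hκs (ε := ε) hε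
    rw [(integral_gapFun hab hg hflow hΨ hΨ_lip hR hR0 c1 c2 c3).1 hs]
    refine Eq.trans ?_ (setIntegral_eq_integral_of_ae_compl_eq_zero (s := E) ?_)
    · refine setIntegral_congr_fun hEo.measurableSet fun p hp => ?_
      have h1 : κ p * (timeCut b ε p.2 * φ p) = timeCut b ε p.2 * φ p := (hηE ε p hp).eq_of_nhds
      rw [h1]
      ring
    · filter_upwards [ae_mem_Ioo hg] with p hp hpE
      rw [levelA_eq_zero hR (hoff p hp hpE).1, zero_mul, zero_mul]
  · intro hsub hφ0
    refine ge_of_tendsto hlim ?_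
    filter_upwards [self_mem_nhdsWithin] with ε hε
    obtain ⟨c1, c2, c3⟩ := cutoff_test_function hφ hκ hκc hκs (ε := ε) hε
    refine (integral_gapFun hab hg hflow hΨ hΨ_lip hR hR0 c1 c2 c3).2 hsub fun p => ?_
    by_cases hp : p ∈ tsupport (η ε)
    · have := (c3 hp).2
      exact mul_nonneg (hκ0 p) (mul_nonneg (timeCut_nonneg _ _ _)
        (hφ0 p.1 p.2 (Ioo_subset_Ioc_self this)))
    · exact (image_eq_zero_of_notMem_tsupport hp).ge

end Global

/-! ### Integration over the radius -/

/-- The contribution of a point with `Ψ = y` to the integrand over the radii. -/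
def radial (n : ℕ) (x y z r : ℝ) : ℝ :=
  n / r ^ (n + 1) * if (r ^ n)⁻¹ < y then x + (Real.log y + n * Real.log r) * z else 0

theorem log_inv_pow (n : ℕ) (r : ℝ) : Real.log ((r ^ n)⁻¹) = -(n * Real.log r) := by
  rw [Real.log_inv, Real.log_pow]

theorem integrableOn_radial (n : ℕ) {x y z r₀ r₁ : ℝ} (h0 : 0 < r₀) :
    IntegrableOn (radial n x y z) (Icc r₀ r₁) := by
  have hS : MeasurableSet {r : ℝ | (r ^ n)⁻¹ < y} :=
    measurableSet_lt (by fun_prop) measurable_const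
  have hpos : ∀ r ∈ Icc r₀ r₁, r ≠ 0 := fun r hr => (h0.trans_le hr.1).ne'
  have hc : ContinuousOn (fun r : ℝ => n / r ^ (n + 1) * (x + (Real.log y + n * Real.log r) * z))
      (Icc r₀ r₁) := by
    refine (continuousOn_const.div (by fun_prop) fun r hr => pow_ne_zero _ (hpos r hr)).mul
      (continuousOn_const.add ((continuousOn_const.add (continuousOn_const.mul ?_)).mul
        continuousOn_const))
    exact Real.continuousOn_log.mono fun r hr => hpos r hr
  have h1 := (hc.integrableOn_Icc (μ := volume)).indicator hS
  refine h1.congr_fun (fun r _ => ?_) measurableSet_Icc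
  by_cases hr : (r ^ n)⁻¹ < y
  · rw [indicator_of_mem (show r ∈ {r : ℝ | (r ^ n)⁻¹ < y} from hr), radial, if_pos hr]
  · rw [indicator_of_notMem (show r ∉ {r : ℝ | (r ^ n)⁻¹ < y} from hr), radial, if_neg hr, mul_zero]

/-- Integration over the radius produces the two level functions. -/
theorem integral_radial (n : ℕ) {x y z r₀ r₁ : ℝ} (h0 : 0 < r₀) (h01 : r₀ ≤ r₁) (hy : 0 < y) :
    ∫ r in r₀..r₁, radial n x y z r
      = levelA (r₁ ^ n)⁻¹ (r₀ ^ n)⁻¹ y * x + levelB (r₁ ^ n)⁻¹ (r₀ ^ n)⁻¹ y * z := by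
  -- for `n = 0` both sides vanish
  rcases Nat.eq_zero_or_pos n with hn | hn
  · subst hn
    simp [radial, levelA, levelB]
  have hpos : ∀ r ∈ uIcc r₀ r₁, 0 < r := fun r hr => by
    rw [uIcc_of_le h01] at hr
    exact h0.trans_le hr.1
  -- a primitive in the radius
  set F : ℝ → ℝ := fun r => -(min (r ^ n)⁻¹ y * x +
    (min (r ^ n)⁻¹ y + (r ^ n)⁻¹ * max 0 (Real.log y + n * Real.log r)) * z) with hF
  have hρ : ∀ r, 0 < r → HasDerivAt (fun r : ℝ => (r ^ n)⁻¹) (-(n / r ^ (n + 1))) r := by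
    intro r hr
    have h1 := (hasDerivAt_pow n r).inv (pow_ne_zero n hr.ne')
    refine h1.congr_deriv ?_
    have e : r ^ n = r ^ (n - 1) * r := by rw [← pow_succ, Nat.sub_add_cancel hn]
    have e2 : r ^ (n + 1) = r ^ (n - 1) * r * r := by rw [pow_succ, e]
    rw [e2, e]
    field_simp
  have hlog : ∀ r, 0 < r → HasDerivAt (fun r : ℝ => Real.log y + n * Real.log r) (n / r) r := by
    intro r hr
    have := ((Real.hasDerivAt_log hr.ne').const_mul (n : ℝ)).const_add (Real.log y)
    simpa [div_eq_mul_inv] using this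
  have hsign : ∀ r, 0 < r → ((r ^ n)⁻¹ < y ↔ 0 < Real.log y + n * Real.log r) := by
    intro r hr
    rw [← Real.log_lt_log_iff (inv_pos.2 (pow_pos hr n)) hy, log_inv_pow]
    constructor <;> intro h <;> linarith
  have hsign' : ∀ r, 0 < r → (y < (r ^ n)⁻¹ ↔ Real.log y + n * Real.log r < 0) := by
    intro r hr
    rw [← Real.log_lt_log_iff hy (inv_pos.2 (pow_pos hr n)), log_inv_pow]
    constructor <;> intro h <;> linarith
  -- the primitive has a corner at the one radius where `r⁻ⁿ = y`
  have hcount : ({r : ℝ | 0 < r ∧ (r ^ n)⁻¹ = y}).Countable := by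
    refine Set.Subsingleton.countable fun r hr s hs => ?_
    have h1 : r ^ n = s ^ n := inv_injective (hr.2.trans hs.2.symm)
    exact (pow_left_inj₀ hr.1.le hs.1.le hn.ne').1 h1
  have hcρ : ContinuousOn (fun r : ℝ => (r ^ n)⁻¹) (uIcc r₀ r₁) := fun r hr =>
    (hρ r (hpos r hr)).continuousAt.continuousWithinAt
  have hcl : ContinuousOn (fun r : ℝ => Real.log y + n * Real.log r) (uIcc r₀ r₁) := fun r hr =>
    (hlog r (hpos r hr)).continuousAt.continuousWithinAt
  have hmin : Continuous fun s : ℝ => min s y := continuous_id.min continuous_const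
  have hmax : Continuous fun s : ℝ => max 0 s := continuous_const.max continuous_id
  have hcF : ContinuousOn F (uIcc r₀ r₁) :=
    (((hmin.comp_continuousOn hcρ).mul continuousOn_const).add (((hmin.comp_continuousOn hcρ).add
      (hcρ.mul (hmax.comp_continuousOn hcl))).mul continuousOn_const)).neg
  have hint : IntervalIntegrable (radial n x y z) volume r₀ r₁ := by
    rw [intervalIntegrable_iff_integrableOn_Icc_of_le h01]
    exact integrableOn_radial n h0
  rw [integral_eq_of_hasDerivAt_off_countable F (radial n x y z) hcount hcF ?_ hint]
  · have e1 : ∀ r, Real.log y + n * Real.log r = Real.log y - Real.log ((r ^ n)⁻¹) := fun r => by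
      rw [log_inv_pow]; ring
    simp only [hF, e1, levelA, levelB]
    ring
  · intro r hr
    have hr0 : 0 < r := by
      have := hr.1
      rw [min_eq_left h01, max_eq_right h01] at this
      exact h0.trans this.1
    have hne : (r ^ n)⁻¹ ≠ y := fun h => hr.2 ⟨hr0, h⟩
    have hd1 := hρ r hr0
    have hd2 := hlog r hr0
    rcases lt_or_gt_of_ne hne with hlt | hgt
    · have hG : HasDerivAt (fun r : ℝ => -((r ^ n)⁻¹ * x +
          ((r ^ n)⁻¹ + (r ^ n)⁻¹ * (Real.log y + n * Real.log r)) * z)) (radial n x y z r) r := by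
        refine (((hd1.mul_const x).add ((hd1.add (hd1.mul hd2)).mul_const z)).neg).congr_deriv ?_
        rw [radial, if_pos hlt, pow_succ]
        field_simp
        ring
      refine hG.congr_of_eventuallyEq ?_
      filter_upwards [hd1.continuousAt.eventually (gt_mem_nhds hlt), lt_mem_nhds hr0] with s hs hs0
      simp only [hF]
      rw [min_eq_left hs.le, max_eq_right ((hsign s hs0).1 hs).le]
    · have hG : HasDerivAt (fun _ : ℝ => -(y * x + y * z)) (radial n x y z r) r := by
        refine (hasDerivAt_const r _).congr_deriv ?_
        rw [radial, if_neg hgt.not_gt, mul_zero]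
      refine hG.congr_of_eventuallyEq ?_
      filter_upwards [hd1.continuousAt.eventually (lt_mem_nhds hgt), lt_mem_nhds hr0] with s hs hs0
      simp only [hF]
      rw [min_eq_right hs.le, max_eq_left ((hsign' s hs0).1 hs).le, mul_zero, add_zero]

/-- Fubini's theorem for the integration over the radius. -/
theorem integral_radial_swap {X : Type*} [MeasurableSpace X] {μ : Measure X} [IsFiniteMeasure μ]
    (n : ℕ) {r₀ r₁ : ℝ} (h0 : 0 < r₀) (h01 : r₀ ≤ r₁) {u x z : X → ℝ} (hu : AEMeasurable u μ)
    (hupos : ∀ᵐ p ∂μ, 0 < u p) (hlog : Integrable (fun p => Real.log (u p)) μ)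
    (hx : Integrable x μ) (hz : AEStronglyMeasurable z μ) {B : ℝ} (hB : ∀ᵐ p ∂μ, |z p| ≤ B) :
    IntervalIntegrable (fun r => ∫ p, radial n (x p) (u p) (z p) r ∂μ) volume r₀ r₁ ∧
    ∫ r in r₀..r₁, ∫ p, radial n (x p) (u p) (z p) r ∂μ
      = ∫ p, (levelA (r₁ ^ n)⁻¹ (r₀ ^ n)⁻¹ (u p) * x p
          + levelB (r₁ ^ n)⁻¹ (r₀ ^ n)⁻¹ (u p) * z p) ∂μ := by
  set τ := (volume : Measure ℝ).restrict (Ioc r₀ r₁) with hτ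
  set L : ℝ := |Real.log r₀| + |Real.log r₁| with hL
  have hzi : Integrable z μ := Integrable.of_bound hz B hB
  have hlz : Integrable (fun p => Real.log (u p) * z p) μ := by
    have h1 : Integrable (fun p => z p * Real.log (u p)) μ := hlog.bdd_mul (c := B) hz hB
    exact h1.congr (Eventually.of_forall fun p => mul_comm _ _)
  -- an integrable bound
  set W : X → ℝ := fun p => |x p| + |Real.log (u p) * z p| + n * L * |z p| with hW
  have hWi : Integrable W μ := (hx.abs.add hlz.abs).add (hzi.abs.const_mul _)
  have hWτ : Integrable (fun q : ℝ × X => n / r₀ ^ (n + 1) * W q.2) (τ.prod μ) :=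
    (integrable_const (μ := τ) ((n : ℝ) / r₀ ^ (n + 1))).mul_prod hWi
  have hmeas : AEStronglyMeasurable (fun q : ℝ × X => radial n (x q.2) (u q.2) (z q.2) q.1)
      (τ.prod μ) := by
    have mu : AEMeasurable (fun q : ℝ × X => u q.2) (τ.prod μ) :=
      (hu.aestronglyMeasurable.comp_snd).aemeasurable
    have mx : AEMeasurable (fun q : ℝ × X => x q.2) (τ.prod μ) :=
      (hx.1.comp_snd).aemeasurable
    have mz : AEMeasurable (fun q : ℝ × X => z q.2) (τ.prod μ) :=
      (hz.comp_snd).aemeasurable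
    have mr : AEMeasurable (fun q : ℝ × X => q.1) (τ.prod μ) := measurable_fst.aemeasurable
    have m4 := ((mr.prodMk mu).prodMk (mx.prodMk mz))
    have hm : Measurable fun v : (ℝ × ℝ) × (ℝ × ℝ) => radial n v.2.1 v.1.2 v.2.2 v.1.1 := by
      unfold radial
      refine Measurable.mul (by fun_prop) (Measurable.ite ?_ (by fun_prop) measurable_const)
      exact measurableSet_lt (by fun_prop) (by fun_prop)
    exact (hm.comp_aemeasurable m4).aestronglyMeasurable
  have hint : Integrable (fun q : ℝ × X => radial n (x q.2) (u q.2) (z q.2) q.1) (τ.prod μ) := by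
    refine hWτ.mono' hmeas ?_
    have hmem : ∀ᵐ q ∂(τ.prod μ), q.1 ∈ Ioc r₀ r₁ :=
      Measure.quasiMeasurePreserving_fst.ae (ae_restrict_mem measurableSet_Ioc)
    filter_upwards [hmem] with q hq
    have hq0 : 0 < q.1 := h0.trans hq.1
    have k1 : |(n : ℝ) / q.1 ^ (n + 1)| ≤ n / r₀ ^ (n + 1) := by
      rw [abs_of_nonneg (by positivity)]
      have := hq.1.le
      gcongr
    have k2 : |Real.log q.1| ≤ L := by
      have l1 := Real.log_le_log h0 hq.1.le
      have l2 := Real.log_le_log hq0 hq.2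
      have := neg_abs_le (Real.log r₀)
      have := le_abs_self (Real.log r₁)
      have := abs_nonneg (Real.log r₁)
      have := abs_nonneg (Real.log r₀)
      rw [abs_le]
      constructor <;> rw [hL] <;> linarith
    rw [radial, norm_mul, Real.norm_eq_abs, Real.norm_eq_abs]
    refine mul_le_mul k1 ?_ (abs_nonneg _) (by positivity)
    have hW0 : 0 ≤ W q.2 := by
      have : 0 ≤ L := by positivity
      positivity
    split_ifs
    · rw [add_mul]
      refine (abs_add_le _ _).trans ?_
      rw [hW]
      beta_reduce
      rw [add_assoc]
      refine add_le_add le_rfl ((abs_add_le _ _).trans (add_le_add le_rfl ?_))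
      rw [abs_mul, abs_mul, Nat.abs_cast]
      gcongr
    · rwa [abs_zero]
  constructor
  · rw [intervalIntegrable_iff_integrableOn_Ioc_of_le h01]
    exact hint.integral_prod_left
  · rw [intervalIntegral.integral_of_le h01,
      integral_integral_swap (f := fun r p => radial n (x p) (u p) (z p) r) hint]
    refine integral_congr_ae ?_
    filter_upwards [hupos] with p hp
    rw [← integral_radial n h0 h01 hp, intervalIntegral.integral_of_le h01]

/-! ### The conjugate heat operator and the logarithm -/

/-- `Δ log u = Δu / u - |∇u|² / u²`. -/
theorem HeatCoeff.lap_log {ι E : Type*} [Fintype ι] [NormedAddCommGroup E] [NormedSpace ℝ E]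
    (c : HeatCoeff ι E) {u : E → ℝ} (hu : ContDiffOn ℝ ∞ u c.D) (hpos : ∀ q ∈ c.D, 0 < u q) {q : E}
    (hq : q ∈ c.D) : c.lap (fun z => Real.log (u z)) q
      = c.lap u q / u q - c.pair q (fderiv ℝ u q) (fderiv ℝ u q) / u q ^ 2 := by
  have hd : ∀ z ∈ c.D, DifferentiableAt ℝ u z := fun z hz =>
    (hu.contDiffAt (c.isOpen.mem_nhds hz)).differentiableAt (by simp)
  have hfl : ∀ i, c.flux (fun z => Real.log (u z)) i =ᶠ[𝓝 q] fun z => (u z)⁻¹ * c.flux u i z := by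
    intro i
    filter_upwards [c.isOpen.mem_nhds hq] with z hz
    have h1 : fderiv ℝ (fun z => Real.log (u z)) z = (u z)⁻¹ • fderiv ℝ u z :=
      ((hd z hz).hasFDerivAt.log (hpos z hz).ne').fderiv
    rw [flux, flux, h1]
    simp only [smul_apply, smul_eq_mul, Finset.mul_sum]
    exact Finset.sum_congr rfl fun j _ => by ring
  have hu0 := (hpos q hq).ne'
  have hv0 := (c.v_pos q hq).ne'
  have hfd : ∀ i, fderiv ℝ (c.flux (fun z => Real.log (u z)) i) q (c.e i)
      = (u q)⁻¹ * fderiv ℝ (c.flux u i) q (c.e i)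
        - (u q ^ 2)⁻¹ * (fderiv ℝ u q (c.e i) * c.flux u i q) := by
    intro i
    have dI : HasFDerivAt (fun x => (u x)⁻¹) (-(u q ^ 2)⁻¹ • fderiv ℝ u q) q :=
      (hasDerivAt_inv hu0).comp_hasFDerivAt q (hd q hq).hasFDerivAt
    have dF : DifferentiableAt ℝ (c.flux u i) q :=
      ((c.flux_smooth hu i).contDiffAt (c.isOpen.mem_nhds hq)).differentiableAt (by simp)
    have hm : HasFDerivAt (fun z => (u z)⁻¹ * c.flux u i z) _ q := dI.mul dF.hasFDerivAt
    rw [(hfl i).fderiv_eq, hm.fderiv]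
    simp only [add_apply, smul_apply, smul_eq_mul]
    ring
  have hp := c.pair_eq_flux q (fderiv ℝ u q) u
  rw [lap, lap, Finset.sum_congr rfl fun i _ => hfd i, Finset.sum_sub_distrib, ← Finset.mul_sum,
    ← Finset.mul_sum, ← hp]
  field_simp

section Global

variable {n : ℕ} {M : Type*} [TopologicalSpace M] [T2Space M] [SecondCountableTopology M]
  [ChartedSpace (Model n) M] [IsManifold 𝓘(ℝ, Model n) ∞ M] [MeasurableSpace M] [BorelSpace M]
  {g : ℝ → SmoothMetric n M} {h : ℝ → BilinField n M} {a b : ℝ}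

variable (hab : a < b) (hg : IsSmoothFamily g a b) (hflow : EvolvesBy g h a b)
  {Ψ : M × ℝ → ℝ} (hΨ : ∀ x : M, ∀ t ∈ Ico a b, 0 < Ψ (x, t))

include hab hg hflow hΨ in
theorem conjHeatQuotient_eq_logConjHeat
    (hs : ContMDiffOn (𝓘(ℝ, Model n).prod 𝓘(ℝ, ℝ)) 𝓘(ℝ, ℝ) ∞ Ψ (univ ×ˢ Ioo a b)) {p : M × ℝ}
    (hp : p.2 ∈ Ioo a b) : conjHeatQuotient g h Ψ p = logConjHeat g h Ψ p := by
  set c := p.1 with hcdef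
  have hc : p.1 ∈ chartSource n c := mem_extChartAt_source c
  set q := stCoord n c p with hqdef
  have hq : q ∈ chartTarget n c ×ˢ Ioo a b := ⟨coord_mem hc, hp⟩
  set C := stCoeff hab hg hflow c with hC
  set u := stChart n Ψ c with hu
  have hus : ContDiffOn ℝ ∞ u C.D := contDiffOn_stChart hs c
  have hpos : ∀ z ∈ C.D, 0 < u z := fun z hz => hΨ _ _ (Ioo_subset_Ico_self hz.2)
  have hls : ContMDiffOn (𝓘(ℝ, Model n).prod 𝓘(ℝ, ℝ)) 𝓘(ℝ, ℝ) ∞ (logFun Ψ) (univ ×ˢ Ioo a b) :=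
    fun z hz => (Real.contDiffAt_log.2
      (hΨ z.1 z.2 (Ioo_subset_Ico_self hz.2)).ne').contMDiffAt.comp_contMDiffWithinAt z (hs z hz)
  have hud : DifferentiableAt ℝ u q :=
    (hus.contDiffAt (C.isOpen.mem_nhds hq)).differentiableAt (by simp)
  have hld := hasFDerivAt_stChart_logFun (hpos q hq) hud
  have hlog : stChart n (logFun Ψ) c = fun z => Real.log (u z) := rfl
  have hpp : p = stParam n c q := (stParam_stCoord hc).symm
  have e1 : timeDeriv (logFun Ψ) (stParam n c q) = (u q)⁻¹ * fderiv ℝ u q (0, 1) := by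
    rw [timeDeriv_stChart hld.differentiableAt, hld.fderiv]
    rfl
  have e2 : spaceLaplacian g (logFun Ψ) (stParam n c q) = _ :=
    spaceLaplacian_stChart hab hg hflow hls hq
  have e3 : trH g h (stParam n c q) = _ := trH_stChart hq.1
  rw [hpp, conjHeatQuotient_stChart hab hg hflow hs hq, logConjHeat, e1, e2, hlog,
    C.lap_log hus hpos hq, spaceGradNormSq_logFun hab hg hflow hq.1 (hpos q hq) hud, e3]
  have := (hpos q hq).ne'
  change (fderiv ℝ u q (0, 1) + C.lap u q + trHChart g h c q * u q) / u q =
    (u q)⁻¹ * fderiv ℝ u q (0, 1)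
      + (C.lap u q / u q - C.pair q (fderiv ℝ u q) (fderiv ℝ u q) / u q ^ 2)
      + C.pair q (fderiv ℝ u q) (fderiv ℝ u q) / u q ^ 2 + trHChart g h c q
  field_simp
  ring

variable (hΨ_lip : AssumptionLipschitz n a b Ψ)
  {rbar : ℝ} (hΨ_rad : AssumptionRadius g a b Ψ rbar)
  {K : Set (M × ℝ)} (hK : IsCompact K) (hKs : K ⊆ univ ×ˢ Ioc a b)
  (hsmall : ∀ x : M, ∀ t ∈ Ico a b, (x, t) ∉ K → Ψ (x, t) ≤ (rbar ^ n)⁻¹)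
  {φ : M × ℝ → ℝ}
  (hφ : ContMDiffOn (𝓘(ℝ, Model n).prod 𝓘(ℝ, ℝ)) 𝓘(ℝ, ℝ) ∞ φ (univ ×ˢ Ioc a b))

/-! ### The monotonicity formula -/

theorem superlevel_mono {r r' : ℝ} (hr : 0 < r) (hrr' : r ≤ r') :
    superlevel a b Ψ (r ^ n)⁻¹ ⊆ superlevel a b Ψ (r' ^ n)⁻¹ := fun _ hp =>
  ⟨hp.1, lt_of_le_of_lt (inv_anti₀ (pow_pos hr n) (pow_le_pow_left₀ hr.le hrr' n)) hp.2⟩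

include hg in
theorem integrableOn_heatball {F : M × ℝ → ℝ} {r : ℝ} (hr : 0 < r) (hrr : r ≤ rbar)
    (hF : IntegrableOn F (superlevel a b Ψ (rbar ^ n)⁻¹) (spacetimeMeasure g a b)) :
    IntegrableOn F (heatball n a b Ψ r) (spacetimeMeasure g a b) :=
  (hF.mono_set (superlevel_mono hr hrr)).congr_set_ae (heatball_ae_eq hg r)

include hab hg hflow hΨ hΨ_lip hΨ_rad hK hKs hsmall hφ in
theorem integrableOn_integrandP (r : ℝ) :
    IntegrableOn (integrandP g h φ Ψ r) (superlevel a b Ψ (rbar ^ n)⁻¹)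
      (spacetimeMeasure g a b) := by
  have hφS : ContMDiffOn (𝓘(ℝ, Model n).prod 𝓘(ℝ, ℝ)) 𝓘(ℝ, ℝ) ∞ φ (univ ×ˢ Ioo a b) :=
    hφ.mono (prod_mono_right Ioo_subset_Ioc_self)
  obtain ⟨Bφ, hBφ⟩ := hK.exists_bound_of_continuousOn (hφ.continuousOn.mono hKs)
  obtain ⟨T, hT⟩ := hK.exists_bound_of_continuousOn
    ((continuousOn_trH (h := h) hab hg hflow).mono
      (hKs.trans (prod_mono_right Ioc_subset_Icc_self)))
  have hEK := superlevel_subset (a := a) (b := b) hsmall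
  refine integrableOn_of_le_domFun (B := (1 + (1 + |n * Real.log r|) * |T|) * |Bφ|) hab hg hflow hΨ
    hΨ_lip hΨ_rad hK hKs hsmall ?_ fun p hp => ?_
  · have c1 := continuousOn_logFun hΨ hΨ_lip
    have c2 := (continuousOn_trH (h := h) hab hg hflow).mono
      (prod_mono_right (s := (univ : Set M)) Ioo_subset_Icc_self)
    exact ((aestronglyMeasurable_spaceGradNormSq hab hg hflow hΨ hΨ_lip).sub
      (aestronglyMeasurable_of_continuousOn hg ((c1.add continuousOn_const).mul c2))).mul
      (aestronglyMeasurable_of_continuousOn hg hφS.continuousOn)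
  · obtain ⟨d0, d1, d2, d3⟩ := domFun_bounds (g := g) (Ψ := Ψ) p
    have t1 : |trH g h p| ≤ |T| := (hT p (hEK hp)).trans (le_abs_self T)
    have f1 : |φ p| ≤ |Bφ| := (hBφ p (hEK hp)).trans (le_abs_self _)
    have s2 : |logFun Ψ p + n * Real.log r| ≤ (1 + |n * Real.log r|) * domFun g Ψ p := by
      refine (abs_add_le _ _).trans ?_
      rw [add_mul, one_mul]
      exact add_le_add d2 (le_mul_of_one_le_right (abs_nonneg _) d3)
    have s3 : |spaceGradNormSq g (logFun Ψ) p - (logFun Ψ p + n * Real.log r) * trH g h p|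
        ≤ (1 + (1 + |n * Real.log r|) * |T|) * domFun g Ψ p := by
      refine (abs_sub _ _).trans ?_
      rw [abs_of_nonneg d0, abs_mul, add_mul (1 : ℝ) ((1 + |n * Real.log r|) * |T|), one_mul,
        mul_right_comm (1 + |n * Real.log r|)]
      exact add_le_add d1 (mul_le_mul s2 t1 (abs_nonneg _) ((abs_nonneg _).trans s2))
    rw [integrandP, abs_mul, mul_right_comm]
    exact mul_le_mul s3 f1 (abs_nonneg _) ((abs_nonneg _).trans s3)

include hab hg hflow hΨ hΨ_lip hΨ_rad hK hKs hsmall hφ in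
theorem integrableOn_logFun_mul_heatOp (r : ℝ) :
    IntegrableOn (fun p => (logFun Ψ p + n * Real.log r) * heatOp g φ p)
      (superlevel a b Ψ (rbar ^ n)⁻¹) (spacetimeMeasure g a b) := by
  have hφS : ContMDiffOn (𝓘(ℝ, Model n).prod 𝓘(ℝ, ℝ)) 𝓘(ℝ, ℝ) ∞ φ (univ ×ˢ Ioo a b) :=
    hφ.mono (prod_mono_right Ioo_subset_Ioc_self)
  obtain ⟨H, hH0, hH⟩ := exists_bound_heatOp hab hg hflow hφ hK hKs
  refine integrableOn_of_le_domFun (B := (1 + |n * Real.log r|) * H) hab hg hflow hΨ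
    hΨ_lip hΨ_rad hK hKs hsmall ?_ fun p hp => ?_
  · exact aestronglyMeasurable_of_continuousOn hg
      (((continuousOn_logFun hΨ hΨ_lip).add continuousOn_const).mul
        (continuousOn_heatOp hab hg hflow hφS))
  · obtain ⟨-, -, d2, d3⟩ := domFun_bounds (g := g) (Ψ := Ψ) p
    have s2 : |logFun Ψ p + n * Real.log r| ≤ (1 + |n * Real.log r|) * domFun g Ψ p := by
      refine (abs_add_le _ _).trans ?_
      rw [add_mul, one_mul]
      exact add_le_add d2 (le_mul_of_one_le_right (abs_nonneg _) d3)
    rw [abs_mul, mul_right_comm]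
    exact mul_le_mul s2 (hH p (superlevel_subset hsmall hp) hp.1) (abs_nonneg _)
      ((abs_nonneg _).trans s2)

include hab hg hflow hΨ hΨ_lip hΨ_rad hK hKs hsmall hφ in
/-- The integral of `gapFun` times `φ` is the change of `P(r) / rⁿ` between two radii. -/
theorem integral_gapFun_eq_functionalP {r₀ r₁ : ℝ} (h0 : 0 < r₀) (h01 : r₀ ≤ r₁) (h1 : r₁ ≤ rbar) :
    ∫ p in superlevel a b Ψ (rbar ^ n)⁻¹, gapFun g h (r₁ ^ n)⁻¹ (r₀ ^ n)⁻¹ Ψ p * φ p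
      ∂(spacetimeMeasure g a b)
      = functionalP g h a b φ Ψ r₀ / r₀ ^ n - functionalP g h a b φ Ψ r₁ / r₁ ^ n := by
  set ν := spacetimeMeasure g a b with hν
  set E := superlevel a b Ψ (rbar ^ n)⁻¹ with hE
  have hEm : MeasurableSet E := (isOpen_superlevel hΨ_lip _).measurableSet
  have hP : ∀ r, 0 < r → r ≤ rbar → functionalP g h a b φ Ψ r / r ^ n
      = ∫ p in E, (superlevel a b Ψ (r ^ n)⁻¹).indicator
        (fun p => integrandP g h φ Ψ r p * (r ^ n)⁻¹) p ∂ν := fun r hr hrr => by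
    have hm : MeasurableSet (superlevel a b Ψ (r ^ n)⁻¹) :=
      (isOpen_superlevel hΨ_lip _).measurableSet
    rw [functionalP, setIntegral_congr_set (heatball_ae_eq hg r), integral_indicator hm,
      Measure.restrict_restrict hm, inter_eq_left.2 (superlevel_mono hr hrr), integral_mul_const,
      div_eq_mul_inv]
  have hI : ∀ r, 0 < r → r ≤ rbar → IntegrableOn ((superlevel a b Ψ (r ^ n)⁻¹).indicator
      (fun p => integrandP g h φ Ψ r p * (r ^ n)⁻¹)) E ν := fun r hr hrr =>
    Integrable.indicator ((integrableOn_integrandP hab hg hflow hΨ hΨ_lip hΨ_rad hK hKs hsmall hφ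
      r).mul_const _) (isOpen_superlevel hΨ_lip _).measurableSet
  rw [hP r₀ h0 (h01.trans h1), hP r₁ (h0.trans_le h01) h1,
    ← integral_sub (hI r₀ h0 (h01.trans h1)) (hI r₁ (h0.trans_le h01) h1)]
  refine setIntegral_congr_fun hEm fun p hp => ?_
  have hp2 : p.2 ∈ Ioo a b := hp.1
  have hpos : 0 < Ψ p := hΨ p.1 p.2 (Ioo_subset_Ico_self hp2)
  have key : ∀ r, 0 < r → (superlevel a b Ψ (r ^ n)⁻¹).indicator
      (fun p => integrandP g h φ Ψ r p * (r ^ n)⁻¹) p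
      = ((if (r ^ n)⁻¹ < Ψ p then (r ^ n)⁻¹ else 0) * spaceGradNormSq g (logFun Ψ) p
        - (r ^ n)⁻¹ * max 0 (Real.log (Ψ p) - Real.log ((r ^ n)⁻¹)) * trH g h p) * φ p := by
    intro r hr
    have hrn : 0 < (r ^ n)⁻¹ := inv_pos.2 (pow_pos hr n)
    by_cases hc : (r ^ n)⁻¹ < Ψ p
    · rw [indicator_of_mem (show p ∈ superlevel a b Ψ (r ^ n)⁻¹ from ⟨hp2, hc⟩), if_pos hc,
        max_eq_right (sub_nonneg.2 (Real.log_le_log hrn hc.le)), log_inv_pow, integrandP, logFun]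
      ring
    · rw [indicator_of_notMem (fun h' => hc h'.2), if_neg hc,
        max_eq_left (sub_nonpos.2 (Real.log_le_log hpos (not_lt.1 hc)))]
      ring
  rw [key r₀ h0, key r₁ (h0.trans_le h01), gapFun, levelB]
  ring

include hab hg hΨ hΨ_lip hΨ_rad hK hKs hsmall in
/-- The iterated integral over the radius and the heatballs as one integral with the two level
functions. -/
theorem integral_radius {r₀ r₁ : ℝ} (h0 : 0 < r₀) (h01 : r₀ ≤ r₁) (h1 : r₁ ≤ rbar)
    {x z F : M × ℝ → ℝ} {G : ℝ → M × ℝ → ℝ}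
    (hx : IntegrableOn x (superlevel a b Ψ (rbar ^ n)⁻¹) (spacetimeMeasure g a b))
    (hz : AEStronglyMeasurable z (spacetimeMeasure g a b)) {B : ℝ}
    (hB : ∀ p ∈ superlevel a b Ψ (rbar ^ n)⁻¹, |z p| ≤ B)
    (hG : ∀ r, ∀ p, p.2 ∈ Ioo a b → G r p = x p + (logFun Ψ p + n * Real.log r) * z p)
    (hF : ∀ p ∈ superlevel a b Ψ (rbar ^ n)⁻¹, F p = levelA (r₁ ^ n)⁻¹ (r₀ ^ n)⁻¹ (Ψ p) * x p
      + levelB (r₁ ^ n)⁻¹ (r₀ ^ n)⁻¹ (Ψ p) * z p) :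
    IntervalIntegrable (fun r => n / r ^ (n + 1) * ∫ p in heatball n a b Ψ r, G r p
      ∂(spacetimeMeasure g a b)) volume r₀ r₁ ∧
    ∫ r in r₀..r₁, n / r ^ (n + 1) * ∫ p in heatball n a b Ψ r, G r p ∂(spacetimeMeasure g a b)
      = ∫ p in superlevel a b Ψ (rbar ^ n)⁻¹, F p ∂(spacetimeMeasure g a b) := by
  set ν := spacetimeMeasure g a b with hν
  set E := superlevel a b Ψ (rbar ^ n)⁻¹ with hE
  have hEm : MeasurableSet E := (isOpen_superlevel hΨ_lip _).measurableSet
  have hfin : IsFiniteMeasure (ν.restrict E) := ⟨by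
    rw [Measure.restrict_apply_univ]
    exact lt_of_le_of_lt (measure_mono (superlevel_subset hsmall)) (measure_compact_lt_top hg hK)⟩
  have hu : AEMeasurable Ψ (ν.restrict E) := (aestronglyMeasurable_of_continuousOn hg
    (continuousOn_of_lipschitz hΨ_lip)).restrict.aemeasurable
  obtain ⟨s1, s2⟩ := integral_radial_swap (μ := ν.restrict E) n h0 h01 hu
    ((ae_restrict_mem hEm).mono fun p hp => hΨ p.1 p.2 (Ioo_subset_Ico_self hp.1))
    (integrableOn_logFun hab hg hΨ hΨ_lip hΨ_rad hK hKs hsmall) hx hz.restrict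
    ((ae_restrict_mem hEm).mono hB)
  have hr : ∀ r ∈ uIoc r₀ r₁, ∫ p in E, radial n (x p) (Ψ p) (z p) r ∂ν
      = n / r ^ (n + 1) * ∫ p in heatball n a b Ψ r, G r p ∂ν := by
    intro r hr
    rw [uIoc_of_le h01] at hr
    have hr0 : 0 < r := h0.trans hr.1
    have hm : MeasurableSet (superlevel a b Ψ (r ^ n)⁻¹) :=
      (isOpen_superlevel hΨ_lip _).measurableSet
    rw [setIntegral_congr_set (heatball_ae_eq hg r), ← integral_const_mul,
      ← inter_eq_left.2 (superlevel_mono (a := a) (b := b) (Ψ := Ψ) (n := n) hr0 (hr.2.trans h1)),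
      ← Measure.restrict_restrict hm, ← integral_indicator hm]
    refine setIntegral_congr_fun hEm fun p hp => ?_
    by_cases hc : (r ^ n)⁻¹ < Ψ p
    · rw [indicator_of_mem (show p ∈ superlevel a b Ψ (r ^ n)⁻¹ from ⟨hp.1, hc⟩), radial, if_pos hc,
        hG r p hp.1, logFun]
    · rw [indicator_of_notMem (fun h' => hc h'.2), radial, if_neg hc, mul_zero]
  refine ⟨s1.congr hr, ?_⟩
  rw [← intervalIntegral.integral_congr_ae (Eventually.of_forall hr), s2]
  exact (setIntegral_congr_fun hEm hF).symm

end Global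

theorem integrable_levelA_mul {α : Type*} [MeasurableSpace α] {μ : Measure α} {R₁ R₀ : ℝ}
    {u x : α → ℝ} (hu : AEMeasurable u μ) (hR : R₁ ≤ R₀) (hx : Integrable x μ) :
    Integrable (fun p => levelA R₁ R₀ (u p) * x p) μ := by
  refine hx.bdd_mul (c := R₀ - R₁) ?_ (ae_of_all _ fun p => ?_)
  · unfold levelA
    fun_prop
  · exact abs_levelA_le hR _

section Global

variable {n : ℕ} {M : Type*} [TopologicalSpace M] [T2Space M] [SecondCountableTopology M]
  [ChartedSpace (Model n) M] [IsManifold 𝓘(ℝ, Model n) ∞ M] [MeasurableSpace M] [BorelSpace M]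
  {g : ℝ → SmoothMetric n M} {h : ℝ → BilinField n M} {a b : ℝ}

variable (hab : a < b) (hg : IsSmoothFamily g a b) (hflow : EvolvesBy g h a b)
  {Ψ : M × ℝ → ℝ} (hΨ : ∀ x : M, ∀ t ∈ Ico a b, 0 < Ψ (x, t))
  (hΨ_lip : AssumptionLipschitz n a b Ψ)
  {rbar : ℝ} (hrbar : 0 < rbar) (hΨ_rad : AssumptionRadius g a b Ψ rbar)
  {K : Set (M × ℝ)} (hK : IsCompact K) (hKs : K ⊆ univ ×ˢ Ioc a b)
  (hsmall : ∀ x : M, ∀ t ∈ Ico a b, (x, t) ∉ K → Ψ (x, t) ≤ (rbar ^ n)⁻¹)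
  {φ : M × ℝ → ℝ}
  (hφ : ContMDiffOn (𝓘(ℝ, Model n).prod 𝓘(ℝ, ℝ)) 𝓘(ℝ, ℝ) ∞ φ (univ ×ˢ Ioc a b))

include hab hg hflow hΨ hΨ_lip hrbar hΨ_rad hK hKs hsmall hφ in
/-- The monotonicity formula for smooth `Ψ`. -/
theorem monotonicity_formula
    (hs : ContMDiffOn (𝓘(ℝ, Model n).prod 𝓘(ℝ, ℝ)) 𝓘(ℝ, ℝ) ∞ Ψ (univ ×ˢ Ioo a b))
    (hq : IntegrableOn (conjHeatQuotient g h Ψ) (heatball n a b Ψ rbar) (spacetimeMeasure g a b))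
    {r₀ r₁ : ℝ} (h0 : 0 < r₀) (h01 : r₀ ≤ r₁) (h1 : r₁ ≤ rbar) :
    (∀ r ∈ Icc r₀ r₁, IntegrableOn
      (fun p => -logConjHeat g h Ψ p * φ p - (logFun Ψ p + n * Real.log r) * heatOp g φ p)
      (heatball n a b Ψ r) (spacetimeMeasure g a b)) ∧
    IntervalIntegrable
      (fun r => n / r ^ (n + 1) * ∫ p in heatball n a b Ψ r,
        (-logConjHeat g h Ψ p * φ p
          - (logFun Ψ p + n * Real.log r) * heatOp g φ p) ∂(spacetimeMeasure g a b))
      volume r₀ r₁ ∧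
    functionalP g h a b φ Ψ r₁ / r₁ ^ n - functionalP g h a b φ Ψ r₀ / r₀ ^ n =
      ∫ r in r₀..r₁, n / r ^ (n + 1) * ∫ p in heatball n a b Ψ r,
        (-logConjHeat g h Ψ p * φ p
          - (logFun Ψ p + n * Real.log r) * heatOp g φ p) ∂(spacetimeMeasure g a b) := by
  set ν := spacetimeMeasure g a b with hν
  set E := superlevel a b Ψ (rbar ^ n)⁻¹ with hE
  have hEm : MeasurableSet E := (isOpen_superlevel hΨ_lip _).measurableSet
  have hφS : ContMDiffOn (𝓘(ℝ, Model n).prod 𝓘(ℝ, ℝ)) 𝓘(ℝ, ℝ) ∞ φ (univ ×ˢ Ioo a b) :=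
    hφ.mono (prod_mono_right Ioo_subset_Ioc_self)
  have hEK := superlevel_subset (a := a) (b := b) hsmall
  have hR : (r₁ ^ n)⁻¹ ≤ (r₀ ^ n)⁻¹ := inv_anti₀ (pow_pos h0 n) (pow_le_pow_left₀ h0.le h01 n)
  have hR1 : (rbar ^ n)⁻¹ ≤ (r₁ ^ n)⁻¹ :=
    inv_anti₀ (pow_pos (h0.trans_le h01) n) (pow_le_pow_left₀ (h0.trans_le h01).le h1 n)
  obtain ⟨Bφ, hBφ⟩ := hK.exists_bound_of_continuousOn (hφ.continuousOn.mono hKs)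
  obtain ⟨H, hH0, hH⟩ := exists_bound_heatOp hab hg hflow hφ hK hKs
  have hqE : IntegrableOn (conjHeatQuotient g h Ψ) E ν :=
    hq.congr_set_ae (heatball_ae_eq hg rbar).symm
  have hqφ : IntegrableOn (fun p => conjHeatQuotient g h Ψ p * φ p) E ν :=
    hqE.mul_bdd (aestronglyMeasurable_of_continuousOn hg hφS.continuousOn).restrict
      ((ae_restrict_mem hEm).mono fun p hp => hBφ p (hEK hp))
  have hu : AEMeasurable Ψ (ν.restrict E) := (aestronglyMeasurable_of_continuousOn hg
    (continuousOn_of_lipschitz hΨ_lip)).restrict.aemeasurable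
  obtain ⟨i1, i2, i3, -⟩ := integral_gapFun_superlevel hab hg hflow hΨ hΨ_lip hrbar hΨ_rad hK hKs
    hsmall hφ hR hR1
  have i4 : IntegrableOn (fun p => levelA (r₁ ^ n)⁻¹ (r₀ ^ n)⁻¹ (Ψ p)
      * (conjHeatQuotient g h Ψ p * φ p)) E ν := integrable_levelA_mul hu hR hqφ
  have hG : ∀ r, ∀ p : M × ℝ, p.2 ∈ Ioo a b →
      -logConjHeat g h Ψ p * φ p - (logFun Ψ p + n * Real.log r) * heatOp g φ p
        = -(conjHeatQuotient g h Ψ p * φ p) + (logFun Ψ p + n * Real.log r) * -heatOp g φ p :=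
    fun r p hp => by
      rw [conjHeatQuotient_eq_logConjHeat hab hg hflow hΨ hs hp]
      ring
  obtain ⟨s1, s2⟩ := integral_radius hab hg hΨ hΨ_lip hΨ_rad hK hKs hsmall h0 h01 h1
    (F := fun p => -(levelA (r₁ ^ n)⁻¹ (r₀ ^ n)⁻¹ (Ψ p) * (conjHeatQuotient g h Ψ p * φ p)
      + levelB (r₁ ^ n)⁻¹ (r₀ ^ n)⁻¹ (Ψ p) * heatOp g φ p))
    hqφ.neg (aestronglyMeasurable_of_continuousOn hg (continuousOn_heatOp hab hg hflow hφS)).neg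
    (B := H) (fun p hp => by
      rw [Pi.neg_apply, abs_neg]
      exact hH p (hEK hp) hp.1) hG fun p _ => by
        simp only [Pi.neg_apply]
        ring
  refine ⟨fun r hr => ?_, s1, ?_⟩
  · refine integrableOn_heatball hg (h0.trans_le hr.1) (hr.2.trans h1) ?_
    refine (hqφ.neg.sub (integrableOn_logFun_mul_heatOp hab hg hflow hΨ hΨ_lip hΨ_rad hK hKs hsmall
      hφ r)).congr_fun (fun p hp => ?_) hEm
    rw [hG r p hp.1, Pi.sub_apply, Pi.neg_apply]
    ring
  · rw [s2, integral_neg, integral_add i4 i2]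
    have e1 := i3 hs hqE
    have e2 := integral_gapFun_eq_functionalP hab hg hflow hΨ hΨ_lip hΨ_rad hK hKs hsmall hφ h0 h01
      h1
    simp only [mul_assoc] at e1
    linarith

include hab hg hflow hΨ hΨ_lip hrbar hΨ_rad hK hKs hsmall hφ in
/-- The monotonicity inequality for locally Lipschitz distributional subsolutions `Ψ`. -/
theorem monotonicity_inequality (hsub : IsDistribSubsolution g a b Ψ)
    (hφ0 : ∀ x : M, ∀ t ∈ Ioc a b, 0 ≤ φ (x, t))
    {r₀ r₁ : ℝ} (h0 : 0 < r₀) (h01 : r₀ ≤ r₁) (h1 : r₁ ≤ rbar) :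
    (∀ r ∈ Icc r₀ r₁, IntegrableOn
      (fun p => (logFun Ψ p + n * Real.log r) * heatOp g φ p)
      (heatball n a b Ψ r) (spacetimeMeasure g a b)) ∧
    IntervalIntegrable
      (fun r => n / r ^ (n + 1) * ∫ p in heatball n a b Ψ r,
        (logFun Ψ p + n * Real.log r) * heatOp g φ p ∂(spacetimeMeasure g a b))
      volume r₀ r₁ ∧
    functionalP g h a b φ Ψ r₁ / r₁ ^ n - functionalP g h a b φ Ψ r₀ / r₀ ^ n ≤
      -∫ r in r₀..r₁, n / r ^ (n + 1) * ∫ p in heatball n a b Ψ r,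
        (logFun Ψ p + n * Real.log r) * heatOp g φ p ∂(spacetimeMeasure g a b) := by
  have hφS : ContMDiffOn (𝓘(ℝ, Model n).prod 𝓘(ℝ, ℝ)) 𝓘(ℝ, ℝ) ∞ φ (univ ×ˢ Ioo a b) :=
    hφ.mono (prod_mono_right Ioo_subset_Ioc_self)
  have hR : (r₁ ^ n)⁻¹ ≤ (r₀ ^ n)⁻¹ := inv_anti₀ (pow_pos h0 n) (pow_le_pow_left₀ h0.le h01 n)
  have hR1 : (rbar ^ n)⁻¹ ≤ (r₁ ^ n)⁻¹ :=
    inv_anti₀ (pow_pos (h0.trans_le h01) n) (pow_le_pow_left₀ (h0.trans_le h01).le h1 n)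
  obtain ⟨H, hH0, hH⟩ := exists_bound_heatOp hab hg hflow hφ hK hKs
  obtain ⟨i1, i2, -, i3⟩ := integral_gapFun_superlevel hab hg hflow hΨ hΨ_lip hrbar hΨ_rad hK hKs
    hsmall hφ hR hR1
  obtain ⟨s1, s2⟩ := integral_radius hab hg hΨ hΨ_lip hΨ_rad hK hKs hsmall h0 h01 h1
    (x := fun _ => 0) (z := heatOp g φ) (B := H)
    (F := fun p => levelB (r₁ ^ n)⁻¹ (r₀ ^ n)⁻¹ (Ψ p) * heatOp g φ p)
    (G := fun r p => (logFun Ψ p + n * Real.log r) * heatOp g φ p)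
    integrableOn_zero
    (aestronglyMeasurable_of_continuousOn hg (continuousOn_heatOp hab hg hflow hφS))
    (fun p hp => hH p (superlevel_subset hsmall hp) hp.1) (fun r p _ => by ring)
    fun p _ => by ring
  refine ⟨fun r hr => integrableOn_heatball hg (h0.trans_le hr.1) (hr.2.trans h1)
    (integrableOn_logFun_mul_heatOp hab hg hflow hΨ hΨ_lip hΨ_rad hK hKs hsmall hφ r), s1, ?_⟩
  have e1 := i3 hsub hφ0
  have e2 := integral_gapFun_eq_functionalP hab hg hflow hΨ hΨ_lip hΨ_rad hK hKs hsmall hφ h0 h01 h1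
  rw [s2]
  linarith

end Global

end HeatBall

end

theorem mainTheorem1 {n : ℕ} {M : Type*} [TopologicalSpace M] [T2Space M]
    [SecondCountableTopology M] [ChartedSpace (Model n) M] [IsManifold 𝓘(ℝ, Model n) ∞ M]
    [MeasurableSpace M] [BorelSpace M]
    {a b : ℝ} (hab : a < b)
    -- a smooth family of complete metrics on `M` with `∂g/∂t = 2h` for `t ∈ [a, b]`
    (g : ℝ → SmoothMetric n M) (h : ℝ → BilinField n M)
    (hg : IsSmoothFamily g a b)
    (hcomplete : ∀ t ∈ Icc a b, IsCompleteMetric (g t))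
    (hflow : EvolvesBy g h a b)
    -- the positive function `Ψ` on `M × [a, b)` and the radius `rbar`
    (Ψ : M × ℝ → ℝ) (hΨ : ∀ x : M, ∀ t ∈ Ico a b, 0 < Ψ (x, t))
    (hΨ_lip : AssumptionLipschitz n a b Ψ)
    (hΨ_bdd : AssumptionBounded a b Ψ)
    {rbar : ℝ} (hrbar : 0 < rbar)
    (hΨ_rad : AssumptionRadius g a b Ψ rbar)
    (hΨ_small : IsSmallOutsideCompact n a b Ψ rbar)
    -- the smooth function `φ` on `M × (a, b]`
    (φ : M × ℝ → ℝ)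
    (hφ : ContMDiffOn (𝓘(ℝ, Model n).prod 𝓘(ℝ, ℝ)) 𝓘(ℝ, ℝ) ∞ φ (univ ×ˢ Ioc a b)) :
    -- the integrals `P(r)` converge
    (∀ r ∈ Ioc 0 rbar,
      IntegrableOn (integrandP g h φ Ψ r) (heatball n a b Ψ r) (spacetimeMeasure g a b)) ∧
    -- the identity for smooth `Ψ`
    (ContMDiffOn (𝓘(ℝ, Model n).prod 𝓘(ℝ, ℝ)) 𝓘(ℝ, ℝ) ∞ Ψ (univ ×ˢ Ico a b) →
      (∀ x : M, ∀ t ∈ Ioo a b, conjHeatQuotient g h Ψ (x, t) = logConjHeat g h Ψ (x, t)) ∧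
      (IntegrableOn (conjHeatQuotient g h Ψ) (heatball n a b Ψ rbar) (spacetimeMeasure g a b) →
        ∀ r₀ r₁ : ℝ, 0 < r₀ → r₀ < r₁ → r₁ ≤ rbar →
          (∀ r ∈ Icc r₀ r₁, IntegrableOn
            (fun p => -logConjHeat g h Ψ p * φ p
              - (logFun Ψ p + n * Real.log r) * heatOp g φ p)
            (heatball n a b Ψ r) (spacetimeMeasure g a b)) ∧
          IntervalIntegrable
            (fun r => n / r ^ (n + 1) * ∫ p in heatball n a b Ψ r,
              (-logConjHeat g h Ψ p * φ p
                - (logFun Ψ p + n * Real.log r) * heatOp g φ p) ∂(spacetimeMeasure g a b))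
            volume r₀ r₁ ∧
          functionalP g h a b φ Ψ r₁ / r₁ ^ n - functionalP g h a b φ Ψ r₀ / r₀ ^ n =
            ∫ r in r₀..r₁, n / r ^ (n + 1) * ∫ p in heatball n a b Ψ r,
              (-logConjHeat g h Ψ p * φ p
                - (logFun Ψ p + n * Real.log r) * heatOp g φ p) ∂(spacetimeMeasure g a b))) ∧
    -- the inequality for locally Lipschitz `Ψ`
    (IsDistribSubsolution g a b Ψ → (∀ x : M, ∀ t ∈ Ioc a b, 0 ≤ φ (x, t)) →
      ∀ r₀ r₁ : ℝ, 0 < r₀ → r₀ < r₁ → r₁ ≤ rbar →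
        (∀ r ∈ Icc r₀ r₁, IntegrableOn
          (fun p => (logFun Ψ p + n * Real.log r) * heatOp g φ p)
          (heatball n a b Ψ r) (spacetimeMeasure g a b)) ∧
        IntervalIntegrable
          (fun r => n / r ^ (n + 1) * ∫ p in heatball n a b Ψ r,
            (logFun Ψ p + n * Real.log r) * heatOp g φ p ∂(spacetimeMeasure g a b))
          volume r₀ r₁ ∧
        functionalP g h a b φ Ψ r₁ / r₁ ^ n - functionalP g h a b φ Ψ r₀ / r₀ ^ n ≤
          -∫ r in r₀..r₁, n / r ^ (n + 1) * ∫ p in heatball n a b Ψ r,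
            (logFun Ψ p + n * Real.log r) * heatOp g φ p ∂(spacetimeMeasure g a b)) := by
  obtain ⟨K, hK, hKs, hsmall⟩ := hΨ_small
  refine ⟨fun r hr => integrableOn_heatball hg hr.1 hr.2 (integrableOn_integrandP hab hg hflow hΨ
    hΨ_lip hΨ_rad hK hKs hsmall hφ r), fun hs => ?_, fun hsub hφ0 r₀ r₁ h0 h01 h1 =>
    monotonicity_inequality hab hg hflow hΨ hΨ_lip hrbar hΨ_rad hK hKs hsmall hφ hsub hφ0 h0 h01.le
      h1⟩
  have hs' := hs.mono (prod_mono_right Ioo_subset_Ico_self)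
  exact ⟨fun x t ht => conjHeatQuotient_eq_logConjHeat hab hg hflow hΨ hs' ht,
    fun hq r₀ r₁ h0 h01 h1 => monotonicity_formula hab hg hflow hΨ hΨ_lip hrbar hΨ_rad hK hKs
      hsmall hφ hs' hq h0 h01.le h1⟩
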